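/- \textbf{Theorem (Feasibility via shadow simplex).} There is an absolute constant $C>0$ such that the following holds for all integers $n\ge 1$, $m\ge 0$ and all $b\in\mathbb R^m$. Write $P=\{x\in\mathbb R^n: Ax\le b\}$. A linearly independent family $v_1,\dots,v_k\in\mathbb R^n$ has the \emph{$\delta$-distance property} if, for every $i$, the Euclidean distance from $v_i$ to the span of the other $v_j$ is at least $\delta\|v_i\|$; a real matrix has the \emph{global $\delta$-distance property} if every linearly independent set of its rows has the $\delta$-distance property. A \emph{shadow simplex pivot} is one exchange step $B\mapsto (B\setminus\{i\})\cup\{j\}$ of the simplex method on a polyhedron, or on one of its faces, while the objective moves along a segment $[c,d]$: $i$ is the first index of the current optimal basis $B$ whose coefficient in the expansion of the moving objective in the rows of $B$ becomes negative before $d$ is reached, and $j$ is determined by the ratio test along the corresponding edge, for right-hand sides that are perturbed symbolically by distinct powers of an infinitesimal $\varepsilon>0$. The perturbation is fixed at the beginning of each optimization, with the highest powers on the rows of the initial basis. The algorithms below are explicit randomized algorithms whose optimizations are carried out by such pivots, along segments determined by vectors sampled from the exponential distribution (density proportional to $e^{-\|x\|}$) on $\mathbb R^k$ conditioned on $\|x\|\le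 2k$, with $1\le k\le n$ in (1) and $1\le k\le n+1$ in (2). Besides the pivots they perform only elementary linear algebra and ray casting. \begin{enumerate} \item Let $A\in\mathbb R^{m\times n}$ have full column rank and the global $\delta$-distance property, $\delta>0$. Given $A,b,\delta$, the algorithm almost surely returns either a feasible basis of $P$ together with the point $x\in P$ it defines, or a certificate of infeasibility, i.e.\ $y\in\mathbb R^m$ with $y\ge 0$, $y^{T}A=0$, $y^{T}b<0$. The expected number of shadow simplex pivots is at most $$C\cdot\frac{m n^3}{\delta}\Bigl(1+\ln\frac n\delta\Bigr).$$ \item Let $A\in\mathbb Z^{m\times n}$ have full column rank, and let all its subdeterminants be bounded by $\Delta$ in absolute value. Given $A,b,\Delta$, the algorithm almost surely returns an answer of the same kind, and the expected number of shadow simplex pivots is at most $$C\cdot n^5\Delta^2\bigl(1+\ln(n\Delta)\bigr),$$ independently of $m$. \end{enumerate} For $n\ge 2$ these bounds are $O\bigl(\tfrac{mn^3}{\delta}\ln\tfrac n\delta\bigr)$ and $O\bigl(n^5\Delta^2\ln(n\Delta)\bigr)$; the summand $1$ matters only for $n=1$, where the logarithms can vanish. -/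

import Mathlib

namespace ShadowSimplex

open MeasureTheory
open scoped ENNReal Topology Classical

noncomputable section

/-! ### The distance property -/

/-- The `δ`-distance property of a family of (linearly independent) vectors: every `v i` has
Euclidean distance at least `δ * ‖v i‖` from the span of the others. -/
def DeltaDistance {ι : Type} {n : ℕ} (δ : ℝ) (v : ι → EuclideanSpace ℝ (Fin n)) : Prop :=
  ∀ i, δ * ‖v i‖ ≤
    Metric.infDist (v i) (Submodule.span ℝ (v '' {j | j ≠ i}) : Set (EuclideanSpace ℝ (Fin n)))

/-- The rows of a matrix as vectors of Euclidean space. -/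
def row {m n : ℕ} (A : Matrix (Fin m) (Fin n) ℝ) (i : Fin m) : EuclideanSpace ℝ (Fin n) :=
  WithLp.toLp 2 (A i)

/-- The global `δ`-distance property of a matrix: every linearly independent set of rows has the
`δ`-distance property. -/
def GlobalDeltaDistance {m n : ℕ} (δ : ℝ) (A : Matrix (Fin m) (Fin n) ℝ) : Prop :=
  ∀ s : Set (Fin m), LinearIndependent ℝ (fun i : s => row A i) →
    DeltaDistance δ (fun i : s => row A i)

/-! ### Linear systems, bases, and linear algebra at a basis -/

/-- The polyhedron `{x | ⟪a i, x⟫ ≤ b i for all i ∈ active}`. -/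
structure LinSys (M n : ℕ) where
  a : Fin M → EuclideanSpace ℝ (Fin n)
  b : Fin M → ℝ
  active : Finset (Fin M)

/-- The smallest index in `s` with property `p`, if there is one. -/
def firstSuch {M : ℕ} (s : Finset (Fin M)) (p : Fin M → Prop) : Option (Fin M) :=
  if h : (s.filter p).Nonempty then some ((s.filter p).min' h) else none

/-- The solution `x` of the linear system `⟪a i, x⟫ = r i`, `i ∈ B` (unique if `B` is a basis). -/
def solve {M n : ℕ} (a : Fin M → EuclideanSpace ℝ (Fin n)) (B : Finset (Fin M))
    (r : Fin M → ℝ) : EuclideanSpace ℝ (Fin n) :=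
  if h : ∃ x : EuclideanSpace ℝ (Fin n), ∀ i ∈ B, inner ℝ (a i) x = r i then h.choose else 0

/-- The coefficients of `d` as a linear combination of the `a i`, `i ∈ B` (unique if `B` is a
basis). -/
def coords {M n : ℕ} (a : Fin M → EuclideanSpace ℝ (Fin n)) (B : Finset (Fin M))
    (d : EuclideanSpace ℝ (Fin n)) : Fin M → ℝ :=
  if h : ∃ f : Fin M → ℝ, (∀ i, i ∉ B → f i = 0) ∧ ∑ i ∈ B, f i • a i = d then h.choose else 0

/-- The orthogonal complement of the span of the `a i`, `i ∈ S`. -/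
def orth {M n : ℕ} (a : Fin M → EuclideanSpace ℝ (Fin n)) (S : Finset (Fin M)) :
    Submodule ℝ (EuclideanSpace ℝ (Fin n)) :=
  (Submodule.span ℝ (a '' (S : Set (Fin M))))ᗮ

/-- The orthogonal projection onto `orth a S`. -/
def proj {M n : ℕ} (a : Fin M → EuclideanSpace ℝ (Fin n)) (S : Finset (Fin M))
    (v : EuclideanSpace ℝ (Fin n)) : EuclideanSpace ℝ (Fin n) :=
  (orth a S).starProjection v

/-- The basis found by Gauss elimination: the rows outside the span of the preceding rows. -/
def greedyBasis {M n : ℕ} (a : Fin M → EuclideanSpace ℝ (Fin n)) : Finset (Fin M) :=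
  Finset.univ.filter fun i => a i ∉ Submodule.span ℝ (a '' {j | j < i})

/-! ### The shadow simplex method with symbolic perturbation

A face of the polyhedron is described by a set `S` of constraints that are required to be tight;
these never leave the basis. For `i ∈ B \ S`, the coefficient of `a i` in the expansion of a vector
`c` in the basis `B` is also the coefficient of the projection of `a i` in the expansion of the
projection of `c` to `orth a S`. -/

/-- The perturbed right hand sides; the rows of `B₀` are perturbed by the highest powers of `ε`. -/
def perturbed {M n : ℕ} (L : LinSys M n) (B₀ : Finset (Fin M)) (ε : ℝ) (i : Fin M) : ℝ :=
  L.b i + ε ^ (if i ∈ B₀ then M + (i : ℕ) + 1 else (i : ℕ) + 1)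

/-- The index that leaves the basis `B` on the way from the objective `c` to the objective `d`:
the minimizer of `c i / (c i - d i)` over `i ∈ B \ S` with `c i > d i`, provided that the minimum
is less than `1`. Here `c i`, `d i` are the coefficients in the basis `B`. -/
def leaving {M n : ℕ} (L : LinSys M n) (S : Finset (Fin M)) (c d : EuclideanSpace ℝ (Fin n))
    (B : Finset (Fin M)) : Option (Fin M) :=
  let γ := coords L.a B c
  let η := coords L.a B d
  firstSuch (B \ S) fun i =>
    η i < γ i ∧ γ i / (γ i - η i) < 1 ∧
      ∀ k ∈ B \ S, η k < γ k → γ i / (γ i - η i) ≤ γ k / (γ k - η k)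

/-- The direction of the edge along which the constraint `i ∈ B` becomes slack. -/
def edgeDir {M n : ℕ} (L : LinSys M n) (B : Finset (Fin M)) (i : Fin M) :
    EuclideanSpace ℝ (Fin n) :=
  solve L.a B (Pi.single i (-1))

/-- The distance (along the edge) to the constraint `j` in the perturbed polyhedron. -/
def ratio {M n : ℕ} (L : LinSys M n) (B₀ B : Finset (Fin M)) (i j : Fin M) (ε : ℝ) : ℝ :=
  (perturbed L B₀ ε j - inner ℝ (L.a j) (solve L.a B (perturbed L B₀ ε))) /
    inner ℝ (L.a j) (edgeDir L B i)

/-- The index that enters the basis when `i` leaves: the ratio test, where the ratios are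
compared for all sufficiently small `ε > 0`. -/
def entering {M n : ℕ} (L : LinSys M n) (B₀ B : Finset (Fin M)) (i : Fin M) : Option (Fin M) :=
  firstSuch (L.active \ B) fun j =>
    0 < inner ℝ (L.a j) (edgeDir L B i) ∧
      ∀ k ∈ L.active \ B, 0 < inner ℝ (L.a k) (edgeDir L B i) →
        ∀ᶠ ε in 𝓝[>] (0 : ℝ), ratio L B₀ B i j ε ≤ ratio L B₀ B i k ε

/-- One shadow simplex pivot along the segment `[c, d]`; `none` if the method stops at `B`. -/
def pivot {M n : ℕ} (L : LinSys M n) (B₀ S : Finset (Fin M)) (c d : EuclideanSpace ℝ (Fin n))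
    (B : Finset (Fin M)) : Option (Finset (Fin M)) :=
  (leaving L S c d B).bind fun i => (entering L B₀ B i).map fun j => insert j (B.erase i)

/-- The result of a computation together with the number of shadow simplex pivots performed
(`⊤` if it does not terminate). -/
structure Outcome (α : Type) where
  result : α
  pivots : ℕ∞

instance (α : Type) : MeasurableSpace (Outcome α) := ⊤

/-- Account for `N` pivots performed earlier. -/
def Outcome.add {α : Type} (N : ℕ∞) (o : Outcome α) : Outcome α := ⟨o.result, N + o.pivots⟩

/-- Follow the segment `[c, d]`, starting at the basis `B`: the last basis and the number of
pivots. -/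
def follow {M n : ℕ} (L : LinSys M n) (B₀ S : Finset (Fin M)) (c d : EuclideanSpace ℝ (Fin n))
    (B : Finset (Fin M)) : Outcome (Finset (Fin M)) :=
  let next := fun B' => (pivot L B₀ S c d B').getD B'
  let N : ℕ∞ := {t : ℕ | (pivot L B₀ S c d (next^[t] B)).isSome}.encard
  ⟨next^[N.toNat] B, N⟩

/-! ### Optimization over a polytope -/

/-- The exponential distribution on `ℝ^k` (density proportional to `exp (-‖x‖)`), conditioned on
`‖x‖ ≤ 2 k`. -/
def truncExp (k : ℕ) : Measure (EuclideanSpace ℝ (Fin k)) :=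
  ProbabilityTheory.cond (volume.withDensity fun x => ENNReal.ofReal (Real.exp (-‖x‖)))
    (Metric.closedBall 0 (2 * (k : ℝ)))

/-- A vector of a `k`-dimensional subspace `W`, given by its coordinates in an orthonormal basis.
(The law of `ofCoords W x` for `x` distributed as `truncExp k` does not depend on the basis.) -/
def ofCoords {n : ℕ} (W : Submodule ℝ (EuclideanSpace ℝ (Fin n)))
    (x : EuclideanSpace ℝ (Fin (Module.finrank ℝ W))) : EuclideanSpace ℝ (Fin n) :=
  ((stdOrthonormalBasis ℝ W).repr.symm x : W)

/-- Follow the segments `[c, c + X]`, `[c + X, d + X]` and `[d + X, e]`, starting at `B`. -/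
def threeLegs {M n : ℕ} (L : LinSys M n) (B₀ S : Finset (Fin M))
    (c d e X : EuclideanSpace ℝ (Fin n)) (B : Finset (Fin M)) : Outcome (Finset (Fin M)) :=
  let o₁ := follow L B₀ S c (c + X) B
  let o₂ := follow L B₀ S (c + X) (d + X) o₁.result
  let o₃ := follow L B₀ S (d + X) e o₂.result
  ⟨o₃.result, o₁.pivots + o₂.pivots + o₃.pivots⟩

/-- Maximize `⟪d, x⟫` over the face of the polytope on which the constraints in `S` are tight,
starting at the basis `B ⊇ S`. The face lies in a translate of `orth a S`, of dimension `k`. After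
the three segments have been followed, a row `i` whose normalized coefficient in the current
objective exceeds `1 / k` is made tight, and the method recurses on the facet defined by `i`. The
first argument bounds the depth of the recursion. -/
def optimizeFace {M n : ℕ} (L : LinSys M n) (B₀ : Finset (Fin M)) (δ : ℝ)
    (d : EuclideanSpace ℝ (Fin n)) :
    ℕ → Finset (Fin M) → Finset (Fin M) → Measure (Outcome (Finset (Fin M)))
  | 0, _, B => Measure.dirac ⟨B, 0⟩
  | t + 1, S, B =>
    let π := proj L.a S
    let k := Module.finrank ℝ (orth L.a S)
    if π d = 0 then Measure.dirac ⟨B, 0⟩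
    else
      let c := ∑ i ∈ B \ S, ‖π (L.a i)‖⁻¹ • π (L.a i)
      let d₁ := (2 / ‖π d‖) • π d
      (truncExp k).bind fun x =>
        let X := ofCoords (orth L.a S) x
        let e := d₁ + (δ / (2 * (k : ℝ) ^ 3)) • X
        let o := threeLegs L B₀ S c d₁ e X B
        match firstSuch (o.result \ S)
            (fun i => 1 / (k : ℝ) < coords L.a o.result e i * ‖π (L.a i)‖) with
        | none => Measure.dirac o
        | some i => (optimizeFace L B₀ δ d t (insert i S) o.result).map (Outcome.add o.pivots)

/-- Maximize `⟪d, x⟫` over a polytope, starting at the feasible basis `B`: the law of the final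
basis and of the number of pivots. -/
def optimize {M n : ℕ} (L : LinSys M n) (δ : ℝ) (B : Finset (Fin M))
    (d : EuclideanSpace ℝ (Fin n)) : Measure (Outcome (Finset (Fin M))) :=
  optimizeFace L B δ d n ∅ B

/-! ### Removing unboundedness, and ray casting -/

/-- The system with the additional constraints `⟪a i, x⟫ ≥ - n ‖a i‖ bmax / δ - 1`, `i` active,
where `bmax` is the maximum of `|b i| / ‖a i‖` over all `i`. Row `i` becomes row `Fin.castAdd M i`
and its new companion is row `Fin.natAdd M i`. -/
def boxed {M n : ℕ} (L : LinSys M n) (δ : ℝ) : LinSys (M + M) n where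
  a := Fin.append L.a fun i => -L.a i
  b := Fin.append L.b fun i => (n : ℝ) * ‖L.a i‖ * (⨆ j, |L.b j| / ‖L.a j‖) / δ + 1
  active := L.active.image (Fin.castAdd M) ∪ L.active.image (Fin.natAdd M)

/-- Maximize `⟪d, x⟫` over the boxed system, starting at a feasible basis `B` of `L`. -/
def optimizeBoxed {M n : ℕ} (L : LinSys M n) (δ : ℝ) (B : Finset (Fin M))
    (d : EuclideanSpace ℝ (Fin n)) : Measure (Outcome (Finset (Fin (M + M)))) :=
  optimize (boxed L δ) δ (B.image (Fin.castAdd M)) d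

/-- One step of ray casting from the feasible point `x`, at which the constraints in `T` are tight:
move within these tight constraints, in the direction of the projection of an active row outside
their span, until another active constraint becomes tight. -/
def rayCastStep {M n : ℕ} (L : LinSys M n)
    (p : Finset (Fin M) × EuclideanSpace ℝ (Fin n)) :
    Finset (Fin M) × EuclideanSpace ℝ (Fin n) :=
  match firstSuch L.active (fun j => proj L.a p.1 (L.a j) ≠ 0) with
  | none => p
  | some j =>
    let z := proj L.a p.1 (L.a j)
    let ρ := fun k => (L.b k - inner ℝ (L.a k) p.2) / inner ℝ (L.a k) z
    match firstSuch L.active (fun k => 0 < inner ℝ (L.a k) z ∧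
        ∀ l ∈ L.active, 0 < inner ℝ (L.a l) z → ρ k ≤ ρ l) with
    | none => p
    | some k => (insert k p.1, p.2 + ρ k • z)

/-- Round the feasible point `x` to a feasible basis (without any pivots). -/
def rayCast {M n : ℕ} (L : LinSys M n) (x : EuclideanSpace ℝ (Fin n)) : Finset (Fin M) :=
  ((rayCastStep L)^[n] (∅, x)).1

/-! ### Feasibility -/

/-- The answer of a feasibility algorithm: a point together with a basis, or multipliers that
certify infeasibility. -/
inductive Answer (m n : ℕ) : Type
  | feasible (x : Fin n → ℝ) (B : Finset (Fin m))
  | infeasible (y : Fin m → ℝ)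

/-- `x` satisfies `A x ≤ b` and `B` is a feasible basis defining `x`; respectively, `y` is a Farkas
certificate for the infeasibility of `A x ≤ b`. -/
def Answer.Correct {m n : ℕ} (A : Matrix (Fin m) (Fin n) ℝ) (b : Fin m → ℝ) :
    Answer m n → Prop
  | .feasible x B =>
      (∀ i, (A.mulVec x) i ≤ b i) ∧ LinearIndependent ℝ (fun i : B => A i) ∧ B.card = n ∧
        ∀ i ∈ B, (A.mulVec x) i = b i
  | .infeasible y => (∀ i, 0 ≤ y i) ∧ Matrix.vecMul y A = 0 ∧ dotProduct y b < 0

/-- Add the constraints in the list one at a time. `B` is a feasible basis of the system consisting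
of the constraints in `I`; the next constraint `i` is dealt with by minimizing `⟪a i, x⟫` over the
(boxed) system `I`. -/
def addConstraints {m n : ℕ} (A : Matrix (Fin m) (Fin n) ℝ) (b : Fin m → ℝ) (δ : ℝ) :
    List (Fin m) → Finset (Fin m) → Finset (Fin m) → Measure (Outcome (Answer m n))
  | [], _, B => Measure.dirac ⟨.feasible (WithLp.ofLp (solve (row A) B b)) B, 0⟩
  | i :: l, I, B =>
    if i ∈ I then addConstraints A b δ l I B
    else
      let L : LinSys m n := ⟨row A, b, I⟩
      (optimizeBoxed L δ B (-row A i)).bind fun o =>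
        let x := solve (boxed L δ).a o.result (boxed L δ).b
        if b i < inner ℝ (row A i) x then
          let β := coords (boxed L δ).a o.result (-row A i)
          Measure.dirac
            ⟨.infeasible (fun j => β (Fin.castAdd m j) + if j = i then 1 else 0), o.pivots⟩
        else
          (addConstraints A b δ l (insert i I)
            (rayCast ⟨row A, b, insert i I⟩ x)).map (Outcome.add o.pivots)

/-- Shadow simplex feasibility algorithm for `A x ≤ b`, where `A` satisfies the global
`δ`-distance property: the law of its answer and of its number of pivots. -/
def feasibility {m n : ℕ} (A : Matrix (Fin m) (Fin n) ℝ) (b : Fin m → ℝ) (δ : ℝ) :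
    Measure (Outcome (Answer m n)) :=
  addConstraints A b δ (List.finRange m) (greedyBasis (row A)) (greedyBasis (row A))

/-- The constraints `A x - s ≤ b`, `- s ≤ 0` in the variables `(x, s)`. -/
def slackSystem {m n : ℕ} (A : Matrix (Fin m) (Fin n) ℝ) (b : Fin m → ℝ) :
    LinSys (m + 1) (n + 1) where
  a := Fin.snoc (α := fun _ => EuclideanSpace ℝ (Fin (n + 1)))
    (fun i => WithLp.toLp 2 (Fin.snoc (α := fun _ => ℝ) (A i) (-1)))
    (WithLp.toLp 2 (Fin.snoc (α := fun _ => ℝ) (fun _ => 0) (-1)))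
  b := Fin.snoc (α := fun _ => ℝ) b 0
  active := Finset.univ

/-- Shadow simplex feasibility algorithm for `A x ≤ b`, where `A` is integral with
subdeterminants bounded by `Δ`: minimize `s` subject to `A x - s ≤ b`, `s ≥ 0`, using that this
system has the global distance property with parameter `1 / ((n + 1) Δ)^2`. -/
def integralFeasibility {m n : ℕ} (A : Matrix (Fin m) (Fin n) ℤ) (b : Fin m → ℝ) (Δ : ℝ) :
    Measure (Outcome (Answer m n)) :=
  let A' : Matrix (Fin m) (Fin n) ℝ := A.map (Int.cast : ℤ → ℝ)
  let L := slackSystem A' b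
  let δ : ℝ := 1 / (((n : ℝ) + 1) * Δ) ^ 2
  let start : EuclideanSpace ℝ (Fin (n + 1)) :=
    WithLp.toLp 2 (Fin.snoc (α := fun _ => ℝ) (fun _ => 0) (max 0 (⨆ i, -b i)))
  let d : EuclideanSpace ℝ (Fin (n + 1)) :=
    WithLp.toLp 2 (Fin.snoc (α := fun _ => ℝ) (fun _ => 0) (-1))
  (optimizeBoxed L δ (rayCast L start) d).bind fun o =>
    let z := solve (boxed L δ).a o.result (boxed L δ).b
    if 0 < z (Fin.last n) then
      let β := coords (boxed L δ).a o.result d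
      Measure.dirac
        ⟨.infeasible (fun j => β (Fin.castAdd (m + 1) (Fin.castSucc j))), o.pivots⟩
    else
      let x : EuclideanSpace ℝ (Fin n) := WithLp.toLp 2 fun j => z (Fin.castSucc j)
      let B := rayCast ⟨row A', b, Finset.univ⟩ x
      Measure.dirac ⟨.feasible (WithLp.ofLp (solve (row A') B b)) B, o.pivots⟩

end

end ShadowSimplex

/-!
Correctness of both algorithms reduces to linear programming duality; the bounds reduce to an
estimate of the expected number of pivots along one random segment.

Pivots. Since the rows of the initial basis carry the highest powers of `ε`, that basis is feasible
for the perturbed system, and since the exponents are distinct, no vertex of the perturbed system is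
degenerate (`IsVertex`). The cones spanned by the rows of the feasible bases of a face therefore
have disjoint interiors, and each pivot replaces the cone containing the moving objective by the
adjacent one that the segment enters. Every pivot increases the value of the objective at the end of
the segment, so the method halts (`follow_spec`), and on a bounded polyhedron it stops at a basis
that is optimal for the end of the segment (`IsOptimal.follow`).

Expected number of pivots. The number of pivots is at most the number of facets of the cones through
which the segment leaves, counted over all feasible bases. Consider a segment `{x + p + r • h | α ≤
r ≤ β}` with `x` exponentially distributed; almost surely it avoids the faces of codimension two.
The probability of leaving a cone through the facet opposite to its generator `u i` is estimated by
Tonelli's theorem on the lines in direction `u i` (`lintegral_facetCrossing_le`): the crossing point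
moves at speed `|γ i h|`, where `γ i` is the functional dual to `u i`, while the density decays at
rate at most `‖u i‖` along the ray from the crossing point into the cone. By the distance property
`|γ i h| * ‖u i‖ ≤ ‖h‖ / δ`, and as the cones are disjoint, the sum over all cones is at most a
multiple of the dimension times `‖h‖ / δ` (`lintegral_translated_leg_le`). On the first and third
segments the crossings have the form `p + t • X`, where `X` is the random vector. Dividing by `t`
yields the segment `X + r • p` with `r = 1 / t`, on which the speed of a crossing at time `r` is of
order `‖X‖ / (δ * r)`; integrating `1 / r` produces the logarithm (`lintegral_radial_leg_le`).

Descending to facets. If, in the final objective, no normalized coefficient exceeds `1 / k`, then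
the final objective has norm at most `1`, while it is within distance `1` of the scaled objective,
whose norm is `2`; so it is half of that, and the basis is optimal for the objective proper.
Otherwise the row with the large coefficient is tight at some optimum, so that it may be fixed
(`IsOptimal.of_tightRow_eq_none`, `IsOptimal.exists_of_tightRow_eq_some`). This takes at most `n`
levels, each costing `levelCost n δ`.

Feasibility. The box is so large that it does not cut off any basic solution. A positive multiplier
of one of its constraints at the optimum would thus mean that the problem is unbounded without the
box; when a new constraint cannot be satisfied, or the least slack is positive, this is impossible,
so the optimal multipliers form a Farkas certificate (`IsOptimal.coords_natAdd_eq_zero`). In the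
other case, ray casting turns the optimum into a feasible basis (`isFeasibleBasis_rayCast`). For an
integral matrix, Cramer's rule bounds the entries of the edges of the system with a slack variable
by minors, which yields its distance property (`wide_slackMatrix`).
-/

namespace ShadowSimplex

open MeasureTheory
open scoped ENNReal Topology Classical

/-! ### Bases of row vectors -/

/-- `B` indexes a basis of `ℝ^n` among the vectors `a i`. -/
structure IsBasis {M n : ℕ} (a : Fin M → EuclideanSpace ℝ (Fin n)) (B : Finset (Fin M)) :
    Prop where
  linInd : LinearIndepOn ℝ a (B : Set (Fin M))
  card : B.card = n

section Basis

variable {M n : ℕ} {a : Fin M → EuclideanSpace ℝ (Fin n)} {B S : Finset (Fin M)}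

theorem IsBasis.span_eq_top (hB : IsBasis a B) :
    Submodule.span ℝ (a '' (B : Set (Fin M))) = ⊤ := by
  have h := LinearIndependent.span_eq_top_of_card_eq_finrank' (b := fun i : B => a i)
    hB.linInd (by simp [hB.card])
  rwa [Set.image_eq_range]

theorem IsBasis.eq_zero_of_inner (hB : IsBasis a B) {x : EuclideanSpace ℝ (Fin n)}
    (hx : ∀ i ∈ B, inner ℝ (a i) x = 0) : x = 0 := by
  have h : x ∈ (Submodule.span ℝ (a '' (B : Set (Fin M))))ᗮ := by
    rw [Submodule.mem_orthogonal]
    intro u hu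
    induction hu using Submodule.span_induction with
    | mem y hy => obtain ⟨i, hi, rfl⟩ := hy; exact hx i hi
    | zero => simp
    | add y z _ _ hy hz => rw [inner_add_left, hy, hz, add_zero]
    | smul r y _ hy => rw [inner_smul_left, hy, mul_zero]
  rw [hB.span_eq_top] at h
  simpa using h

theorem IsBasis.exists_coords (hB : IsBasis a B) (d : EuclideanSpace ℝ (Fin n)) :
    ∃ f : Fin M → ℝ, (∀ i, i ∉ B → f i = 0) ∧ ∑ i ∈ B, f i • a i = d := by
  have h : d ∈ Submodule.span ℝ (a '' (B : Set (Fin M))) := by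
    rw [hB.span_eq_top]; trivial
  obtain ⟨f, hf⟩ := (Submodule.mem_span_image_finset_iff_exists_fun ℝ).1 h
  refine ⟨fun i => if hi : i ∈ B then f ⟨i, hi⟩ else 0, fun i hi => by simp [hi], ?_⟩
  rw [← hf, ← Finset.sum_coe_sort B]
  exact Finset.sum_congr rfl fun i _ => by simp

theorem IsBasis.coords_of_notMem (hB : IsBasis a B) (d : EuclideanSpace ℝ (Fin n)) {i : Fin M}
    (hi : i ∉ B) : coords a B d i = 0 := by
  rw [coords, dif_pos (hB.exists_coords d)]
  exact (hB.exists_coords d).choose_spec.1 i hi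

theorem IsBasis.sum_coords (hB : IsBasis a B) (d : EuclideanSpace ℝ (Fin n)) :
    ∑ i ∈ B, coords a B d i • a i = d := by
  rw [coords, dif_pos (hB.exists_coords d)]
  exact (hB.exists_coords d).choose_spec.2

theorem IsBasis.coords_eq (hB : IsBasis a B) {d : EuclideanSpace ℝ (Fin n)} {f : Fin M → ℝ}
    (hf : ∑ i ∈ B, f i • a i = d) {i : Fin M} (hi : i ∈ B) : coords a B d i = f i := by
  have h := linearIndepOn_finset_iff.1 hB.linInd (fun i => coords a B d i - f i)
    (by simp only [sub_smul, Finset.sum_sub_distrib, hB.sum_coords, hf, sub_self]) i hi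
  exact sub_eq_zero.1 h

theorem IsBasis.exists_solve (hB : IsBasis a B) (r : Fin M → ℝ) :
    ∃ x : EuclideanSpace ℝ (Fin n), ∀ i ∈ B, inner ℝ (a i) x = r i := by
  let T : EuclideanSpace ℝ (Fin n) →ₗ[ℝ] (B → ℝ) :=
    LinearMap.pi fun i : B => (innerSL ℝ (a i)).toLinearMap
  have hinj : Function.Injective T := by
    rw [← LinearMap.ker_eq_bot, LinearMap.ker_eq_bot']
    intro x hx
    exact hB.eq_zero_of_inner fun i hi => congrFun hx ⟨i, hi⟩
  have hsurj : Function.Surjective T :=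
    (LinearMap.injective_iff_surjective_of_finrank_eq_finrank (by simp [hB.card])).1 hinj
  obtain ⟨x, hx⟩ := hsurj fun i => r i
  exact ⟨x, fun i hi => congrFun hx ⟨i, hi⟩⟩

theorem IsBasis.inner_solve (hB : IsBasis a B) (r : Fin M → ℝ) {i : Fin M} (hi : i ∈ B) :
    inner ℝ (a i) (solve a B r) = r i := by
  rw [solve, dif_pos (hB.exists_solve r)]
  exact (hB.exists_solve r).choose_spec i hi

theorem IsBasis.eq_solve (hB : IsBasis a B) {r : Fin M → ℝ} {x : EuclideanSpace ℝ (Fin n)}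
    (hx : ∀ i ∈ B, inner ℝ (a i) x = r i) : x = solve a B r := by
  rw [← sub_eq_zero]
  refine hB.eq_zero_of_inner fun i hi => ?_
  rw [inner_sub_right, hx i hi, hB.inner_solve r hi, sub_self]

theorem IsBasis.inner_eq_sum (hB : IsBasis a B) (d x : EuclideanSpace ℝ (Fin n)) :
    inner ℝ d x = ∑ i ∈ B, coords a B d i * inner ℝ (a i) x := by
  conv_lhs => rw [← hB.sum_coords d]
  simp [sum_inner, inner_smul_left]

/-- The edge direction of a basis, for a bare family of vectors. -/
noncomputable def edge (a : Fin M → EuclideanSpace ℝ (Fin n)) (B : Finset (Fin M)) (i : Fin M) :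
    EuclideanSpace ℝ (Fin n) :=
  solve a B (Pi.single i (-1))

theorem IsBasis.inner_edge_self (hB : IsBasis a B) {i : Fin M} (hi : i ∈ B) :
    inner ℝ (a i) (edge a B i) = -1 := by
  rw [edge, hB.inner_solve _ hi, Pi.single_eq_same]

theorem IsBasis.inner_edge_of_ne (hB : IsBasis a B) {i j : Fin M} (hj : j ∈ B) (hij : j ≠ i) :
    inner ℝ (a j) (edge a B i) = 0 := by
  rw [edge, hB.inner_solve _ hj, Pi.single_eq_of_ne hij]

theorem IsBasis.inner_edge (hB : IsBasis a B) {i : Fin M} (hi : i ∈ B)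
    (d : EuclideanSpace ℝ (Fin n)) : inner ℝ d (edge a B i) = -coords a B d i := by
  rw [hB.inner_eq_sum d, Finset.sum_eq_single i]
  · rw [hB.inner_edge_self hi, mul_neg_one]
  · intro j hj hji
    rw [hB.inner_edge_of_ne hj hji, mul_zero]
  · exact fun h => absurd hi h

theorem IsBasis.coords_eq_inner (hB : IsBasis a B) {i : Fin M} (hi : i ∈ B)
    (d : EuclideanSpace ℝ (Fin n)) : coords a B d i = -inner ℝ (edge a B i) d := by
  rw [real_inner_comm, hB.inner_edge hi, neg_neg]

theorem IsBasis.coords_add_smul (hB : IsBasis a B) (i : Fin M) (x y : EuclideanSpace ℝ (Fin n))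
    (r : ℝ) : coords a B (x + r • y) i = coords a B x i + r * coords a B y i := by
  by_cases hi : i ∈ B
  · simp only [hB.coords_eq_inner hi, inner_add_right, inner_smul_right]; ring
  · simp [hB.coords_of_notMem _ hi]

theorem IsBasis.coords_add (hB : IsBasis a B) (i : Fin M) (x y : EuclideanSpace ℝ (Fin n)) :
    coords a B (x + y) i = coords a B x i + coords a B y i := by
  simpa using hB.coords_add_smul i x y 1

theorem IsBasis.coords_smul (hB : IsBasis a B) (i : Fin M) (r : ℝ)
    (y : EuclideanSpace ℝ (Fin n)) : coords a B (r • y) i = r * coords a B y i := by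
  by_cases hi : i ∈ B
  · simp only [hB.coords_eq_inner hi, inner_smul_right]; ring
  · simp [hB.coords_of_notMem _ hi]

theorem IsBasis.coords_sub (hB : IsBasis a B) (i : Fin M) (x y : EuclideanSpace ℝ (Fin n)) :
    coords a B (x - y) i = coords a B x i - coords a B y i := by
  by_cases hi : i ∈ B
  · simp only [hB.coords_eq_inner hi, inner_sub_right]; ring
  · simp [hB.coords_of_notMem _ hi]

theorem IsBasis.coords_row (hB : IsBasis a B) {i j : Fin M} (hj : j ∈ B) :
    coords a B (a j) i = if i = j then 1 else 0 := by
  by_cases hi : i ∈ B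
  · rw [hB.coords_eq (f := fun i => if i = j then 1 else 0) _ hi]
    simp [hj]
  · rw [hB.coords_of_notMem _ hi, if_neg]
    rintro rfl; exact hi hj

theorem IsBasis.edge_ne_zero (hB : IsBasis a B) {i : Fin M} (hi : i ∈ B) : edge a B i ≠ 0 := by
  intro h
  have := hB.inner_edge_self hi
  simp [h] at this

theorem IsBasis.row_ne_zero (hB : IsBasis a B) {i : Fin M} (hi : i ∈ B) : a i ≠ 0 := by
  intro h
  have := hB.inner_edge_self hi
  simp [h] at this

theorem IsBasis.notMem_span_erase (hB : IsBasis a B) {i j : Fin M}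
    (hij : inner ℝ (a j) (edge a B i) ≠ 0) :
    a j ∉ Submodule.span ℝ (a '' ((B.erase i : Finset (Fin M)) : Set (Fin M))) := by
  intro h
  apply hij
  have : edge a B i ∈ (Submodule.span ℝ
      (a '' ((B.erase i : Finset (Fin M)) : Set (Fin M))))ᗮ := by
    rw [Submodule.mem_orthogonal]
    intro u hu
    induction hu using Submodule.span_induction with
    | mem y hy =>
      obtain ⟨k, hk, rfl⟩ := hy
      have hk' := Finset.mem_erase.1 (Finset.mem_coe.1 hk)
      exact hB.inner_edge_of_ne hk'.2 hk'.1
    | zero => simp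
    | add y z _ _ hy hz => rw [inner_add_left, hy, hz, add_zero]
    | smul r y _ hy => rw [inner_smul_left, hy, mul_zero]
  exact Submodule.inner_right_of_mem_orthogonal h this

theorem IsBasis.exchange (hB : IsBasis a B) {i j : Fin M} (hi : i ∈ B)
    (hij : inner ℝ (a j) (edge a B i) ≠ 0) : IsBasis a (insert j (B.erase i)) := by
  have hn := hB.notMem_span_erase hij
  have hj : j ∉ B.erase i := fun h => hn (Submodule.subset_span ⟨j, h, rfl⟩)
  refine ⟨?_, ?_⟩
  · rw [Finset.coe_insert]
    exact (hB.linInd.mono (by simp)).insert hn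
  · rw [Finset.card_insert_of_notMem hj, Finset.card_erase_add_one hi, hB.card]

/-- When the coefficient of the leaving row vanishes, an exchange leaves all coefficients
unchanged. -/
theorem IsBasis.coords_exchange (hB : IsBasis a B) {i j : Fin M} (hi : i ∈ B)
    (hij : inner ℝ (a j) (edge a B i) ≠ 0) {d : EuclideanSpace ℝ (Fin n)}
    (hd : coords a B d i = 0) {k : Fin M} (hk : k ∈ insert j (B.erase i)) :
    coords a (insert j (B.erase i)) d k = if k ∈ B.erase i then coords a B d k else 0 := by
  have hn := hB.notMem_span_erase hij
  have hj : j ∉ B.erase i := fun h => hn (Submodule.subset_span ⟨j, h, rfl⟩)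
  refine (hB.exchange hi hij).coords_eq
    (f := fun k => if k ∈ B.erase i then coords a B d k else 0) ?_ hk
  rw [Finset.sum_insert hj, if_neg hj, zero_smul, zero_add]
  conv_rhs => rw [← hB.sum_coords d, ← Finset.add_sum_erase _ _ hi, hd, zero_smul, zero_add]
  exact Finset.sum_congr rfl fun k hk => by rw [if_pos hk]

/-- The edges of every basis are short: equivalently, in every basis each row `a i` has distance
at least `δ ‖a i‖` from the span of the others. -/
def Wide (a : Fin M → EuclideanSpace ℝ (Fin n)) (δ : ℝ) : Prop :=
  ∀ B, IsBasis a B → ∀ i ∈ B, δ * ‖a i‖ * ‖edge a B i‖ ≤ 1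

theorem Wide.abs_coords_le {δ : ℝ} (hw : Wide a δ) (hδ : 0 < δ) (hB : IsBasis a B) {i : Fin M}
    (hi : i ∈ B) (d : EuclideanSpace ℝ (Fin n)) : |coords a B d i| ≤ ‖d‖ / (δ * ‖a i‖) := by
  have ha : 0 < ‖a i‖ := norm_pos_iff.2 (hB.row_ne_zero hi)
  rw [le_div_iff₀ (by positivity), hB.coords_eq_inner hi, abs_neg]
  calc |inner ℝ (edge a B i) d| * (δ * ‖a i‖)
      ≤ (‖edge a B i‖ * ‖d‖) * (δ * ‖a i‖) := by
        gcongr; exact abs_real_inner_le_norm _ _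
    _ = (δ * ‖a i‖ * ‖edge a B i‖) * ‖d‖ := by ring
    _ ≤ 1 * ‖d‖ := by gcongr; exact hw B hB i hi
    _ = ‖d‖ := one_mul _

theorem Wide.le_one {δ : ℝ} (hw : Wide a δ) (hδ : 0 < δ) (hB : IsBasis a B) {i : Fin M}
    (hi : i ∈ B) : δ ≤ 1 := by
  have h := hw.abs_coords_le hδ hB hi (a i)
  have ha : 0 < ‖a i‖ := norm_pos_iff.2 (hB.row_ne_zero hi)
  rw [hB.coords_row hi, if_pos rfl, abs_one, le_div_iff₀ (by positivity)] at h
  nlinarith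

/-! ### Projection to a face -/

theorem mem_orth_iff {x : EuclideanSpace ℝ (Fin n)} :
    x ∈ orth a S ↔ ∀ i ∈ S, inner ℝ (a i) x = 0 := by
  rw [orth, Submodule.mem_orthogonal]
  refine ⟨fun h i hi => h _ (Submodule.subset_span ⟨i, hi, rfl⟩), fun h u hu => ?_⟩
  induction hu using Submodule.span_induction with
  | mem y hy => obtain ⟨i, hi, rfl⟩ := hy; exact h i hi
  | zero => simp
  | add y z _ _ hy hz => rw [inner_add_left, hy, hz, add_zero]
  | smul r y _ hy => rw [inner_smul_left, hy, mul_zero]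

theorem proj_mem (v : EuclideanSpace ℝ (Fin n)) : proj a S v ∈ orth a S := by
  rw [proj]; exact Submodule.starProjection_apply_mem _ _

theorem norm_proj_le (v : EuclideanSpace ℝ (Fin n)) : ‖proj a S v‖ ≤ ‖v‖ :=
  Submodule.norm_starProjection_apply_le _ _

theorem proj_eq_self {v : EuclideanSpace ℝ (Fin n)} (hv : v ∈ orth a S) : proj a S v = v :=
  Submodule.starProjection_eq_self_iff.2 hv

theorem sub_proj_mem (v : EuclideanSpace ℝ (Fin n)) :
    v - proj a S v ∈ Submodule.span ℝ (a '' (S : Set (Fin M))) := by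
  have h : v - proj a S v ∈ (orth a S)ᗮ := Submodule.sub_starProjection_mem_orthogonal v
  rwa [orth, Submodule.orthogonal_orthogonal] at h

theorem IsBasis.coords_of_mem_span (hB : IsBasis a B) (hS : S ⊆ B) {i : Fin M} (hi : i ∉ S)
    {v : EuclideanSpace ℝ (Fin n)} (hv : v ∈ Submodule.span ℝ (a '' (S : Set (Fin M)))) :
    coords a B v i = 0 := by
  induction hv using Submodule.span_induction with
  | mem y hy =>
    obtain ⟨j, hj, rfl⟩ := hy
    rw [hB.coords_row (hS hj), if_neg]
    rintro rfl; exact hi hj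
  | zero => simpa using hB.coords_smul i 0 0
  | add y z _ _ hy hz => rw [hB.coords_add, hy, hz, add_zero]
  | smul r y _ hy => rw [hB.coords_smul, hy, mul_zero]

theorem IsBasis.coords_proj (hB : IsBasis a B) (hS : S ⊆ B) {i : Fin M} (hi : i ∉ S)
    (v : EuclideanSpace ℝ (Fin n)) : coords a B (proj a S v) i = coords a B v i := by
  have h := hB.coords_of_mem_span hS hi (sub_proj_mem v)
  rw [hB.coords_sub] at h
  linarith

theorem proj_row_of_mem {i : Fin M} (hi : i ∈ S) : proj a S (a i) = 0 := by
  refine (Submodule.starProjection_apply_eq_zero_iff _).2 ?_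
  rw [orth, Submodule.orthogonal_orthogonal]
  exact Submodule.subset_span ⟨i, hi, rfl⟩

theorem IsBasis.proj_row_ne_zero (hB : IsBasis a B) (hS : S ⊆ B) {i : Fin M} (hi : i ∈ B \ S) :
    proj a S (a i) ≠ 0 := by
  rw [Finset.mem_sdiff] at hi
  intro h
  have h1 := hB.coords_proj hS hi.2 (a i)
  rw [h, hB.coords_row hi.1, if_pos rfl] at h1
  have h2 := hB.coords_smul i 0 0
  simp only [zero_smul, zero_mul] at h2
  rw [h2] at h1
  exact zero_ne_one h1

theorem IsBasis.sum_coords_proj (hB : IsBasis a B) (hS : S ⊆ B) {d : EuclideanSpace ℝ (Fin n)}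
    (hd : d ∈ orth a S) : ∑ i ∈ B \ S, coords a B d i • proj a S (a i) = d := by
  conv_rhs => rw [← proj_eq_self hd, ← hB.sum_coords d]
  rw [← Finset.sum_sdiff hS]
  simp only [proj, map_add, map_sum, map_smul]
  rw [Finset.sum_eq_zero (s := S), add_zero]
  intro i hi
  have := proj_row_of_mem (a := a) hi
  rw [proj] at this
  rw [this, smul_zero]

theorem IsBasis.finrank_orth (hB : IsBasis a B) (hS : S ⊆ B) :
    Module.finrank ℝ (orth a S) = (B \ S).card := by
  have h1 : Module.finrank ℝ (Submodule.span ℝ (a '' (S : Set (Fin M)))) = S.card := by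
    have h := finrank_span_eq_card (hB.linInd.mono (Finset.coe_subset.2 hS))
    rw [Set.image_eq_range]
    simpa using h
  have h2 := Submodule.finrank_add_finrank_orthogonal
    (Submodule.span ℝ (a '' (S : Set (Fin M))))
  rw [h1, finrank_euclideanSpace, Fintype.card_fin] at h2
  rw [Finset.card_sdiff_of_subset hS, hB.card]
  have h3 : Module.finrank ℝ (orth a S) =
    Module.finrank ℝ (Submodule.span ℝ (a '' (S : Set (Fin M))))ᗮ := rfl
  omega

end Basis

/-! ### Signs of polynomials near zero -/

theorem Polynomial.eventually_sign (p : Polynomial ℝ) :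
    p = 0 ∨ (∀ᶠ ε in 𝓝[>] (0 : ℝ), 0 < p.eval ε) ∨ (∀ᶠ ε in 𝓝[>] (0 : ℝ), p.eval ε < 0) := by
  induction p using Polynomial.recOnHorner with
  | M0 => exact Or.inl rfl
  | MC p c hp hc _ =>
    right
    have hcont : Filter.Tendsto (fun ε => (p + Polynomial.C c).eval ε) (𝓝[>] (0 : ℝ)) (𝓝 c) := by
      have h := (p + Polynomial.C c).continuous.tendsto 0
      rw [← Polynomial.coeff_zero_eq_eval_zero] at h
      simp only [Polynomial.coeff_add, hp, Polynomial.coeff_C_zero, zero_add] at h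
      exact h.mono_left nhdsWithin_le_nhds
    rcases lt_or_gt_of_ne hc with h | h
    · exact Or.inr (hcont.eventually_lt_const h)
    · exact Or.inl (hcont.eventually_const_lt h)
  | MX p hp ih =>
    right
    rcases ih with h | h | h
    · exact absurd h hp
    · left
      filter_upwards [h, self_mem_nhdsWithin] with ε h1 h2
      simpa using mul_pos h1 h2
    · right
      filter_upwards [h, self_mem_nhdsWithin] with ε h1 h2
      simpa using mul_neg_of_neg_of_pos h1 h2

theorem Polynomial.eventually_nonneg_or_nonpos (p : Polynomial ℝ) :
    (∀ᶠ ε in 𝓝[>] (0 : ℝ), 0 ≤ p.eval ε) ∨ (∀ᶠ ε in 𝓝[>] (0 : ℝ), p.eval ε ≤ 0) := by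
  rcases Polynomial.eventually_sign p with h | h | h
  · left; simp [h]
  · exact Or.inl (h.mono fun _ => le_of_lt)
  · exact Or.inr (h.mono fun _ => le_of_lt)

theorem Finset.exists_min_of_total {α : Type*} {s : Finset α} (hs : s.Nonempty)
    (r : α → α → Prop) (htot : ∀ x y, r x y ∨ r y x) (htrans : ∀ x y z, r x y → r y z → r x z) :
    ∃ x ∈ s, ∀ y ∈ s, r x y := by
  induction hs using Finset.Nonempty.cons_induction with
  | singleton a => exact ⟨a, by simp, by simpa using (htot a a)⟩
  | cons a s ha _ ih =>
    obtain ⟨x, hx, hmin⟩ := ih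
    rcases htot a x with h | h
    · refine ⟨a, by simp, fun y hy => ?_⟩
      rcases Finset.mem_cons.1 hy with rfl | hy
      · exact (htot y y).elim id id
      · exact htrans _ _ _ h (hmin y hy)
    · refine ⟨x, by simp [hx], fun y hy => ?_⟩
      rcases Finset.mem_cons.1 hy with rfl | hy
      · exact h
      · exact hmin y hy

theorem firstSuch_eq_some {M : ℕ} {s : Finset (Fin M)} {p : Fin M → Prop} {i : Fin M}
    (h : firstSuch s p = some i) : i ∈ s ∧ p i := by
  rw [firstSuch] at h
  split_ifs at h with hne
  rw [Option.some.injEq] at h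
  have := Finset.min'_mem _ hne
  rw [h, Finset.mem_filter] at this
  exact this

theorem firstSuch_eq_none {M : ℕ} {s : Finset (Fin M)} {p : Fin M → Prop}
    (h : firstSuch s p = none) {i : Fin M} (hi : i ∈ s) : ¬ p i := by
  rw [firstSuch] at h
  split_ifs at h with hne
  exact fun hp => hne ⟨i, Finset.mem_filter.2 ⟨hi, hp⟩⟩

/-! ### Vertices of the symbolically perturbed polyhedron -/

section Vertex

variable {M n : ℕ} {L : LinSys M n} {B₀ B B' S : Finset (Fin M)}

/-- The exponent of `ε` in the perturbation of row `i`. -/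
def expo {M : ℕ} (B₀ : Finset (Fin M)) (i : Fin M) : ℕ :=
  if i ∈ B₀ then M + (i : ℕ) + 1 else (i : ℕ) + 1

theorem expo_injective : Function.Injective (expo B₀) := by
  intro i j h
  simp only [expo] at h
  apply Fin.ext
  have := i.2
  have := j.2
  split_ifs at h <;> omega

theorem expo_pos (i : Fin M) : 0 < expo B₀ i := by
  simp only [expo]; split_ifs <;> omega

theorem perturbed_eq (ε : ℝ) (i : Fin M) : perturbed L B₀ ε i = L.b i + ε ^ expo B₀ i := rfl

theorem perturbed_zero : perturbed L B₀ 0 = L.b := by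
  funext i
  rw [perturbed_eq, zero_pow (expo_pos i).ne', add_zero]

/-- The perturbed right hand side as a polynomial in `ε`. -/
noncomputable def pertPoly (L : LinSys M n) (B₀ : Finset (Fin M)) (i : Fin M) : Polynomial ℝ :=
  Polynomial.C (L.b i) + Polynomial.X ^ expo B₀ i

/-- The slack of constraint `j` at the vertex of basis `B`, as a polynomial in `ε`. -/
noncomputable def slackPoly (L : LinSys M n) (B₀ B : Finset (Fin M)) (j : Fin M) : Polynomial ℝ :=
  pertPoly L B₀ j - ∑ i ∈ B, Polynomial.C (coords L.a B (L.a j) i) * pertPoly L B₀ i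

theorem pertPoly_eval (ε : ℝ) (i : Fin M) :
    (pertPoly L B₀ i).eval ε = perturbed L B₀ ε i := by
  simp [pertPoly, perturbed_eq]

theorem slackPoly_eval (hB : IsBasis L.a B) (ε : ℝ) (j : Fin M) :
    (slackPoly L B₀ B j).eval ε =
      perturbed L B₀ ε j - inner ℝ (L.a j) (solve L.a B (perturbed L B₀ ε)) := by
  rw [hB.inner_eq_sum]
  simp only [slackPoly, Polynomial.eval_sub, Polynomial.eval_finsetSum, Polynomial.eval_mul,
    Polynomial.eval_C, pertPoly_eval]
  congr 1
  exact Finset.sum_congr rfl fun i hi => by rw [hB.inner_solve _ hi]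

/-- The exponents of distinct rows differ, so that no vertex lies on a further constraint. -/
theorem slackPoly_ne_zero {j : Fin M} (hj : j ∉ B) : slackPoly L B₀ B j ≠ 0 := by
  intro h
  have h1 : (slackPoly L B₀ B j).coeff (expo B₀ j) = 1 := by
    simp only [slackPoly, pertPoly, Polynomial.coeff_sub, Polynomial.finsetSum_coeff,
      Polynomial.coeff_C_mul, Polynomial.coeff_add, Polynomial.coeff_C, (expo_pos j).ne',
      if_false, Polynomial.coeff_X_pow, if_true, zero_add]
    rw [Finset.sum_eq_zero, sub_zero]
    intro i hi
    rw [if_neg, mul_zero]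
    intro h
    exact hj (expo_injective h ▸ hi)
  rw [h] at h1
  simp at h1

/-- `B` is a feasible basis of the perturbed system; its vertex is automatically nondegenerate. -/
structure IsVertex (L : LinSys M n) (B₀ B : Finset (Fin M)) : Prop where
  basis : IsBasis L.a B
  subset : B ⊆ L.active
  slack : ∀ j ∈ L.active, j ∉ B → ∀ᶠ ε in 𝓝[>] (0 : ℝ),
    inner ℝ (L.a j) (solve L.a B (perturbed L B₀ ε)) < perturbed L B₀ ε j

theorem IsBasis.slack_lt (hB : IsBasis L.a B) {j : Fin M} (hj : j ∉ B)
    (h : ∀ᶠ ε in 𝓝[>] (0 : ℝ),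
      inner ℝ (L.a j) (solve L.a B (perturbed L B₀ ε)) ≤ perturbed L B₀ ε j) :
    ∀ᶠ ε in 𝓝[>] (0 : ℝ),
      inner ℝ (L.a j) (solve L.a B (perturbed L B₀ ε)) < perturbed L B₀ ε j := by
  rcases Polynomial.eventually_sign (slackPoly L B₀ B j) with h0 | h0 | h0
  · exact absurd h0 (slackPoly_ne_zero hj)
  · filter_upwards [h0] with ε h1
    rw [slackPoly_eval hB] at h1
    linarith
  · obtain ⟨ε, h1, h2⟩ := (h.and h0).exists
    rw [slackPoly_eval hB] at h2
    linarith

theorem IsVertex.feasible (hB : IsVertex L B₀ B) : ∀ᶠ ε in 𝓝[>] (0 : ℝ), ∀ j ∈ L.active,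
    inner ℝ (L.a j) (solve L.a B (perturbed L B₀ ε)) ≤ perturbed L B₀ ε j := by
  rw [Filter.eventually_all_finset]
  intro j hj
  by_cases hjB : j ∈ B
  · exact Filter.Eventually.of_forall fun ε => (hB.basis.inner_solve _ hjB).le
  · exact (hB.slack j hj hjB).mono fun _ => le_of_lt

/-- The unperturbed vertex is feasible for the unperturbed system. -/
theorem IsVertex.feasible_zero (hB : IsVertex L B₀ B) {j : Fin M} (hj : j ∈ L.active) :
    inner ℝ (L.a j) (solve L.a B L.b) ≤ L.b j := by
  have h1 : ∀ᶠ ε in 𝓝[>] (0 : ℝ), 0 ≤ (slackPoly L B₀ B j).eval ε := by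
    filter_upwards [hB.feasible] with ε hε
    rw [slackPoly_eval hB.basis]
    linarith [hε j hj]
  have h2 : Filter.Tendsto (fun ε => (slackPoly L B₀ B j).eval ε) (𝓝[>] (0 : ℝ))
      (𝓝 ((slackPoly L B₀ B j).eval 0)) :=
    ((slackPoly L B₀ B j).continuous.tendsto 0).mono_left nhdsWithin_le_nhds
  have h3 := ge_of_tendsto h2 h1
  rw [slackPoly_eval hB.basis, perturbed_zero] at h3
  linarith

/-- The rows of the initial basis carry the highest powers of `ε`, so that it stays feasible. -/
theorem IsBasis.isVertex (hB : IsBasis L.a B) (hsub : B ⊆ L.active)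
    (hfeas : ∀ j ∈ L.active, inner ℝ (L.a j) (solve L.a B L.b) ≤ L.b j) : IsVertex L B B := by
  refine ⟨hB, hsub, fun j hj hjB => ?_⟩
  have hexp : expo B j = (j : ℕ) + 1 := by rw [expo, if_neg hjB]
  have hle : ∀ ε : ℝ, inner ℝ (L.a j) (solve L.a B (perturbed L B ε)) ≤
      L.b j + ∑ i ∈ B, coords L.a B (L.a j) i * ε ^ expo B i := by
    intro ε
    have h1 := hfeas j hj
    rw [hB.inner_eq_sum] at h1 ⊢
    rw [Finset.sum_congr rfl fun i hi => by rw [hB.inner_solve _ hi]] at h1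
    rw [Finset.sum_congr rfl fun i hi => by rw [hB.inner_solve _ hi, perturbed_eq, mul_add]]
    rw [Finset.sum_add_distrib]
    linarith
  -- `ε ^ (j + 1)` dominates, as all exponents of the rows of `B` exceed `j + 1`.
  have hlim : Filter.Tendsto
      (fun ε : ℝ => ∑ i ∈ B, coords L.a B (L.a j) i * ε ^ (M + (i : ℕ) - (j : ℕ)))
      (𝓝[>] (0 : ℝ)) (𝓝 0) := by
    have hc : Continuous
        (fun ε : ℝ => ∑ i ∈ B, coords L.a B (L.a j) i * ε ^ (M + (i : ℕ) - (j : ℕ))) := by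
      fun_prop
    have h0 := hc.tendsto 0
    rw [Finset.sum_eq_zero] at h0
    · exact h0.mono_left nhdsWithin_le_nhds
    · intro i _
      rw [zero_pow (by have := j.2; omega), mul_zero]
  filter_upwards [hlim.eventually_lt_const one_pos, self_mem_nhdsWithin] with ε h1 h2
  refine lt_of_le_of_lt (hle ε) ?_
  rw [perturbed_eq, hexp]
  have h3 : ∑ i ∈ B, coords L.a B (L.a j) i * ε ^ expo B i =
      ε ^ ((j : ℕ) + 1) * ∑ i ∈ B, coords L.a B (L.a j) i * ε ^ (M + (i : ℕ) - (j : ℕ)) := by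
    rw [Finset.mul_sum]
    refine Finset.sum_congr rfl fun i hi => ?_
    have h4 : expo B i = ((j : ℕ) + 1) + (M + (i : ℕ) - (j : ℕ)) := by
      rw [expo, if_pos hi]; have := j.2; omega
    rw [h4, pow_add]; ring
  rw [h3]
  have h5 : 0 < ε ^ ((j : ℕ) + 1) := pow_pos h2 _
  nlinarith

/-- A vertex whose basis is optimal for `v` (up to the tight constraints `S`) maximizes `v`. -/
theorem IsBasis.inner_le_of_optimal (hB : IsBasis L.a B) {v x : EuclideanSpace ℝ (Fin n)}
    {r : Fin M → ℝ} (hv : ∀ i ∈ B \ S, 0 ≤ coords L.a B v i)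
    (hx : ∀ i ∈ B, inner ℝ (L.a i) x ≤ r i) (hxS : ∀ i ∈ S, inner ℝ (L.a i) x = r i) :
    inner ℝ v x ≤ inner ℝ v (solve L.a B r) := by
  rw [hB.inner_eq_sum v x, hB.inner_eq_sum v]
  refine Finset.sum_le_sum fun i hi => ?_
  rw [hB.inner_solve _ hi]
  by_cases hiS : i ∈ S
  · rw [hxS i hiS]
  · exact mul_le_mul_of_nonneg_left (hx i hi) (hv i (Finset.mem_sdiff.2 ⟨hi, hiS⟩))

theorem IsVertex.eventually_inner_le (hB : IsVertex L B₀ B) (hB' : IsVertex L B₀ B')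
    (hS : S ⊆ B) {v : EuclideanSpace ℝ (Fin n)}
    (hv : ∀ i ∈ B' \ S, 0 ≤ coords L.a B' v i) :
    ∀ᶠ ε in 𝓝[>] (0 : ℝ), inner ℝ v (solve L.a B (perturbed L B₀ ε)) ≤
      inner ℝ v (solve L.a B' (perturbed L B₀ ε)) := by
  filter_upwards [hB.feasible] with ε hε
  exact hB'.basis.inner_le_of_optimal hv (fun i hi => hε i (hB'.subset hi))
    fun i hi => hB.basis.inner_solve _ (hS hi)

/-- An objective in the interior of the cone of one feasible basis lies in no other cone. -/
theorem IsVertex.eq_of_optimal (hB : IsVertex L B₀ B) (hB' : IsVertex L B₀ B')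
    (hS : S ⊆ B) (hS' : S ⊆ B') {v : EuclideanSpace ℝ (Fin n)}
    (hv : ∀ i ∈ B \ S, 0 < coords L.a B v i) (hv' : ∀ i ∈ B' \ S, 0 ≤ coords L.a B' v i) :
    B = B' := by
  refine Finset.eq_of_subset_of_card_le (fun i hi => ?_)
    (by rw [hB.basis.card, hB'.basis.card])
  by_contra hiB'
  have hiS : i ∉ S := fun h => hiB' (hS' h)
  obtain ⟨ε, ⟨h1, h2⟩, h3⟩ := (((hB.eventually_inner_le hB' hS hv').and hB'.feasible).and
    (hB'.slack i (hB.subset hi) hiB')).exists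
  rw [hB.basis.inner_eq_sum v, hB.basis.inner_eq_sum v] at h1
  refine absurd h1 (not_le.2 (Finset.sum_lt_sum (fun k hk => ?_) ⟨i, hi, ?_⟩))
  · rw [hB.basis.inner_solve _ hk]
    by_cases hkS : k ∈ S
    · rw [hB'.basis.inner_solve _ (hS' hkS)]
    · exact mul_le_mul_of_nonneg_left (h2 k (hB.subset hk))
        (hv k (Finset.mem_sdiff.2 ⟨hk, hkS⟩)).le
  · rw [hB.basis.inner_solve _ hi]
    exact mul_lt_mul_of_pos_left h3 (hv i (Finset.mem_sdiff.2 ⟨hi, hiS⟩))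

/-! ### The ratio test -/

theorem edgeDir_eq (i : Fin M) : edgeDir L B i = edge L.a B i := rfl

theorem ratio_eq (hB : IsBasis L.a B) (i j : Fin M) (ε : ℝ) :
    ratio L B₀ B i j ε = (slackPoly L B₀ B j).eval ε / inner ℝ (L.a j) (edge L.a B i) := by
  rw [slackPoly_eval hB]; rfl

theorem entering_eq_none (hB : IsBasis L.a B) {i : Fin M} (h : entering L B₀ B i = none)
    {j : Fin M} (hj : j ∈ L.active) (hjB : j ∉ B) : inner ℝ (L.a j) (edge L.a B i) ≤ 0 := by
  by_contra hcon
  rw [not_le] at hcon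
  let s := (L.active \ B).filter fun k => 0 < inner ℝ (L.a k) (edge L.a B i)
  obtain ⟨k, hk, hmin⟩ := Finset.exists_min_of_total (s := s)
    ⟨j, Finset.mem_filter.2 ⟨Finset.mem_sdiff.2 ⟨hj, hjB⟩, hcon⟩⟩
    (fun k l => ∀ᶠ ε in 𝓝[>] (0 : ℝ), ratio L B₀ B i k ε ≤ ratio L B₀ B i l ε)
    (fun k l => by
      have := Polynomial.eventually_nonneg_or_nonpos
        (Polynomial.C (inner ℝ (L.a l) (edge L.a B i))⁻¹ * slackPoly L B₀ B l -
          Polynomial.C (inner ℝ (L.a k) (edge L.a B i))⁻¹ * slackPoly L B₀ B k)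
      refine this.imp (fun h => ?_) fun h => ?_ <;>
      · filter_upwards [h] with ε hε
        simp only [Polynomial.eval_sub, Polynomial.eval_mul, Polynomial.eval_C] at hε
        simp only [ratio_eq hB, div_eq_inv_mul]
        linarith)
    (fun x y z h1 h2 => by filter_upwards [h1, h2] with ε h3 h4 using h3.trans h4)
  rw [Finset.mem_filter] at hk
  refine firstSuch_eq_none h hk.1 ⟨hk.2, fun l hl hpos => ?_⟩
  exact hmin l (Finset.mem_filter.2 ⟨hl, hpos⟩)

theorem entering_spec {i j : Fin M} (h : entering L B₀ B i = some j) :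
    j ∈ L.active ∧ j ∉ B ∧ 0 < inner ℝ (L.a j) (edge L.a B i) ∧
      ∀ k ∈ L.active \ B, 0 < inner ℝ (L.a k) (edge L.a B i) →
        ∀ᶠ ε in 𝓝[>] (0 : ℝ), ratio L B₀ B i j ε ≤ ratio L B₀ B i k ε := by
  obtain ⟨h1, h2, h3⟩ := firstSuch_eq_some h
  rw [Finset.mem_sdiff] at h1
  exact ⟨h1.1, h1.2, h2, h3⟩

theorem IsVertex.eventually_ratio_pos (hB : IsVertex L B₀ B) {i j : Fin M}
    (h : entering L B₀ B i = some j) : ∀ᶠ ε in 𝓝[>] (0 : ℝ), 0 < ratio L B₀ B i j ε := by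
  obtain ⟨hj, hjB, hpos, -⟩ := entering_spec h
  filter_upwards [hB.slack j hj hjB] with ε hε
  exact div_pos (sub_pos.2 hε) hpos

theorem IsBasis.solve_exchange (hB : IsBasis L.a B) {i j : Fin M} (hi : i ∈ B)
    (hij : inner ℝ (L.a j) (edge L.a B i) ≠ 0) (ε : ℝ) :
    solve L.a (insert j (B.erase i)) (perturbed L B₀ ε) =
      solve L.a B (perturbed L B₀ ε) + ratio L B₀ B i j ε • edge L.a B i := by
  refine ((hB.exchange hi hij).eq_solve fun k hk => ?_).symm
  rw [inner_add_right, inner_smul_right]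
  rcases Finset.mem_insert.1 hk with rfl | hk
  · rw [ratio, edgeDir_eq]; field_simp; ring
  · rw [Finset.mem_erase] at hk
    rw [hB.inner_edge_of_ne hk.2 hk.1, hB.inner_solve _ hk.2, mul_zero, add_zero]

theorem IsVertex.pivot (hB : IsVertex L B₀ B) {i j : Fin M} (hi : i ∈ B)
    (h : entering L B₀ B i = some j) : IsVertex L B₀ (insert j (B.erase i)) := by
  obtain ⟨hj, hjB, hpos, hmin⟩ := entering_spec h
  have hB' := hB.basis.exchange hi hpos.ne'
  refine ⟨hB', ?_, fun k hk hkB => hB'.slack_lt hkB ?_⟩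
  · exact Finset.insert_subset hj ((Finset.erase_subset _ _).trans hB.subset)
  · rw [Finset.mem_insert, Finset.mem_erase, not_or, not_and_or, not_not] at hkB
    have hr := hB.eventually_ratio_pos h
    simp only [hB.basis.solve_exchange hi hpos.ne', inner_add_right, inner_smul_right]
    by_cases hki : k = i
    · subst hki
      filter_upwards [hr] with ε h1
      rw [hB.basis.inner_edge_self hi, hB.basis.inner_solve _ hi]
      linarith
    · have hkB' : k ∉ B := hkB.2.resolve_left hki
      rcases le_or_gt (inner ℝ (L.a k) (edge L.a B i)) 0 with h0 | h0
      · filter_upwards [hr, hB.slack k hk hkB'] with ε h1 h2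
        nlinarith
      · filter_upwards [hmin k (Finset.mem_sdiff.2 ⟨hk, hkB'⟩) h0] with ε h1
        have h2 : ratio L B₀ B i k ε * inner ℝ (L.a k) (edge L.a B i) =
            perturbed L B₀ ε k - inner ℝ (L.a k) (solve L.a B (perturbed L B₀ ε)) :=
          div_mul_cancel₀ _ h0.ne'
        have h3 := mul_le_mul_of_nonneg_right h1 h0.le
        linarith

/-- A pivot strictly increases every linear functional that increases along the edge. -/
theorem IsVertex.pivot_increases (hB : IsVertex L B₀ B) {i j : Fin M} (hi : i ∈ B)
    (h : entering L B₀ B i = some j) {v : EuclideanSpace ℝ (Fin n)}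
    (hv : coords L.a B v i < 0) :
    ∀ᶠ ε in 𝓝[>] (0 : ℝ), inner ℝ v (solve L.a B (perturbed L B₀ ε)) <
      inner ℝ v (solve L.a (insert j (B.erase i)) (perturbed L B₀ ε)) := by
  obtain ⟨hj, hjB, hpos, -⟩ := entering_spec h
  filter_upwards [hB.eventually_ratio_pos h] with ε h1
  rw [hB.basis.solve_exchange hi hpos.ne', inner_add_right, inner_smul_right,
    hB.basis.inner_edge hi]
  nlinarith

/-- No nonzero direction is a direction of recession. -/
def LinSys.IsBounded (L : LinSys M n) : Prop :=
  ∀ z : EuclideanSpace ℝ (Fin n), z ≠ 0 → ∃ j ∈ L.active, 0 < inner ℝ (L.a j) z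

theorem IsBasis.inner_edge_nonpos (hB : IsBasis L.a B) (i : Fin M) {j : Fin M} (hj : j ∈ B) :
    inner ℝ (L.a j) (edge L.a B i) ≤ 0 := by
  by_cases h : j = i
  · subst h; rw [hB.inner_edge_self hj]; norm_num
  · rw [hB.inner_edge_of_ne hj h]

theorem LinSys.IsBounded.entering_ne_none (hL : L.IsBounded) (hB : IsBasis L.a B) {i : Fin M}
    (hi : i ∈ B) : entering L B₀ B i ≠ none := by
  intro h
  obtain ⟨j, hj, hpos⟩ := hL _ (hB.edge_ne_zero hi)
  by_cases hjB : j ∈ B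
  · exact absurd (hB.inner_edge_nonpos i hjB) (not_le.2 hpos)
  · exact absurd (entering_eq_none hB h hj hjB) (not_le.2 hpos)

/-- If some optimal vertex of a face lies on the facet defined by `i`, then the vertices that are
optimal on this facet are optimal on the face. -/
theorem IsVertex.coords_nonneg_of_facet (hL : L.IsBounded) (hB : IsVertex L B₀ B)
    (hB' : IsVertex L B₀ B') {i : Fin M} (hiS : i ∉ S) (hS : insert i S ⊆ B)
    (hS' : insert i S ⊆ B')
    {d : EuclideanSpace ℝ (Fin n)} (hd : ∀ k ∈ B \ S, 0 ≤ coords L.a B d k)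
    (hd' : ∀ k ∈ B' \ insert i S, 0 ≤ coords L.a B' d k) : 0 ≤ coords L.a B' d i := by
  by_contra hneg
  rw [not_le] at hneg
  have hi : i ∈ B' := hS' (Finset.mem_insert_self _ _)
  obtain ⟨j, hj⟩ := Option.ne_none_iff_exists'.1
    (hL.entering_ne_none (B₀ := B₀) hB'.basis hi)
  have hS'' : S ⊆ insert j (B'.erase i) := fun k hk =>
    Finset.mem_insert_of_mem (Finset.mem_erase.2
      ⟨fun h => hiS (h ▸ hk), hS' (Finset.mem_insert_of_mem hk)⟩)
  obtain ⟨ε, ⟨h1, h2⟩, h3⟩ := (((hB'.pivot_increases hi hj hneg).and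
    ((hB'.pivot hi hj).eventually_inner_le hB hS'' hd)).and
    (hB.eventually_inner_le hB' hS hd')).exists
  linarith

end Vertex

/-! ### Iterating a partial step function -/

section Iterate

variable {α : Type} {p : α → Option α} {x : α}

theorem iterate_getD_invariant {R : α → Prop} (hx : R x)
    (hstep : ∀ y z, R y → p y = some z → R z) (t : ℕ) :
    R ((fun y => (p y).getD y)^[t] x) := by
  induction t with
  | zero => exact hx
  | succ t ih =>
    rw [Function.iterate_succ_apply']
    cases h : p ((fun y => (p y).getD y)^[t] x) with
    | none => simpa [h] using ih
    | some z => simpa [h] using hstep _ _ ih h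

/-- A partial step function that increases a strict order on a finite type halts; until then it
never revisits a state. -/
theorem exists_halting_time [Finite α] {R : α → Prop} {lt : α → α → Prop}
    (hirr : ∀ y, ¬ lt y y) (htrans : ∀ y z w, lt y z → lt z w → lt y w) (hx : R x)
    (hstep : ∀ y z, R y → p y = some z → R z ∧ lt y z) :
    ∃ N : ℕ, {t : ℕ | (p ((fun y => (p y).getD y)^[t] x)).isSome} = {t | t < N} ∧
      Set.InjOn (fun t => (fun y => (p y).getD y)^[t] x) {t | t < N} := by
  set f : ℕ → α := fun t => (fun y => (p y).getD y)^[t] x with hf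
  have hR : ∀ t, R (f t) :=
    iterate_getD_invariant hx fun y z hy h => (hstep y z hy h).1
  have hsucc : ∀ t, f (t + 1) = (p (f t)).getD (f t) := fun t => by
    simp only [hf, Function.iterate_succ_apply']
  have hdown : ∀ t, (p (f (t + 1))).isSome → (p (f t)).isSome := by
    intro t h
    by_contra hn
    rw [Option.not_isSome_iff_eq_none] at hn
    rw [hsucc, hn, Option.getD_none, hn] at h
    simp at h
  have hdown' : ∀ k t, (p (f (t + k))).isSome → (p (f t)).isSome := by
    intro k
    induction k with
    | zero => exact fun t h => h
    | succ k ih => exact fun t h => ih t (hdown _ h)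
  have hlt : ∀ k t, (p (f (t + k))).isSome → lt (f t) (f (t + k + 1)) := by
    intro k
    induction k with
    | zero =>
      intro t h
      obtain ⟨z, hz⟩ := Option.isSome_iff_exists.1 h
      simp only [add_zero] at hz ⊢
      rw [hsucc, hz]
      exact (hstep _ _ (hR t) hz).2
    | succ k ih =>
      intro t h
      obtain ⟨z, hz⟩ := Option.isSome_iff_exists.1 h
      refine htrans _ _ _ (ih t (hdown _ h)) ?_
      rw [hsucc (t + (k + 1)), hz]
      exact (hstep _ _ (hR _) hz).2
  have hinj : Set.InjOn f {t | (p (f t)).isSome} := by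
    have key : ∀ t u, t < u → (p (f u)).isSome → f t ≠ f u := by
      intro t u htu hu heq
      obtain ⟨k, rfl⟩ := Nat.exists_eq_add_of_lt htu
      have := hlt k t (hdown _ hu)
      rw [← heq] at this
      exact hirr _ this
    intro t ht u hu heq
    rcases lt_trichotomy t u with h | h | h
    · exact absurd heq (key t u h hu)
    · exact h
    · exact absurd heq.symm (key u t h ht)
  have hfin : {t | (p (f t)).isSome}.Finite :=
    Set.Finite.of_finite_image (Set.toFinite _) hinj
  obtain ⟨t₀, ht₀⟩ := hfin.exists_notMem
  have hex : ∃ t, ¬ (p (f t)).isSome := ⟨t₀, ht₀⟩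
  have heq : {t | (p (f t)).isSome} = {t | t < Nat.find hex} := by
    ext t
    simp only [Set.mem_ofPred_eq, Nat.lt_find_iff, not_not]
    refine ⟨fun h m hm => ?_, fun h => h t le_rfl⟩
    obtain ⟨k, rfl⟩ := Nat.exists_eq_add_of_le hm
    exact hdown' k m h
  exact ⟨Nat.find hex, heq, heq ▸ hinj⟩

end Iterate

/-! ### Following a segment -/

section Follow

variable {M n : ℕ} {L : LinSys M n} {B₀ B B' S : Finset (Fin M)}
  {c d : EuclideanSpace ℝ (Fin n)}

/-- `B` is a feasible basis of the face defined by `S`, and it is optimal for `v` there. -/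
structure IsOptimal (L : LinSys M n) (B₀ S : Finset (Fin M)) (v : EuclideanSpace ℝ (Fin n))
    (B : Finset (Fin M)) : Prop where
  vertex : IsVertex L B₀ B
  face : S ⊆ B
  nonneg : ∀ k ∈ B \ S, 0 ≤ coords L.a B v k

/-- The segment leaves the cone of the optimal basis `B` through its facet opposite to row `i`,
at time `s`. -/
structure IsCrossing (L : LinSys M n) (B₀ S : Finset (Fin M)) (c d : EuclideanSpace ℝ (Fin n))
    (B : Finset (Fin M)) (i : Fin M) (s : ℝ) : Prop where
  nonneg : 0 ≤ s
  lt_one : s < 1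
  mem : i ∈ B \ S
  optimal : IsOptimal L B₀ S (c + s • (d - c)) B
  coord_eq : coords L.a B (c + s • (d - c)) i = 0
  decreasing : coords L.a B (d - c) i < 0

theorem IsOptimal.leaving_eq_some (hB : IsVertex L B₀ B) {s : ℝ} (hs : 0 ≤ s)
    (ho : IsOptimal L B₀ S (c + s • (d - c)) B) {i : Fin M} (h : leaving L S c d B = some i) :
    ∃ s', s ≤ s' ∧ IsCrossing L B₀ S c d B i s' := by
  obtain ⟨hi, hlt, h1, hmin⟩ := firstSuch_eq_some h
  set γ := coords L.a B c
  set η := coords L.a B d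
  have hco : ∀ k t, coords L.a B (c + t • (d - c)) k = γ k + t * (η k - γ k) := fun k t => by
    rw [hB.basis.coords_add_smul, hB.basis.coords_sub]
  have hpos : 0 < γ i - η i := sub_pos.2 hlt
  have hle : s ≤ γ i / (γ i - η i) := by
    rw [le_div_iff₀ hpos]
    have := ho.nonneg i hi
    rw [hco] at this
    linarith
  refine ⟨γ i / (γ i - η i), hle, hs.trans hle, h1, hi, ⟨hB, ho.face, fun k hk => ?_⟩, ?_, ?_⟩
  · have h0 := ho.nonneg k hk
    rw [hco] at h0 ⊢
    rcases lt_or_ge (η k) (γ k) with hk' | hk'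
    · have h2 := hmin k hk hk'
      rw [le_div_iff₀ (sub_pos.2 hk')] at h2
      linarith
    · nlinarith
  · rw [hco]; field_simp; ring
  · rw [hB.basis.coords_sub]; linarith

theorem IsOptimal.leaving_eq_none {s : ℝ} (hs : s ≤ 1)
    (ho : IsOptimal L B₀ S (c + s • (d - c)) B) (h : leaving L S c d B = none) :
    IsOptimal L B₀ S d B := by
  have hB := ho.vertex
  refine ⟨hB, ho.face, fun k hk => ?_⟩
  have hco : ∀ k t, coords L.a B (c + t • (d - c)) k =
      coords L.a B c k + t * (coords L.a B d k - coords L.a B c k) := fun k t => by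
    rw [hB.basis.coords_add_smul, hB.basis.coords_sub]
  by_contra hneg
  rw [not_le] at hneg
  have h0 := ho.nonneg k hk
  rw [hco] at h0
  have hlt : coords L.a B d k < coords L.a B c k := by
    by_contra hcon
    nlinarith
  have h1 : coords L.a B c k / (coords L.a B c k - coords L.a B d k) < 1 := by
    rw [div_lt_one (sub_pos.2 hlt)]; linarith
  let s := (B \ S).filter fun k => coords L.a B d k < coords L.a B c k
  obtain ⟨i, hi, hmin⟩ := Finset.exists_min_image s
    (fun k => coords L.a B c k / (coords L.a B c k - coords L.a B d k))
    ⟨k, Finset.mem_filter.2 ⟨hk, hlt⟩⟩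
  rw [Finset.mem_filter] at hi
  exact firstSuch_eq_none h hi.1 ⟨hi.2, (hmin k (Finset.mem_filter.2 ⟨hk, hlt⟩)).trans_lt h1,
    fun l hl hll => hmin l (Finset.mem_filter.2 ⟨hl, hll⟩)⟩

theorem IsCrossing.pivot {i j : Fin M} {s : ℝ} (hc : IsCrossing L B₀ S c d B i s)
    (h : entering L B₀ B i = some j) :
    IsOptimal L B₀ S (c + s • (d - c)) (insert j (B.erase i)) := by
  have hi := Finset.mem_sdiff.1 hc.mem
  have hpos := (entering_spec h).2.2.1
  refine ⟨hc.optimal.vertex.pivot hi.1 h, fun k hk => ?_, fun k hk => ?_⟩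
  · exact Finset.mem_insert_of_mem (Finset.mem_erase.2
      ⟨fun h => hi.2 (h ▸ hk), hc.optimal.face hk⟩)
  · rw [Finset.mem_sdiff] at hk
    rw [hc.optimal.vertex.basis.coords_exchange hi.1 hpos.ne' hc.coord_eq hk.1]
    split_ifs with hkB
    · exact hc.optimal.nonneg k (Finset.mem_sdiff.2 ⟨Finset.mem_of_mem_erase hkB, hk.2⟩)
    · exact le_rfl

theorem pivot_eq_some {B'' : Finset (Fin M)} (h : pivot L B₀ S c d B = some B'') :
    ∃ i j, leaving L S c d B = some i ∧ entering L B₀ B i = some j ∧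
      B'' = insert j (B.erase i) := by
  rw [pivot, Option.bind_eq_some_iff] at h
  obtain ⟨i, hi, h⟩ := h
  rw [Option.map_eq_some_iff] at h
  obtain ⟨j, hj, h⟩ := h
  exact ⟨i, j, hi, hj, h.symm⟩

/-- What is known about the basis reached when a segment has been followed: a property `R` of pairs
(basis, time) that is preserved by the pivots still holds, and either the basis is optimal at the
end of the segment, or the objective at the end is unbounded. The number of pivots is at most the
number of crossings. -/
theorem follow_spec (hB : IsOptimal L B₀ S c B) (R : Finset (Fin M) → ℝ → Prop) (hR : R B 0)
    (hstep : ∀ B' i j s s', R B' s → s ≤ s' → IsCrossing L B₀ S c d B' i s' →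
      entering L B₀ B' i = some j → R (insert j (B'.erase i)) s') :
    (∃ s, 0 ≤ s ∧ s ≤ 1 ∧ R (follow L B₀ S c d B).result s ∧
      IsOptimal L B₀ S (c + s • (d - c)) (follow L B₀ S c d B).result ∧
      (IsOptimal L B₀ S d (follow L B₀ S c d B).result ∨
        ∃ i, leaving L S c d (follow L B₀ S c d B).result = some i ∧
          entering L B₀ (follow L B₀ S c d B).result i = none)) ∧
    (follow L B₀ S c d B).pivots ≤
      ((Finset.univ.filter fun q : Finset (Fin M) × Fin M =>
        ∃ s, IsCrossing L B₀ S c d q.1 q.2 s).card : ℕ∞) := by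
  let Q : Finset (Fin M) → Prop := fun B' =>
    ∃ s, 0 ≤ s ∧ s ≤ 1 ∧ R B' s ∧ IsOptimal L B₀ S (c + s • (d - c)) B'
  have hQ0 : Q B := ⟨0, le_rfl, zero_le_one, hR, by simpa using hB⟩
  let lt : Finset (Fin M) → Finset (Fin M) → Prop := fun B' B'' =>
    ∀ᶠ ε in 𝓝[>] (0 : ℝ), inner ℝ (d - c) (solve L.a B' (perturbed L B₀ ε)) <
      inner ℝ (d - c) (solve L.a B'' (perturbed L B₀ ε))
  have hQ : ∀ B' B'', Q B' → pivot L B₀ S c d B' = some B'' → Q B'' ∧ lt B' B'' := by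
    rintro B' B'' ⟨s, h0, h1, hRs, ho⟩ hp
    obtain ⟨i, j, hi, hj, rfl⟩ := pivot_eq_some hp
    obtain ⟨s', hss, hc⟩ := ho.leaving_eq_some ho.vertex h0 hi
    exact ⟨⟨s', hc.nonneg, hc.lt_one.le, hstep _ _ _ _ _ hRs hss hc hj, hc.pivot hj⟩,
      ho.vertex.pivot_increases (Finset.mem_sdiff.1 hc.mem).1 hj hc.decreasing⟩
  obtain ⟨N, hN, hinj⟩ := exists_halting_time (p := pivot L B₀ S c d) (lt := lt)
    (fun B' h => by
      obtain ⟨ε, hε⟩ := h.exists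
      exact lt_irrefl _ hε)
    (fun _ _ _ h1 h2 => by filter_upwards [h1, h2] with ε h3 h4 using h3.trans h4) hQ0 hQ
  have hpiv : (follow L B₀ S c d B).pivots = N := by
    change Set.encard {t : ℕ | _} = _
    rw [hN, show {t | t < N} = ((Finset.range N : Finset ℕ) : Set ℕ) by ext; simp,
      Set.encard_coe_eq_coe_finsetCard, Finset.card_range]
  have hres : (follow L B₀ S c d B).result =
      (fun B' => (pivot L B₀ S c d B').getD B')^[N] B := by
    change (fun B' => (pivot L B₀ S c d B').getD B')^[(follow L B₀ S c d B).pivots.toNat] B = _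
    rw [hpiv, ENat.toNat_natCast]
  have hQall := iterate_getD_invariant (p := pivot L B₀ S c d) hQ0
    fun y z hy h => (hQ y z hy h).1
  refine ⟨?_, ?_⟩
  · have hnone : pivot L B₀ S c d (follow L B₀ S c d B).result = none := by
      rw [hres, ← Option.not_isSome_iff_eq_none]
      intro h
      have : N ∈ {t | t < N} := hN ▸ h
      simp at this
    obtain ⟨s, h0, h1, hRs, ho⟩ := hQall N
    rw [← hres] at hRs ho
    refine ⟨s, h0, h1, hRs, ho, ?_⟩
    cases hl : leaving L S c d (follow L B₀ S c d B).result with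
    | none => exact Or.inl (ho.leaving_eq_none h1 hl)
    | some i =>
      refine Or.inr ⟨i, rfl, ?_⟩
      rw [pivot, hl, Option.bind_some, Option.map_eq_none_iff] at hnone
      exact hnone
  · rw [hpiv, Nat.cast_le]
    have hex : ∀ t ∈ Finset.range N, ∃ q : Finset (Fin M) × Fin M,
        q.1 = (fun B' => (pivot L B₀ S c d B').getD B')^[t] B ∧
        ∃ s, IsCrossing L B₀ S c d q.1 q.2 s := by
      intro t ht
      have ht' : t ∈ {t : ℕ | t < N} := Finset.mem_range.1 ht
      rw [← hN] at ht'
      obtain ⟨B'', hB''⟩ := Option.isSome_iff_exists.1 ht'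
      obtain ⟨s, h0, h1, hRs, ho⟩ := hQall t
      obtain ⟨i, j, hi, hj, -⟩ := pivot_eq_some hB''
      obtain ⟨s', hss, hc⟩ := ho.leaving_eq_some ho.vertex h0 hi
      exact ⟨⟨_, i⟩, rfl, s', hc⟩
    rcases Nat.eq_zero_or_pos N with hN0 | hN0
    · rw [hN0]; exact Nat.zero_le _
    have : Nonempty (Finset (Fin M) × Fin M) := ⟨(hex 0 (Finset.mem_range.2 hN0)).choose⟩
    choose! q hq1 hq2 using hex
    rw [← Finset.card_range N]
    refine Finset.card_le_card_of_injOn q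
      (fun t ht => Finset.mem_coe.2 (Finset.mem_filter.2 ⟨Finset.mem_univ _, hq2 t ht⟩)) ?_
    intro t ht u hu htu
    have ht' := Finset.mem_coe.1 ht
    have hu' := Finset.mem_coe.1 hu
    refine hinj (Finset.mem_range.1 ht') (Finset.mem_range.1 hu') ?_
    simp only
    rw [← hq1 t ht', ← hq1 u hu', htu]

/-- On a bounded polyhedron, following a segment leads to an optimal basis for its end. -/
theorem IsOptimal.follow (hL : L.IsBounded) (hB : IsOptimal L B₀ S c B) :
    IsOptimal L B₀ S d (follow L B₀ S c d B).result := by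
  obtain ⟨⟨s, -, -, -, ho, h | ⟨i, h1, h2⟩⟩, -⟩ :=
    follow_spec (d := d) hB (fun _ _ => True) trivial (fun _ _ _ _ _ _ _ _ _ => trivial)
  · exact h
  · have hi := (Finset.mem_sdiff.1 (firstSuch_eq_some h1).1).1
    exact absurd h2 (hL.entering_ne_none ho.vertex.basis hi)

/-- From a feasible basis one reaches an optimal basis, or the objective increases along some
direction of recession. -/
theorem IsVertex.exists_optimal_or_ray (hB : IsVertex L B₀ B) (d : EuclideanSpace ℝ (Fin n)) :
    (∃ B', IsOptimal L B₀ ∅ d B') ∨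
      ∃ z : EuclideanSpace ℝ (Fin n), (∀ j ∈ L.active, inner ℝ (L.a j) z ≤ 0) ∧
        0 < inner ℝ d z := by
  have hc : IsOptimal L B₀ ∅ (∑ i ∈ B, L.a i) B := by
    refine ⟨hB, Finset.empty_subset _, fun k hk => ?_⟩
    rw [Finset.sdiff_empty] at hk
    rw [hB.basis.coords_eq (f := fun _ => 1) (by simp) hk]
    exact zero_le_one
  obtain ⟨⟨s, h0, h1, -, ho, h | ⟨i, hl, hn⟩⟩, -⟩ :=
    follow_spec (d := d) hc (fun _ _ => True) trivial (fun _ _ _ _ _ _ _ _ _ => trivial)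
  · exact Or.inl ⟨_, h⟩
  · right
    obtain ⟨s', -, hcr⟩ := ho.leaving_eq_some ho.vertex h0 hl
    have hi := (Finset.mem_sdiff.1 hcr.mem).1
    refine ⟨edge L.a (ShadowSimplex.follow L B₀ ∅ (∑ i ∈ B, L.a i) d B).result i, fun j hj => ?_, ?_⟩
    · by_cases hjB : j ∈ (ShadowSimplex.follow L B₀ ∅ (∑ i ∈ B, L.a i) d B).result
      · exact ho.vertex.basis.inner_edge_nonpos i hjB
      · exact entering_eq_none ho.vertex.basis hn hj hjB
    · rw [ho.vertex.basis.inner_edge hi]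
      have e1 := hcr.coord_eq
      have e2 := hcr.decreasing
      have e3 := hcr.lt_one
      rw [ho.vertex.basis.coords_add_smul] at e1
      rw [ho.vertex.basis.coords_sub] at e1 e2
      nlinarith

/-- If the objective `e` is close to `d` and its coefficient at row `i` is large, then row `i`
belongs to some optimal basis for `d`: along the way from `e` to `d`, the coefficient of row `i`
cannot drop to zero. -/
theorem IsOptimal.exists_optimal_mem (hL : L.IsBounded) {e : EuclideanSpace ℝ (Fin n)}
    (hB : IsOptimal L B₀ S e B) {i : Fin M} (hi : i ∈ B) {μ : ℝ}
    (hμ : μ < coords L.a B e i)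
    (hslope : ∀ B', IsBasis L.a B' → i ∈ B' → |coords L.a B' (d - e) i| ≤ μ) :
    ∃ B', IsOptimal L B₀ S d B' ∧ i ∈ B' := by
  let R : Finset (Fin M) → ℝ → Prop := fun B' s =>
    i ∈ B' ∧ μ - s * μ < coords L.a B' (e + s • (d - e)) i
  have hR0 : R B 0 := ⟨hi, by simpa using hμ⟩
  have hμ0 : 0 ≤ μ := (abs_nonneg _).trans (hslope B hB.vertex.basis hi)
  obtain ⟨⟨s, -, -, hR, -⟩, -⟩ := follow_spec (d := d) hB R hR0 (by
    rintro B' k j s s' ⟨hiB, hs⟩ hss hc hj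
    have hb := hc.optimal.vertex.basis
    have hk := (Finset.mem_sdiff.1 hc.mem).1
    have h1 : μ - s' * μ < coords L.a B' (e + s' • (d - e)) i := by
      rw [hb.coords_add_smul] at hs ⊢
      have := (abs_le.1 (hslope B' hb hiB)).1
      nlinarith
    have hne : i ≠ k := by
      rintro rfl
      rw [hc.coord_eq] at h1
      nlinarith [hc.lt_one]
    have hmem : i ∈ B'.erase k := Finset.mem_erase.2 ⟨hne, hiB⟩
    refine ⟨Finset.mem_insert_of_mem hmem, ?_⟩
    rw [hb.coords_exchange hk (entering_spec hj).2.2.1.ne' hc.coord_eq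
      (Finset.mem_insert_of_mem hmem), if_pos hmem]
    exact h1)
  exact ⟨_, hB.follow hL, hR.1⟩

end Follow

/-! ### The exponential density and integration along lines -/

/-- The density `exp (-‖x‖)`. -/
noncomputable def expDensity {E : Type*} [NormedAddCommGroup E] (x : E) : ℝ≥0∞ :=
  ENNReal.ofReal (Real.exp (-‖x‖))

theorem measurable_expDensity {E : Type*} [NormedAddCommGroup E] [MeasurableSpace E]
    [BorelSpace E] : Measurable (expDensity : E → ℝ≥0∞) := by
  unfold expDensity; fun_prop

/-- Along a ray in direction `u`, the density decays at rate at most `‖u‖`. -/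
theorem expDensity_le_lintegral_ray {E : Type*} [NormedAddCommGroup E] [NormedSpace ℝ E] (x : E)
    {u : E} (hu : u ≠ 0) (θ : ℝ) :
    expDensity (x + θ • u) ≤
      ENNReal.ofReal ‖u‖ * ∫⁻ t in Set.Ioi θ, expDensity (x + t • u) := by
  have hu' : 0 < ‖u‖ := norm_pos_iff.2 hu
  have h1 : ∫⁻ t in Set.Ioi θ, ENNReal.ofReal
      (Real.exp (-‖x + θ • u‖ + θ * ‖u‖) * Real.exp (-‖u‖ * t)) ≤
      ∫⁻ t in Set.Ioi θ, expDensity (x + t • u) := by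
    refine setLIntegral_mono' measurableSet_Ioi fun t ht => ?_
    refine ENNReal.ofReal_le_ofReal ?_
    rw [← Real.exp_add, Real.exp_le_exp]
    have h2 : x + t • u = (x + θ • u) + (t - θ) • u := by module
    have h3 : ‖x + t • u‖ ≤ ‖x + θ • u‖ + (t - θ) * ‖u‖ := by
      rw [h2]
      refine (norm_add_le _ _).trans ?_
      rw [norm_smul, Real.norm_of_nonneg (sub_nonneg.2 (le_of_lt ht))]
    nlinarith
  have h2 : ∫⁻ t in Set.Ioi θ, ENNReal.ofReal
      (Real.exp (-‖x + θ • u‖ + θ * ‖u‖) * Real.exp (-‖u‖ * t)) =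
      ENNReal.ofReal (Real.exp (-‖x + θ • u‖) / ‖u‖) := by
    rw [← ofReal_integral_eq_lintegral_ofReal]
    · rw [integral_const_mul, integral_exp_mul_Ioi (by linarith), Real.exp_add]
      congr 1
      rw [neg_div_neg_eq, mul_assoc, mul_div_assoc', ← Real.exp_add]
      rw [show θ * ‖u‖ + -‖u‖ * θ = 0 by ring, Real.exp_zero, mul_one_div]
    · exact (integrableOn_exp_mul_Ioi (by linarith) θ).const_mul _
    · exact Filter.Eventually.of_forall fun t => by positivity
  calc expDensity (x + θ • u)
      = ENNReal.ofReal ‖u‖ * ENNReal.ofReal (Real.exp (-‖x + θ • u‖) / ‖u‖) := by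
        rw [expDensity, ← ENNReal.ofReal_mul hu'.le, mul_div_cancel₀ _ hu'.ne']
    _ ≤ _ := by
        rw [← h2]
        exact mul_le_mul_right h1 _

section Density

variable {E : Type*} [NormedAddCommGroup E] [NormedSpace ℝ E] [MeasurableSpace E] [BorelSpace E]
  [FiniteDimensional ℝ E] (μ : Measure E) [μ.IsAddHaarMeasure]

/-- Tonelli's theorem for the decomposition of a space into the lines parallel to `u`: each line
is weighted by the section `0 < ℓ x ≤ 1` of the space, which meets it in a segment of length `1`. -/
theorem lintegral_eq_lintegral_lines (ℓ : E →L[ℝ] ℝ) {u : E} (hu : ℓ u = 1) {G : E → ℝ≥0∞}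
    (hG : Measurable G) :
    ∫⁻ x, G x ∂μ =
      ∫⁻ x, (Set.Ioc (0 : ℝ) 1).indicator 1 (ℓ x) * (∫⁻ t : ℝ, G (x + t • u)) ∂μ := by
  have hφ : Measurable ((Set.Ioc (0 : ℝ) 1).indicator (1 : ℝ → ℝ≥0∞)) :=
    measurable_one.indicator measurableSet_Ioc
  have h1 : ∀ r : ℝ, ∫⁻ t : ℝ, (Set.Ioc (0 : ℝ) 1).indicator (1 : ℝ → ℝ≥0∞) (r - t) = 1 := by
    intro r
    rw [lintegral_sub_left_eq_self (fun t => (Set.Ioc (0 : ℝ) 1).indicator (1 : ℝ → ℝ≥0∞) t) r,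
      lintegral_indicator_one measurableSet_Ioc]
    simp
  calc ∫⁻ x, G x ∂μ
      = ∫⁻ x, (∫⁻ t : ℝ, G x * (Set.Ioc (0 : ℝ) 1).indicator 1 (ℓ x - t)) ∂μ := by
        refine lintegral_congr fun x => ?_
        rw [lintegral_const_mul _ (by fun_prop), h1, mul_one]
    _ = ∫⁻ t : ℝ, ∫⁻ x, G x * (Set.Ioc (0 : ℝ) 1).indicator 1 (ℓ x - t) ∂μ := by
        rw [lintegral_lintegral_swap]
        refine Measurable.aemeasurable ?_
        refine (hG.comp measurable_fst).mul (hφ.comp ?_)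
        exact (ℓ.continuous.measurable.comp measurable_fst).sub measurable_snd
    _ = ∫⁻ t : ℝ, ∫⁻ x, G (x + t • u) * (Set.Ioc (0 : ℝ) 1).indicator 1 (ℓ x) ∂μ := by
        refine lintegral_congr fun t => ?_
        rw [← lintegral_add_right_eq_self
          (fun x => G x * (Set.Ioc (0 : ℝ) 1).indicator 1 (ℓ x - t)) (t • u)]
        refine lintegral_congr fun x => ?_
        rw [map_add, map_smul, hu, smul_eq_mul, mul_one, add_sub_cancel_right]
    _ = ∫⁻ x, (∫⁻ t : ℝ, G (x + t • u) * (Set.Ioc (0 : ℝ) 1).indicator 1 (ℓ x)) ∂μ := by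
        rw [lintegral_lintegral_swap]
        refine Measurable.aemeasurable ?_
        refine (hG.comp ?_).mul (hφ.comp (ℓ.continuous.measurable.comp measurable_snd))
        exact measurable_snd.add (measurable_fst.smul_const u)
    _ = _ := by
        refine lintegral_congr fun x => ?_
        rw [lintegral_mul_const _ (by fun_prop), mul_comm]

theorem lintegral_le_of_lines (ℓ : E →L[ℝ] ℝ) {u : E} (hu : ℓ u = 1) {G H : E → ℝ≥0∞}
    (hG : Measurable G) (hH : Measurable H)
    (h : ∀ x, ∫⁻ t : ℝ, G (x + t • u) ≤ ∫⁻ t : ℝ, H (x + t • u)) :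
    ∫⁻ x, G x ∂μ ≤ ∫⁻ x, H x ∂μ := by
  rw [lintegral_eq_lintegral_lines μ ℓ hu hG, lintegral_eq_lintegral_lines μ ℓ hu hH]
  exact lintegral_mono fun x => mul_le_mul_right (h x) _

theorem lintegral_expDensity_lt_top [Nontrivial E] : ∫⁻ x : E, expDensity x ∂μ < ∞ := by
  have h : Integrable (fun x : E => Real.exp (-‖x‖)) μ := by
    rw [integrable_fun_norm_addHaar μ (f := fun r => Real.exp (-r))]
    have h1 : (0 : ℝ) < (Module.finrank ℝ E : ℝ) := Nat.cast_pos.2 Module.finrank_pos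
    refine (Real.GammaIntegral_convergent h1).congr_fun (fun x hx => ?_) measurableSet_Ioi
    simp only [smul_eq_mul]
    rw [mul_comm, ← Real.rpow_natCast, Nat.cast_sub Module.finrank_pos, Nat.cast_one]
  exact h.lintegral_lt_top

/-- At least a quarter of the exponential distribution lies in the ball of radius `2 k`, by the
exponential moment bound. -/
theorem lintegral_expDensity_le_four_mul [Nontrivial E] :
    ∫⁻ x : E, expDensity x ∂μ ≤
      4 * ∫⁻ x in Metric.closedBall (0 : E) (2 * (Module.finrank ℝ E : ℝ)), expDensity x ∂μ := by
  set k := Module.finrank ℝ E with hk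
  set Z := ∫⁻ x : E, expDensity x ∂μ with hZ
  set K := Metric.closedBall (0 : E) (2 * (k : ℝ)) with hK
  have hkpos : 1 ≤ k := Module.finrank_pos
  have hZfin : Z ≠ ∞ := (lintegral_expDensity_lt_top μ).ne
  have h1 : ∫⁻ x in Kᶜ, expDensity x ∂μ ≤
      ∫⁻ x, ENNReal.ofReal (Real.exp (-(k : ℝ))) * expDensity ((2⁻¹ : ℝ) • x) ∂μ := by
    refine (setLIntegral_mono' (g := fun x => ENNReal.ofReal (Real.exp (-(k : ℝ))) *
      expDensity ((2⁻¹ : ℝ) • x)) Metric.isClosed_closedBall.measurableSet.compl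
      fun x hx => ?_).trans (setLIntegral_le_lintegral _ _)
    rw [expDensity, expDensity, ← ENNReal.ofReal_mul (by positivity), ← Real.exp_add]
    refine ENNReal.ofReal_le_ofReal (Real.exp_le_exp.2 ?_)
    simp only [Set.mem_compl_iff, mem_closedBall_zero_iff, not_le] at hx
    rw [norm_smul]
    norm_num
    linarith
  have h2 : ∫⁻ x, expDensity ((2⁻¹ : ℝ) • x) ∂μ = ENNReal.ofReal (2 ^ k) * Z := by
    have h3 := Measure.map_addHaar_smul μ (r := (2⁻¹ : ℝ)) (by norm_num)
    rw [← lintegral_map (f := expDensity) measurable_expDensity (measurable_const_smul _), h3,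
      lintegral_smul_measure, smul_eq_mul]
    congr 2
    rw [inv_pow, inv_inv, abs_of_nonneg (by positivity)]
  have h3 : ∫⁻ x in Kᶜ, expDensity x ∂μ ≤ ENNReal.ofReal (3 / 4) * Z := by
    refine h1.trans ?_
    have hm : Measurable fun x : E => expDensity ((2⁻¹ : ℝ) • x) :=
      measurable_expDensity.comp (measurable_const_smul _)
    rw [lintegral_const_mul _ hm, h2, ← mul_assoc, ← ENNReal.ofReal_mul (by positivity)]
    refine mul_le_mul_left (ENNReal.ofReal_le_ofReal ?_) _
    have h4 : Real.exp (-(k : ℝ)) * 2 ^ k = (2 * Real.exp (-1)) ^ k := by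
      rw [mul_pow, ← Real.exp_nat_mul]; ring_nf
    have h5 : 2 * Real.exp (-1) ≤ 3 / 4 := by
      rw [Real.exp_neg, ← div_eq_mul_inv, div_le_iff₀ (Real.exp_pos _)]
      have := Real.exp_one_gt_d9
      linarith
    rw [h4]
    calc (2 * Real.exp (-1)) ^ k ≤ (2 * Real.exp (-1)) ^ 1 :=
          pow_le_pow_of_le_one (by positivity) (h5.trans (by norm_num)) hkpos
      _ ≤ 3 / 4 := by rw [pow_one]; exact h5
  have h4 : Z = ∫⁻ x in K, expDensity x ∂μ + ∫⁻ x in Kᶜ, expDensity x ∂μ :=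
    (lintegral_add_compl _ Metric.isClosed_closedBall.measurableSet).symm
  have h5 : ∫⁻ x in K, expDensity x ∂μ ≠ ∞ :=
    ne_top_of_le_ne_top hZfin (setLIntegral_le_lintegral _ _)
  have h6 : Z ≤ ∫⁻ x in K, expDensity x ∂μ + ENNReal.ofReal (3 / 4) * Z := by
    calc Z = _ := h4
      _ ≤ _ := by gcongr
  lift Z to NNReal using hZfin with z
  set w := ∫⁻ x in K, expDensity x ∂μ
  lift w to NNReal using h5 with w
  have h7 : ENNReal.ofReal (3 / 4) = ((3 / 4 : NNReal) : ℝ≥0∞) := by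
    rw [ENNReal.ofReal]; congr 1; ext; norm_num
  rw [h7] at h6
  norm_cast at h6 ⊢
  rw [← NNReal.coe_le_coe] at h6 ⊢
  push_cast at h6 ⊢
  linarith

end Density

/-! ### Facets of simplicial cones crossed by a random segment -/

section Crossing

variable {E : Type*} [NormedAddCommGroup E] [NormedSpace ℝ E] {ι : Type*}

/-- The open simplicial cone in which the functionals `γ j`, `j ∈ s`, are positive. -/
def openCone (γ : ι → E →L[ℝ] ℝ) (s : Finset ι) : Set E := {x | ∀ j ∈ s, 0 < γ j x}

/-- The points `x` for which the segment `x + p + r • h`, `α ≤ r ≤ β`, meets the relative interior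
of the facet `γ i = 0` of the cone. -/
def facetCrossing (γ : ι → E →L[ℝ] ℝ) (s : Finset ι) (p h : E) (α β : ℝ) (i : ι) : Set E :=
  {x | ∃ r ∈ Set.Icc α β, γ i (x + p + r • h) = 0 ∧ ∀ j ∈ s, j ≠ i → 0 < γ j (x + p + r • h)}

/-- The points `x` for which the segment `x + p + r • h`, `α ≤ r ≤ β`, meets the closed facet
`γ i = 0` of the cone transversally. -/
def closedFacetCrossing (γ : ι → E →L[ℝ] ℝ) (s : Finset ι) (p h : E) (α β : ℝ) (i : ι) : Set E :=
  {x | γ i h ≠ 0 ∧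
    ∃ r ∈ Set.Icc α β, γ i (x + p + r • h) = 0 ∧ ∀ j ∈ s, j ≠ i → 0 ≤ γ j (x + p + r • h)}

variable {γ : ι → E →L[ℝ] ℝ} {s : Finset ι} {p h : E} {α β : ℝ} {i : ι}

theorem isOpen_openCone : IsOpen (openCone γ s) := by
  have : openCone γ s = ⋂ j ∈ s, {x | 0 < γ j x} := by ext; simp [openCone]
  rw [this]
  exact isOpen_biInter_finset fun j _ => isOpen_lt continuous_const (γ j).continuous

/-- The time at which the segment crosses a hyperplane depends affinely on `x`. -/
theorem crossing_time (hi : γ i h ≠ 0) {x : E} {r : ℝ} :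
    γ i (x + p + r • h) = 0 ↔ r = -γ i (x + p) / γ i h := by
  rw [map_add, map_smul, smul_eq_mul, eq_div_iff hi]
  constructor <;> intro h <;> linarith

theorem facetCrossing_eq (hi : γ i h ≠ 0) : facetCrossing γ s p h α β i =
    {x | -γ i (x + p) / γ i h ∈ Set.Icc α β} ∩
      ⋂ j ∈ s.erase i, {x | 0 < γ j (x + p + (-γ i (x + p) / γ i h) • h)} := by
  ext x
  simp only [facetCrossing, Set.mem_ofPred_eq, Set.mem_inter_iff, Set.mem_iInter,
    Finset.mem_erase, crossing_time hi]
  constructor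
  · rintro ⟨r, hr, rfl, h⟩
    exact ⟨hr, fun j hj => h j hj.2 hj.1⟩
  · rintro ⟨hr, h⟩
    exact ⟨_, hr, rfl, fun j hj hji => h j ⟨hji, hj⟩⟩

variable [MeasurableSpace E] [BorelSpace E]

theorem measurableSet_facetCrossing (hi : γ i h ≠ 0) :
    MeasurableSet (facetCrossing γ s p h α β i) := by
  rw [facetCrossing_eq hi]
  have hc : Continuous fun x => -γ i (x + p) / γ i h := by fun_prop
  refine (isClosed_Icc.preimage hc).measurableSet.inter ?_
  exact (isOpen_biInter_finset fun j _ => isOpen_lt continuous_const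
    ((γ j).continuous.comp (by fun_prop))).measurableSet

variable [FiniteDimensional ℝ E] (μ : Measure E) [μ.IsAddHaarMeasure]

/-- A nontrivial affine equation holds almost nowhere. -/
theorem ae_apply_ne {ℓ : E →L[ℝ] ℝ} (hℓ : ℓ ≠ 0) (c : ℝ) : ∀ᵐ x ∂μ, ℓ x ≠ c := by
  obtain ⟨v, hv⟩ : ∃ v, ℓ v ≠ 0 := by
    by_contra hcon
    push Not at hcon
    exact hℓ (ContinuousLinearMap.ext hcon)
  have h1 : ∀ x : E, ℓ x = c ↔ x - (c / ℓ v) • v ∈ LinearMap.ker ℓ.toLinearMap := fun x => by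
    rw [LinearMap.mem_ker]
    simp [hv, sub_eq_zero]
  have h2 : μ (LinearMap.ker ℓ.toLinearMap : Set E) = 0 := by
    refine Measure.addHaar_submodule μ _ fun h => ?_
    have : v ∈ LinearMap.ker ℓ.toLinearMap := by rw [h]; trivial
    exact hv this
  rw [ae_iff]
  simp only [not_not]
  have h3 : {x | ℓ x = c} = (fun x => x + -((c / ℓ v) • v)) ⁻¹'
      (LinearMap.ker ℓ.toLinearMap : Set E) := by
    ext x
    rw [Set.mem_preimage, ← sub_eq_add_neg]
    exact h1 x
  rw [h3, measure_preimage_add_right, h2]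

/-- Almost surely, the segment avoids the faces of codimension two. -/
theorem closedFacetCrossing_ae_le {u : ι → E}
    (hdual : ∀ i ∈ s, ∀ j ∈ s, γ i (u j) = if i = j then 1 else 0) (hi : i ∈ s) :
    ∀ᵐ x ∂μ, x ∈ closedFacetCrossing γ s p h α β i →
      γ i h ≠ 0 ∧ x ∈ facetCrossing γ s p h α β i := by
  by_cases hih : γ i h = 0
  · exact Filter.Eventually.of_forall fun x hx => absurd hih hx.1
  have h1 : ∀ j ∈ s.erase i, ∀ᵐ x ∂μ, (γ i h • γ j - γ j h • γ i) x ≠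
      -(γ i h * γ j p - γ j h * γ i p) := by
    intro j hj
    rw [Finset.mem_erase] at hj
    refine ae_apply_ne μ (fun h0 => hih ?_) _
    have := congrArg (fun ℓ : E →L[ℝ] ℝ => ℓ (u j)) h0
    simpa [hdual j hj.2 j hj.2, hdual i hi j hj.2, Ne.symm hj.1] using this
  have h2 := (Filter.eventually_all_finset (s.erase i)).2 h1
  filter_upwards [h2] with x hx hxc
  obtain ⟨-, r, hr, hr0, hpos⟩ := hxc
  refine ⟨hih, r, hr, hr0, fun j hj hji => lt_of_le_of_ne (hpos j hj hji) fun h0 => ?_⟩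
  refine hx j (Finset.mem_erase.2 ⟨hji, hj⟩) ?_
  simp only [map_add, map_smul, smul_eq_mul, sub_apply,
    smul_apply] at hr0 h0 ⊢
  linear_combination (-γ j h) * hr0 - γ i h * h0

/-- The probability that the random segment `x + p + r • h`, `α ≤ r ≤ β`, leaves a cone through
its facet opposite to the generator `u i` is bounded in terms of the probabilities that the points
of the segment lie in the cone. Indeed, a crossing at time `r` can be charged to the points of the
cone on the ray in direction `u i` that starts at the crossing point: the density decays at rate at
most `‖u i‖` along this ray, while the crossing point moves at speed `|γ i h|` with respect to the
coordinate `γ i`. -/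
theorem lintegral_facetCrossing_le {u : ι → E}
    (hdual : ∀ i ∈ s, ∀ j ∈ s, γ i (u j) = if i = j then 1 else 0) (hi : i ∈ s)
    (hih : γ i h ≠ 0) {K : Set E} (hK : MeasurableSet K) {κ : ℝ → ℝ≥0∞} (hκ : Measurable κ)
    (hspeed : ∀ x ∈ K, ∀ r ∈ Set.Icc α β, γ i (x + p + r • h) = 0 →
      ENNReal.ofReal (|γ i h| * ‖u i‖) ≤ κ r) :
    ∫⁻ x in K ∩ facetCrossing γ s p h α β i, expDensity x ∂μ ≤
      ∫⁻ r in Set.Icc α β, κ r *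
        ∫⁻ x in {x | x + p + r • h ∈ openCone γ s}, expDensity x ∂μ := by
  have hui : γ i (u i) = 1 := by rw [hdual i hi i hi, if_pos rfl]
  have hu0 : u i ≠ 0 := fun h0 => by simp [h0] at hui
  have huj : ∀ j ∈ s, j ≠ i → γ j (u i) = 0 := fun j hj hji => by
    rw [hdual j hj i hi, if_neg hji]
  have hcone : MeasurableSet {q : E × ℝ | q.1 + p + q.2 • h ∈ openCone γ s} :=
    (isOpen_openCone.preimage (by fun_prop)).measurableSet
  have hcone' : ∀ r : ℝ, MeasurableSet {x : E | x + p + r • h ∈ openCone γ s} := fun r =>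
    (isOpen_openCone.preimage (by fun_prop)).measurableSet
  -- the integrand of the right hand side, as a function of `x` and `r`
  let F : E → ℝ → ℝ≥0∞ := fun x r =>
    κ r * {x | x + p + r • h ∈ openCone γ s}.indicator expDensity x
  have hF : Measurable (Function.uncurry F) := by
    refine (hκ.comp measurable_snd).mul ?_
    exact (measurable_expDensity.comp measurable_fst).indicator hcone
  have hset : MeasurableSet (K ∩ facetCrossing γ s p h α β i) :=
    hK.inter (measurableSet_facetCrossing hih)
  calc ∫⁻ x in K ∩ facetCrossing γ s p h α β i, expDensity x ∂μ
      = ∫⁻ x, (K ∩ facetCrossing γ s p h α β i).indicator expDensity x ∂μ :=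
        (lintegral_indicator hset _).symm
    _ ≤ ∫⁻ x, (∫⁻ r in Set.Icc α β, F x r) ∂μ := by
        refine lintegral_le_of_lines μ (γ i) hui (measurable_expDensity.indicator hset)
          hF.lintegral_prod_right' fun x => ?_
        let θ : ℝ → ℝ := fun r => -γ i (x + p + r • h)
        have hθ : ∀ r, θ r = -γ i (x + p) - r * γ i h := fun r => by
          simp only [θ, map_add, map_smul, smul_eq_mul]; ring
        let J : Set ℝ := Set.Icc α β ∩ {r | ∀ j ∈ s, j ≠ i → 0 < γ j (x + p + r • h)}
        have hJ : MeasurableSet J := by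
          refine measurableSet_Icc.inter ?_
          have : {r : ℝ | ∀ j ∈ s, j ≠ i → 0 < γ j (x + p + r • h)} =
              ⋂ j ∈ s.erase i, {r : ℝ | 0 < γ j (x + p + r • h)} := by
            ext r; simp only [Set.mem_ofPred_eq, Set.mem_iInter, Finset.mem_erase]
            exact ⟨fun h j hj => h j hj.2 hj.1, fun h j hj hji => h j ⟨hji, hj⟩⟩
          rw [this]
          exact (isOpen_biInter_finset fun j _ => isOpen_lt continuous_const
            ((γ j).continuous.comp (by fun_prop))).measurableSet
        let J' : Set ℝ := J ∩ {r | x + θ r • u i ∈ K}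
        have hθc : Continuous θ := by
          simp only [θ]
          exact ((γ i).continuous.comp (by fun_prop)).neg
        have hJ' : MeasurableSet J' := by
          refine hJ.inter (hK.preimage (Continuous.measurable ?_))
          fun_prop
        -- on the line through `x`, the crossing at time `r` happens at the point `x + θ r • u i`
        have hpt : ∀ (t r : ℝ) (j : ι), γ j (x + t • u i + p + r • h) =
            γ j (x + p + r • h) + t * γ j (u i) := fun t r j => by
          simp only [map_add, map_smul, smul_eq_mul]; ring
        have hsub : ∀ t : ℝ, x + t • u i ∈ K ∩ facetCrossing γ s p h α β i → t ∈ θ '' J' := by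
          rintro t ⟨htK, r, hr, h0, hpos⟩
          rw [hpt, hui, mul_one] at h0
          have ht : θ r = t := by simp only [θ]; linarith
          refine ⟨r, ⟨⟨hr, fun j hj hji => ?_⟩, ?_⟩, ht⟩
          · have := hpos j hj hji
            rwa [hpt, huj j hj hji, mul_zero, add_zero] at this
          · rw [← ht] at htK; exact htK
        have hinj : Set.InjOn θ J' := by
          intro r _ r' _ hrr
          rw [hθ, hθ] at hrr
          exact mul_right_cancel₀ hih (by linarith)
        have hder : ∀ r ∈ J', HasDerivWithinAt θ (-γ i h) J' r := by
          intro r _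
          have h1 : HasDerivAt (fun r : ℝ => -γ i (x + p) - r * γ i h) (-γ i h) r := by
            simpa using ((hasDerivAt_id r).mul_const (γ i h)).const_sub (-γ i (x + p))
          rw [show θ = fun r : ℝ => -γ i (x + p) - r * γ i h from funext hθ]
          exact h1.hasDerivWithinAt
        have hmeasim : MeasurableSet (θ '' J') :=
          hJ'.image_of_continuousOn_injOn hθc.continuousOn hinj
        calc ∫⁻ t : ℝ, (K ∩ facetCrossing γ s p h α β i).indicator expDensity (x + t • u i)
            ≤ ∫⁻ t : ℝ, (θ '' J').indicator (fun t => expDensity (x + t • u i)) t := by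
              refine lintegral_mono fun t => ?_
              by_cases ht : x + t • u i ∈ K ∩ facetCrossing γ s p h α β i
              · rw [Set.indicator_of_mem ht, Set.indicator_of_mem (hsub t ht)]
              · rw [Set.indicator_of_notMem ht]; exact zero_le
          _ = ∫⁻ t in θ '' J', expDensity (x + t • u i) := lintegral_indicator hmeasim _
          _ = ∫⁻ r in J', ENNReal.ofReal |-γ i h| * expDensity (x + θ r • u i) :=
              lintegral_image_eq_lintegral_abs_deriv_mul hJ' hder hinj
                fun t => expDensity (x + t • u i)
          _ ≤ ∫⁻ r in J', κ r * ∫⁻ t in Set.Ioi (θ r), expDensity (x + t • u i) := by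
              refine setLIntegral_mono' hJ' fun r hr => ?_
              have h1 := hspeed _ hr.2 r hr.1.1 (by
                rw [hpt, hui]; simp only [θ]; ring)
              calc ENNReal.ofReal |-γ i h| * expDensity (x + θ r • u i)
                  ≤ ENNReal.ofReal |γ i h| * (ENNReal.ofReal ‖u i‖ *
                      ∫⁻ t in Set.Ioi (θ r), expDensity (x + t • u i)) := by
                    rw [abs_neg]
                    exact mul_le_mul_right (expDensity_le_lintegral_ray x hu0 (θ r)) _
                _ = ENNReal.ofReal (|γ i h| * ‖u i‖) *
                      ∫⁻ t in Set.Ioi (θ r), expDensity (x + t • u i) := by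
                    rw [← mul_assoc, ENNReal.ofReal_mul (abs_nonneg _)]
                _ ≤ _ := mul_le_mul_left h1 _
          _ ≤ ∫⁻ r in J, κ r * ∫⁻ t in Set.Ioi (θ r), expDensity (x + t • u i) :=
              lintegral_mono_set Set.inter_subset_left
          _ = ∫⁻ r in J, ∫⁻ t : ℝ, F (x + t • u i) r := by
              refine setLIntegral_congr_fun hJ fun r hr => ?_
              simp only [F]
              rw [lintegral_const_mul]
              swap
              · exact (measurable_expDensity.indicator (hcone' r)).comp (by fun_prop)
              rw [← lintegral_indicator measurableSet_Ioi]
              congr 1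
              refine lintegral_congr fun t => ?_
              have hiff : t ∈ Set.Ioi (θ r) ↔
                  x + t • u i ∈ {x | x + p + r • h ∈ openCone γ s} := by
                simp only [openCone, Set.mem_ofPred_eq, Set.mem_Ioi, hpt]
                constructor
                · intro ht j hj
                  by_cases hji : j = i
                  · subst hji
                    rw [hui]
                    simp only [θ] at ht
                    linarith
                  · rw [huj j hj hji, mul_zero, add_zero]
                    exact hr.2 j hj hji
                · intro hpos
                  have := hpos i hi
                  rw [hui] at this
                  simp only [θ]
                  linarith
              by_cases ht : t ∈ Set.Ioi (θ r)
              · rw [Set.indicator_of_mem ht, Set.indicator_of_mem (hiff.1 ht)]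
              · rw [Set.indicator_of_notMem ht, Set.indicator_of_notMem (mt hiff.2 ht)]
          _ ≤ ∫⁻ r in Set.Icc α β, ∫⁻ t : ℝ, F (x + t • u i) r :=
              lintegral_mono_set Set.inter_subset_left
          _ = ∫⁻ t : ℝ, ∫⁻ r in Set.Icc α β, F (x + t • u i) r := by
              rw [lintegral_lintegral_swap]
              refine Measurable.aemeasurable ?_
              exact hF.comp ((Continuous.measurable (by fun_prop)).prodMk measurable_fst)
    _ = ∫⁻ r in Set.Icc α β, ∫⁻ x, F x r ∂μ := lintegral_lintegral_swap hF.aemeasurable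
    _ = _ := by
        refine lintegral_congr fun r => ?_
        simp only [F]
        rw [lintegral_const_mul _ (measurable_expDensity.indicator (hcone' r)),
          lintegral_indicator (hcone' r)]

/-- The expected number of facets of a family of disjoint simplicial cones crossed by the random
segment `x + p + r • h`, `α ≤ r ≤ β`. -/
theorem lintegral_sum_crossings_le {β' : Type*} {𝓑 : Finset β'} {s : β' → Finset ι}
    {γ : β' → ι → E →L[ℝ] ℝ} {u : β' → ι → E} {k : ℕ}
    (hdual : ∀ b ∈ 𝓑, ∀ i ∈ s b, ∀ j ∈ s b, γ b i (u b j) = if i = j then 1 else 0)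
    (hcard : ∀ b ∈ 𝓑, (s b).card ≤ k)
    (hdisj : ∀ b ∈ 𝓑, ∀ b' ∈ 𝓑, ∀ x, x ∈ openCone (γ b) (s b) → x ∈ openCone (γ b') (s b') →
      b = b')
    {K : Set E} (hK : MeasurableSet K) {κ : ℝ → ℝ≥0∞} (hκ : Measurable κ)
    (hspeed : ∀ b ∈ 𝓑, ∀ i ∈ s b, ∀ x ∈ K, ∀ r ∈ Set.Icc α β, γ b i (x + p + r • h) = 0 →
      ENNReal.ofReal (|γ b i h| * ‖u b i‖) ≤ κ r) :
    ∫⁻ x in K, (∑ b ∈ 𝓑, ∑ i ∈ s b,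
        (closedFacetCrossing (γ b) (s b) p h α β i).indicator 1 x) * expDensity x ∂μ ≤
      k * (∫⁻ r in Set.Icc α β, κ r) * ∫⁻ x, expDensity x ∂μ := by
  let T : β' → ι → Set E := fun b i =>
    if γ b i h = 0 then ∅ else facetCrossing (γ b) (s b) p h α β i
  have hT : ∀ b i, MeasurableSet (T b i) := fun b i => by
    simp only [T]
    split_ifs with h0
    · exact MeasurableSet.empty
    · exact measurableSet_facetCrossing h0
  have hTle : ∀ b ∈ 𝓑, ∀ i ∈ s b, ∀ᵐ x ∂(μ.restrict K),
      (closedFacetCrossing (γ b) (s b) p h α β i).indicator (1 : E → ℝ≥0∞) x ≤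
        (T b i).indicator 1 x := by
    intro b hb i hi
    filter_upwards [ae_restrict_of_ae (closedFacetCrossing_ae_le (α := α) (β := β) (p := p)
      (h := h) μ (hdual b hb) hi)] with x hx
    by_cases hxc : x ∈ closedFacetCrossing (γ b) (s b) p h α β i
    · have := hx hxc
      have hxT : x ∈ T b i := by simp only [T, if_neg this.1]; exact this.2
      rw [Set.indicator_of_mem hxc, Set.indicator_of_mem hxT]
    · rw [Set.indicator_of_notMem hxc]; exact zero_le
  have hTae : ∀ᵐ x ∂(μ.restrict K), ∀ b ∈ 𝓑, ∀ i ∈ s b,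
      (closedFacetCrossing (γ b) (s b) p h α β i).indicator (1 : E → ℝ≥0∞) x ≤
        (T b i).indicator 1 x := by
    rw [Filter.eventually_all_finset]
    intro b hb
    rw [Filter.eventually_all_finset]
    exact hTle b hb
  have hcone : ∀ b (r : ℝ), MeasurableSet {x : E | x + p + r • h ∈ openCone (γ b) (s b)} :=
    fun b r => (isOpen_openCone.preimage (by fun_prop)).measurableSet
  have hterm : ∀ b ∈ 𝓑, ∀ i ∈ s b, ∫⁻ x in K, (T b i).indicator 1 x * expDensity x ∂μ ≤
      ∫⁻ r in Set.Icc α β, κ r *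
        ∫⁻ x in {x | x + p + r • h ∈ openCone (γ b) (s b)}, expDensity x ∂μ := by
    intro b hb i hi
    have h1 : ∀ x, (T b i).indicator (1 : E → ℝ≥0∞) x * expDensity x =
        (T b i).indicator expDensity x := fun x => by
      by_cases hx : x ∈ T b i <;> simp [hx]
    simp only [h1]
    rw [lintegral_indicator (hT b i), Measure.restrict_restrict (hT b i), Set.inter_comm]
    by_cases h0 : γ b i h = 0
    · simp [T, h0]
    · simp only [T, if_neg h0]
      exact lintegral_facetCrossing_le μ (hdual b hb) hi h0 hK hκ (hspeed b hb i hi)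
  have hmeas : ∀ b, Measurable fun r : ℝ => κ r *
      ∫⁻ x in {x | x + p + r • h ∈ openCone (γ b) (s b)}, expDensity x ∂μ := by
    intro b
    refine hκ.mul ?_
    have h1 : ∀ r : ℝ, ∫⁻ x in {x | x + p + r • h ∈ openCone (γ b) (s b)}, expDensity x ∂μ =
        ∫⁻ x, {x | x + p + r • h ∈ openCone (γ b) (s b)}.indicator expDensity x ∂μ :=
      fun r => (lintegral_indicator (hcone b r) _).symm
    simp only [h1]
    have h2 : MeasurableSet {q : E × ℝ | q.1 + p + q.2 • h ∈ openCone (γ b) (s b)} :=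
      (isOpen_openCone.preimage (by fun_prop)).measurableSet
    have h3 : Measurable fun q : E × ℝ =>
        {x | x + p + q.2 • h ∈ openCone (γ b) (s b)}.indicator expDensity q.1 :=
      (measurable_expDensity.comp measurable_fst).indicator h2
    exact h3.lintegral_prod_left'
  calc ∫⁻ x in K, (∑ b ∈ 𝓑, ∑ i ∈ s b,
        (closedFacetCrossing (γ b) (s b) p h α β i).indicator 1 x) * expDensity x ∂μ
      ≤ ∫⁻ x in K, ∑ b ∈ 𝓑, ∑ i ∈ s b, (T b i).indicator 1 x * expDensity x ∂μ := by
        refine lintegral_mono_ae ?_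
        filter_upwards [hTae] with x hx
        rw [Finset.sum_mul]
        refine Finset.sum_le_sum fun b hb => ?_
        rw [Finset.sum_mul]
        exact Finset.sum_le_sum fun i hi => mul_le_mul_left (hx b hb i hi) _
    _ = ∑ b ∈ 𝓑, ∑ i ∈ s b, ∫⁻ x in K, (T b i).indicator 1 x * expDensity x ∂μ := by
        have hm : ∀ b i, Measurable fun x : E =>
            (T b i).indicator (1 : E → ℝ≥0∞) x * expDensity x := fun b i =>
          (measurable_one.indicator (hT b i)).mul measurable_expDensity
        rw [lintegral_finsetSum _ fun b _ => Finset.measurable_fun_sum _ fun i _ => hm b i]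
        exact Finset.sum_congr rfl fun b _ => lintegral_finsetSum _ fun i _ => hm b i
    _ ≤ ∑ b ∈ 𝓑, ∑ i ∈ s b, ∫⁻ r in Set.Icc α β, κ r *
          ∫⁻ x in {x | x + p + r • h ∈ openCone (γ b) (s b)}, expDensity x ∂μ :=
        Finset.sum_le_sum fun b hb => Finset.sum_le_sum fun i hi => hterm b hb i hi
    _ ≤ ∑ b ∈ 𝓑, k * ∫⁻ r in Set.Icc α β, κ r *
          ∫⁻ x in {x | x + p + r • h ∈ openCone (γ b) (s b)}, expDensity x ∂μ := by
        refine Finset.sum_le_sum fun b hb => ?_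
        rw [Finset.sum_const, nsmul_eq_mul]
        exact mul_le_mul_left (Nat.cast_le.2 (hcard b hb)) _
    _ = k * ∫⁻ r in Set.Icc α β, κ r * ∑ b ∈ 𝓑,
          ∫⁻ x in {x | x + p + r • h ∈ openCone (γ b) (s b)}, expDensity x ∂μ := by
        rw [← Finset.mul_sum, ← lintegral_finsetSum _ fun b _ => hmeas b]
        simp only [Finset.mul_sum]
    _ ≤ k * ∫⁻ r in Set.Icc α β, κ r * ∫⁻ x, expDensity x ∂μ := by
        refine mul_le_mul_right (lintegral_mono fun r => mul_le_mul_right ?_ _) _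
        rw [← lintegral_biUnion_finset (fun b hb b' hb' hne => ?_) (fun b _ => hcone b r)]
        · exact setLIntegral_le_lintegral _ _
        · refine Set.disjoint_left.2 fun x hx hx' => hne ?_
          exact hdisj b hb b' hb' _ hx hx'
    _ = _ := by
        rw [lintegral_mul_const _ hκ, mul_assoc]

end Crossing

/-! ### The truncated exponential distribution -/

section TruncExp

variable {k : ℕ}

theorem lintegral_expDensity_closedBall_ne_zero (hk : 0 < k) :
    ∫⁻ x in Metric.closedBall (0 : EuclideanSpace ℝ (Fin k)) (2 * (k : ℝ)), expDensity x ≠ 0 := by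
  rw [Ne, lintegral_eq_zero_iff measurable_expDensity]
  intro h
  have h1 : volume (Metric.closedBall (0 : EuclideanSpace ℝ (Fin k)) (2 * (k : ℝ))) = 0 := by
    rw [← Measure.restrict_eq_zero, ← ae_eq_bot, ← Filter.empty_mem_iff_bot]
    filter_upwards [h] with x hx
    have : 0 < expDensity x := ENNReal.ofReal_pos.2 (Real.exp_pos _)
    exact absurd hx this.ne'
  exact (Metric.measure_closedBall_pos volume (0 : EuclideanSpace ℝ (Fin k))
    (by positivity : (0 : ℝ) < 2 * (k : ℝ))).ne' h1

theorem withDensity_closedBall :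
    (volume.withDensity fun x : EuclideanSpace ℝ (Fin k) => ENNReal.ofReal (Real.exp (-‖x‖)))
      (Metric.closedBall 0 (2 * (k : ℝ))) =
    ∫⁻ x in Metric.closedBall (0 : EuclideanSpace ℝ (Fin k)) (2 * (k : ℝ)), expDensity x :=
  withDensity_apply _ Metric.isClosed_closedBall.measurableSet

theorem lintegral_expDensity_closedBall_ne_top (hk : 0 < k) :
    ∫⁻ x in Metric.closedBall (0 : EuclideanSpace ℝ (Fin k)) (2 * (k : ℝ)), expDensity x ≠ ∞ := by
  have : Nonempty (Fin k) := ⟨⟨0, hk⟩⟩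
  exact ne_top_of_le_ne_top (lintegral_expDensity_lt_top volume).ne
    (setLIntegral_le_lintegral _ _)

theorem isProbabilityMeasure_truncExp (hk : 0 < k) : IsProbabilityMeasure (truncExp k) := by
  refine ProbabilityTheory.cond_isProbabilityMeasure_of_finite ?_ ?_
  · rw [withDensity_closedBall]; exact lintegral_expDensity_closedBall_ne_zero hk
  · rw [withDensity_closedBall]; exact lintegral_expDensity_closedBall_ne_top hk

theorem ae_truncExp_norm_le : ∀ᵐ x ∂(truncExp k), ‖x‖ ≤ 2 * (k : ℝ) := by
  have h := ProbabilityTheory.ae_cond_mem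
    (μ := volume.withDensity fun x : EuclideanSpace ℝ (Fin k) => ENNReal.ofReal (Real.exp (-‖x‖)))
    (Metric.isClosed_closedBall (x := (0 : EuclideanSpace ℝ (Fin k)))
      (ε := 2 * (k : ℝ))).measurableSet
  filter_upwards [h] with x hx
  simpa using hx

/-- Conditioning on the ball increases expectations by a factor of at most `4`. -/
theorem lintegral_truncExp_le (hk : 0 < k) {g : EuclideanSpace ℝ (Fin k) → ℝ≥0∞} {A : ℝ≥0∞}
    (h : ∫⁻ x in Metric.closedBall (0 : EuclideanSpace ℝ (Fin k)) (2 * (k : ℝ)),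
      g x * expDensity x ≤ A * ∫⁻ x : EuclideanSpace ℝ (Fin k), expDensity x) :
    ∫⁻ x, g x ∂(truncExp k) ≤ 4 * A := by
  have : Nonempty (Fin k) := ⟨⟨0, hk⟩⟩
  have h4 := lintegral_expDensity_le_four_mul (volume : Measure (EuclideanSpace ℝ (Fin k)))
  rw [finrank_euclideanSpace, Fintype.card_fin] at h4
  have h0 := lintegral_expDensity_closedBall_ne_zero hk
  have htop := lintegral_expDensity_closedBall_ne_top hk
  set w := ∫⁻ x in Metric.closedBall (0 : EuclideanSpace ℝ (Fin k)) (2 * (k : ℝ)), expDensity x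
  have hcond : truncExp k = w⁻¹ •
      ((volume.restrict (Metric.closedBall (0 : EuclideanSpace ℝ (Fin k)) (2 * (k : ℝ)))).withDensity
        expDensity) := by
    rw [truncExp, ProbabilityTheory.cond, withDensity_closedBall]
    congr 1
    exact restrict_withDensity Metric.isClosed_closedBall.measurableSet _
  rw [hcond, lintegral_smul_measure, smul_eq_mul]
  calc w⁻¹ * ∫⁻ x, g x ∂((volume.restrict
        (Metric.closedBall (0 : EuclideanSpace ℝ (Fin k)) (2 * (k : ℝ)))).withDensity expDensity)
      ≤ w⁻¹ * ∫⁻ x in Metric.closedBall (0 : EuclideanSpace ℝ (Fin k)) (2 * (k : ℝ)),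
          ((expDensity : EuclideanSpace ℝ (Fin k) → ℝ≥0∞) * g) x :=
        mul_le_mul_right (lintegral_withDensity_le_lintegral_mul _ measurable_expDensity _) _
    _ ≤ w⁻¹ * (A * (4 * w)) := by
        refine mul_le_mul_right ?_ _
        refine (le_of_eq (lintegral_congr fun x => ?_)).trans (h.trans (mul_le_mul_right h4 _))
        rw [Pi.mul_apply, mul_comm]
    _ = 4 * A * (w⁻¹ * w) := by ring
    _ = 4 * A := by rw [ENNReal.inv_mul_cancel h0 htop, mul_one]

end TruncExp

/-! ### The expected number of pivots on a segment -/

section Legs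

variable {M n : ℕ} {L : LinSys M n} {B₀ B B' S : Finset (Fin M)} {δ : ℝ}

/-- `ofCoords` as a linear isometry. -/
noncomputable def ofCoordsL (W : Submodule ℝ (EuclideanSpace ℝ (Fin n))) :
    EuclideanSpace ℝ (Fin (Module.finrank ℝ W)) →ₗᵢ[ℝ] EuclideanSpace ℝ (Fin n) :=
  W.subtypeₗᵢ.comp (stdOrthonormalBasis ℝ W).repr.symm.toLinearIsometry

theorem ofCoords_eq (W : Submodule ℝ (EuclideanSpace ℝ (Fin n)))
    (x : EuclideanSpace ℝ (Fin (Module.finrank ℝ W))) : ofCoords W x = ofCoordsL W x := rfl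

theorem ofCoords_mem (W : Submodule ℝ (EuclideanSpace ℝ (Fin n)))
    (x : EuclideanSpace ℝ (Fin (Module.finrank ℝ W))) : ofCoords W x ∈ W :=
  ((stdOrthonormalBasis ℝ W).repr.symm x : W).2

theorem norm_ofCoords (W : Submodule ℝ (EuclideanSpace ℝ (Fin n)))
    (x : EuclideanSpace ℝ (Fin (Module.finrank ℝ W))) : ‖ofCoords W x‖ = ‖x‖ := by
  rw [ofCoords_eq, LinearIsometry.norm_map]

theorem exists_ofCoords_eq {W : Submodule ℝ (EuclideanSpace ℝ (Fin n))}
    {v : EuclideanSpace ℝ (Fin n)} (hv : v ∈ W) : ∃ x, ofCoords W x = v :=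
  ⟨(stdOrthonormalBasis ℝ W).repr ⟨v, hv⟩, by simp [ofCoords]⟩

/-- The coefficient of row `i` in the basis `B`, as a functional on the coordinate space of the
face. -/
noncomputable def coordFun (a : Fin M → EuclideanSpace ℝ (Fin n)) (S B : Finset (Fin M))
    (i : Fin M) : EuclideanSpace ℝ (Fin (Module.finrank ℝ (orth a S))) →L[ℝ] ℝ :=
  -((innerSL ℝ (edge a B i)).comp (ofCoordsL (orth a S)).toContinuousLinearMap)

theorem coordFun_apply (hB : IsBasis L.a B) {i : Fin M} (hi : i ∈ B)
    (x : EuclideanSpace ℝ (Fin (Module.finrank ℝ (orth L.a S)))) :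
    coordFun L.a S B i x = coords L.a B (ofCoords (orth L.a S) x) i := by
  rw [hB.coords_eq_inner hi]; rfl

/-- The feasible bases of the face defined by `S`. -/
noncomputable def faceVertices (L : LinSys M n) (B₀ S : Finset (Fin M)) :
    Finset (Finset (Fin M)) :=
  Finset.univ.filter fun B => IsVertex L B₀ B ∧ S ⊆ B

/-- The projected row `i` in the coordinate space of the face. -/
noncomputable def rowCoord (a : Fin M → EuclideanSpace ℝ (Fin n)) (S : Finset (Fin M))
    (i : Fin M) : EuclideanSpace ℝ (Fin (Module.finrank ℝ (orth a S))) :=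
  (exists_ofCoords_eq (proj_mem (a := a) (S := S) (a i))).choose

theorem ofCoords_rowCoord (a : Fin M → EuclideanSpace ℝ (Fin n)) (S : Finset (Fin M))
    (i : Fin M) : ofCoords (orth a S) (rowCoord a S i) = proj a S (a i) :=
  (exists_ofCoords_eq (proj_mem (a := a) (S := S) (a i))).choose_spec

theorem norm_rowCoord_le (a : Fin M → EuclideanSpace ℝ (Fin n)) (S : Finset (Fin M))
    (i : Fin M) : ‖rowCoord a S i‖ ≤ ‖a i‖ := by
  rw [← norm_ofCoords, ofCoords_rowCoord]; exact norm_proj_le _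

/-- The expected number of pivots on a random segment whose crossings, after a reparametrization,
lie on the random segment `x + p + r • h`, `α ≤ r ≤ β`. -/
theorem lintegral_pivots_le (hne : 0 < Module.finrank ℝ (orth L.a S))
    {p h : EuclideanSpace ℝ (Fin (Module.finrank ℝ (orth L.a S)))} {α β : ℝ}
    {c d : EuclideanSpace ℝ (Fin (Module.finrank ℝ (orth L.a S))) → EuclideanSpace ℝ (Fin n)}
    {N : EuclideanSpace ℝ (Fin (Module.finrank ℝ (orth L.a S))) → ℕ∞}
    (hN : ∀ x, ‖x‖ ≤ 2 * (Module.finrank ℝ (orth L.a S) : ℝ) →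
      N x ≤ ((Finset.univ.filter fun q : Finset (Fin M) × Fin M =>
        ∃ s, IsCrossing L B₀ S (c x) (d x) q.1 q.2 s).card : ℕ∞))
    (hcr : ∀ x, ‖x‖ ≤ 2 * (Module.finrank ℝ (orth L.a S) : ℝ) → ∀ B i s,
      IsCrossing L B₀ S (c x) (d x) B i s →
      x ∈ closedFacetCrossing (coordFun L.a S B) (B \ S) p h α β i)
    {κ : ℝ → ℝ≥0∞} (hκ : Measurable κ)
    (hspeed : ∀ B ∈ faceVertices L B₀ S, ∀ i ∈ B \ S,
      ∀ x, ‖x‖ ≤ 2 * (Module.finrank ℝ (orth L.a S) : ℝ) → ∀ r ∈ Set.Icc α β,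
      coordFun L.a S B i (x + p + r • h) = 0 →
      ENNReal.ofReal (|coordFun L.a S B i h| * ‖rowCoord L.a S i‖) ≤ κ r) :
    ∫⁻ x, (N x : ℝ≥0∞) ∂(truncExp (Module.finrank ℝ (orth L.a S))) ≤
      4 * ((Module.finrank ℝ (orth L.a S) : ℕ) * ∫⁻ r in Set.Icc α β, κ r) := by
  refine lintegral_truncExp_le hne ?_
  have hK := (Metric.isClosed_closedBall (x := (0 : EuclideanSpace ℝ (Fin (Module.finrank ℝ
    (orth L.a S))))) (ε := 2 * (Module.finrank ℝ (orth L.a S) : ℝ))).measurableSet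
  refine le_trans (setLIntegral_mono' hK fun x hx => ?_)
    (lintegral_sum_crossings_le (volume : Measure (EuclideanSpace ℝ (Fin (Module.finrank ℝ
      (orth L.a S))))) (𝓑 := faceVertices L B₀ S) (s := fun B => B \ S)
      (γ := coordFun L.a S) (u := fun _ => rowCoord L.a S) (p := p) (h := h) (α := α) (β := β)
      ?_ ?_ ?_ hK hκ ?_)
  · refine mul_le_mul_left ?_ _
    rw [mem_closedBall_zero_iff] at hx
    have h1 : (N x : ℝ≥0∞) ≤ ((Finset.univ.filter fun q : Finset (Fin M) × Fin M =>
        ∃ s, IsCrossing L B₀ S (c x) (d x) q.1 q.2 s).card : ℝ≥0∞) := by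
      have := ENat.toENNReal_le.2 (hN x hx)
      simpa using this
    refine h1.trans ?_
    rw [Finset.sum_sigma', Finset.card_eq_sum_ones, Nat.cast_sum]
    let e : Finset (Fin M) × Fin M → (_ : Finset (Fin M)) × Fin M := fun q => ⟨q.1, q.2⟩
    have he : Function.Injective e := by
      rintro ⟨a, b⟩ ⟨a', b'⟩ h; simp only [e, Sigma.mk.injEq, heq_eq_eq] at h; simp [h]
    rw [← Finset.sum_image (f := fun _ => ((1 : ℕ) : ℝ≥0∞)) he.injOn]
    refine le_trans (Finset.sum_le_sum (g := fun q : (_ : Finset (Fin M)) × Fin M =>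
        (closedFacetCrossing (coordFun L.a S q.1) (q.1 \ S) p h α β q.2).indicator
          (1 : EuclideanSpace ℝ (Fin (Module.finrank ℝ (orth L.a S))) → ℝ≥0∞) x)
        fun q hq => ?_) (Finset.sum_le_sum_of_subset fun q hq => ?_)
    · obtain ⟨q', hq', rfl⟩ := Finset.mem_image.1 hq
      obtain ⟨s, hs⟩ := (Finset.mem_filter.1 hq').2
      rw [Set.indicator_of_mem (hcr x hx _ _ _ hs)]
      simp
    · obtain ⟨q', hq', rfl⟩ := Finset.mem_image.1 hq
      obtain ⟨s, hs⟩ := (Finset.mem_filter.1 hq').2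
      exact Finset.mem_sigma.2 ⟨Finset.mem_filter.2
        ⟨Finset.mem_univ _, hs.optimal.vertex, hs.optimal.face⟩, hs.mem⟩
  · intro B hB i hi j hj
    obtain ⟨hv, hS⟩ := (Finset.mem_filter.1 hB).2
    rw [Finset.mem_sdiff] at hi hj
    rw [coordFun_apply hv.basis hi.1, ofCoords_rowCoord, hv.basis.coords_proj hS hi.2,
      hv.basis.coords_row hj.1]
    by_cases hij : i = j <;> simp [hij]
  · intro B hB
    obtain ⟨hv, hS⟩ := (Finset.mem_filter.1 hB).2
    rw [hv.basis.finrank_orth hS]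
  · intro B hB B' hB' x hx hx'
    obtain ⟨hv, hS⟩ := (Finset.mem_filter.1 hB).2
    obtain ⟨hv', hS'⟩ := (Finset.mem_filter.1 hB').2
    refine hv.eq_of_optimal hv' hS hS' (v := ofCoords (orth L.a S) x) (fun i hi => ?_)
      fun i hi => ?_
    · rw [← coordFun_apply hv.basis (Finset.mem_sdiff.1 hi).1]
      exact hx i hi
    · rw [← coordFun_apply hv'.basis (Finset.mem_sdiff.1 hi).1]
      exact (hx' i hi).le
  · intro B hB i hi x hx
    rw [mem_closedBall_zero_iff] at hx
    exact hspeed B hB i hi x hx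

theorem Wide.coordFun_mul_le (hw : Wide L.a δ) (hδ : 0 < δ) (hB : IsBasis L.a B) {i : Fin M}
    (hi : i ∈ B) (x : EuclideanSpace ℝ (Fin (Module.finrank ℝ (orth L.a S)))) :
    |coordFun L.a S B i x| * ‖rowCoord L.a S i‖ ≤ ‖x‖ / δ := by
  have ha : 0 < ‖L.a i‖ := norm_pos_iff.2 (hB.row_ne_zero hi)
  rw [coordFun_apply hB hi]
  calc |coords L.a B (ofCoords (orth L.a S) x) i| * ‖rowCoord L.a S i‖
      ≤ (‖ofCoords (orth L.a S) x‖ / (δ * ‖L.a i‖)) * ‖L.a i‖ := by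
        gcongr
        · exact hw.abs_coords_le hδ hB hi _
        · exact norm_rowCoord_le _ _ _
    _ = ‖x‖ / δ := by
        rw [norm_ofCoords]; field_simp

/-- The expected number of pivots on the translate by a random vector of a segment `[c, d]`. -/
theorem lintegral_translated_leg_le (hw : Wide L.a δ) (hδ : 0 < δ)
    (hne : 0 < Module.finrank ℝ (orth L.a S)) {c d : EuclideanSpace ℝ (Fin n)}
    (hc : c ∈ orth L.a S) (hd : d ∈ orth L.a S)
    {N : EuclideanSpace ℝ (Fin (Module.finrank ℝ (orth L.a S))) → ℕ∞}
    (hN : ∀ x, ‖x‖ ≤ 2 * (Module.finrank ℝ (orth L.a S) : ℝ) →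
      N x ≤ ((Finset.univ.filter fun q : Finset (Fin M) × Fin M =>
        ∃ s, IsCrossing L B₀ S (c + ofCoords (orth L.a S) x) (d + ofCoords (orth L.a S) x)
          q.1 q.2 s).card : ℕ∞)) :
    ∫⁻ x, (N x : ℝ≥0∞) ∂(truncExp (Module.finrank ℝ (orth L.a S))) ≤
      ENNReal.ofReal (4 * (Module.finrank ℝ (orth L.a S) : ℝ) * ‖d - c‖ / δ) := by
  obtain ⟨p, hp⟩ := exists_ofCoords_eq hc
  obtain ⟨h, hh⟩ := exists_ofCoords_eq (sub_mem hd hc)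
  have hnorm : ‖h‖ = ‖d - c‖ := by rw [← norm_ofCoords, hh]
  refine (lintegral_pivots_le hne hN (p := p) (h := h) (α := 0) (β := 1) ?_
    (κ := fun _ => ENNReal.ofReal (‖d - c‖ / δ)) measurable_const ?_).trans_eq ?_
  · intro x _ B i s hs
    have hb := hs.optimal.vertex.basis
    have hpt : ∀ j ∈ B, coordFun L.a S B j (x + p + s • h) =
        coords L.a B (c + ofCoords (orth L.a S) x + s •
          ((d + ofCoords (orth L.a S) x) - (c + ofCoords (orth L.a S) x))) j := by
      intro j hj
      rw [coordFun_apply hb hj]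
      congr 1
      simp only [ofCoords_eq] at hp hh ⊢
      rw [map_add, map_add, map_smul, hp, hh]
      module
    have hi := (Finset.mem_sdiff.1 hs.mem).1
    refine ⟨?_, s, ⟨hs.nonneg, hs.lt_one.le⟩, ?_, fun j hj _ => ?_⟩
    · rw [coordFun_apply hb hi, hh]
      have := hs.decreasing
      rw [add_sub_add_right_eq_sub] at this
      exact this.ne
    · rw [hpt i hi]; exact hs.coord_eq
    · rw [hpt j (Finset.mem_sdiff.1 hj).1]; exact hs.optimal.nonneg j hj
  · intro B hB i hi x _ r _ _
    obtain ⟨hv, -⟩ := (Finset.mem_filter.1 hB).2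
    refine ENNReal.ofReal_le_ofReal ?_
    rw [← hnorm]
    exact hw.coordFun_mul_le hδ hv.basis (Finset.mem_sdiff.1 hi).1 h
  · rw [setLIntegral_const, Real.volume_Icc, sub_zero, ENNReal.ofReal_one, mul_one]
    rw [← ENNReal.ofReal_natCast, ← ENNReal.ofReal_mul (by positivity),
      show (4 : ℝ≥0∞) = ENNReal.ofReal 4 by norm_num, ← ENNReal.ofReal_mul (by positivity)]
    congr 1; ring

/-- The expected number of pivots on a segment contained in `{p + s • X | β⁻¹ ≤ s ≤ 1}`, where `X`
is the random vector. -/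
theorem lintegral_radial_leg_le (hw : Wide L.a δ) (hδ : 0 < δ)
    (hne : 0 < Module.finrank ℝ (orth L.a S)) {p : EuclideanSpace ℝ (Fin n)}
    (hp : p ∈ orth L.a S) {β : ℝ} (hβ : 1 ≤ β)
    {c d : EuclideanSpace ℝ (Fin (Module.finrank ℝ (orth L.a S))) → EuclideanSpace ℝ (Fin n)}
    {N : EuclideanSpace ℝ (Fin (Module.finrank ℝ (orth L.a S))) → ℕ∞}
    (hN : ∀ x, ‖x‖ ≤ 2 * (Module.finrank ℝ (orth L.a S) : ℝ) →
      N x ≤ ((Finset.univ.filter fun q : Finset (Fin M) × Fin M =>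
        ∃ s, IsCrossing L B₀ S (c x) (d x) q.1 q.2 s).card : ℕ∞))
    (hcr : ∀ x, ‖x‖ ≤ 2 * (Module.finrank ℝ (orth L.a S) : ℝ) → ∀ B i s,
      IsCrossing L B₀ S (c x) (d x) B i s → ∃ t, β⁻¹ ≤ t ∧ t ≤ 1 ∧
        c x + s • (d x - c x) = p + t • ofCoords (orth L.a S) x ∧
        coords L.a B (ofCoords (orth L.a S) x) i ≠ 0) :
    ∫⁻ x, (N x : ℝ≥0∞) ∂(truncExp (Module.finrank ℝ (orth L.a S))) ≤
      ENNReal.ofReal (8 * (Module.finrank ℝ (orth L.a S) : ℝ) ^ 2 / δ * Real.log β) := by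
  obtain ⟨h, hh⟩ := exists_ofCoords_eq hp
  have hβ0 : 0 < β := one_pos.trans_le hβ
  refine (lintegral_pivots_le hne hN (p := 0) (h := h) (α := 1) (β := β) ?_
    (κ := fun r => ENNReal.ofReal (2 * (Module.finrank ℝ (orth L.a S) : ℝ) / δ * r⁻¹))
    (by fun_prop) ?_).trans_eq ?_
  · intro x hx B i s hs
    obtain ⟨t, ht1, ht2, hpt, hX⟩ := hcr x hx B i s hs
    have ht0 : 0 < t := (inv_pos.2 hβ0).trans_le ht1
    have hb := hs.optimal.vertex.basis
    have hi := (Finset.mem_sdiff.1 hs.mem).1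
    -- the segment is rescaled by `t⁻¹`
    have hj : ∀ j ∈ B, coordFun L.a S B j (x + 0 + t⁻¹ • h) =
        t⁻¹ * coords L.a B (c x + s • (d x - c x)) j := by
      intro j hj
      rw [coordFun_apply hb hj, hpt, ← hb.coords_smul]
      congr 1
      simp only [ofCoords_eq] at hh ⊢
      rw [map_add, map_add, map_smul, hh, map_zero, smul_add, smul_smul,
        inv_mul_cancel₀ ht0.ne', one_smul]
      abel
    refine ⟨?_, t⁻¹, ⟨?_, ?_⟩, ?_, fun j hjm _ => ?_⟩
    · rw [coordFun_apply hb hi, hh]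
      intro h0
      have h1 := hs.coord_eq
      rw [hpt, hb.coords_add_smul, h0, zero_add] at h1
      exact hX ((mul_eq_zero.1 h1).resolve_left ht0.ne')
    · exact (one_le_inv₀ ht0).2 ht2
    · exact inv_le_of_inv_le₀ hβ0 ht1
    · rw [hj i hi, hs.coord_eq, mul_zero]
    · rw [hj j (Finset.mem_sdiff.1 hjm).1]
      exact mul_nonneg (inv_pos.2 ht0).le (hs.optimal.nonneg j hjm)
  · intro B hB i hi x hx r hr h0
    obtain ⟨hv, -⟩ := (Finset.mem_filter.1 hB).2
    refine ENNReal.ofReal_le_ofReal ?_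
    have hr0 : 0 < r := one_pos.trans_le hr.1
    have h1 := hw.coordFun_mul_le (S := S) hδ hv.basis (Finset.mem_sdiff.1 hi).1 x
    rw [add_zero, map_add, map_smul, smul_eq_mul] at h0
    have h2 : |coordFun L.a S B i x| = r * |coordFun L.a S B i h| := by
      rw [show coordFun L.a S B i x = -(r * coordFun L.a S B i h) by linarith, abs_neg, abs_mul,
        abs_of_pos hr0]
    rw [h2] at h1
    rw [← div_eq_mul_inv, le_div_iff₀ hr0]
    calc |coordFun L.a S B i h| * ‖rowCoord L.a S i‖ * r
        = r * |coordFun L.a S B i h| * ‖rowCoord L.a S i‖ := by ring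
      _ ≤ ‖x‖ / δ := h1
      _ ≤ 2 * (Module.finrank ℝ (orth L.a S) : ℝ) / δ := by gcongr
  · have h1 : ∫⁻ r in Set.Icc 1 β, ENNReal.ofReal (2 * (Module.finrank ℝ (orth L.a S) : ℝ) / δ * r⁻¹) =
        ENNReal.ofReal (2 * (Module.finrank ℝ (orth L.a S) : ℝ) / δ * Real.log β) := by
      rw [← ofReal_integral_eq_lintegral_ofReal]
      · rw [integral_const_mul, integral_Icc_eq_integral_Ioc,
          ← intervalIntegral.integral_of_le hβ, integral_inv_of_pos one_pos hβ0, div_one]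
      · refine Integrable.const_mul ?_ _
        refine ContinuousOn.integrableOn_Icc ?_
        exact continuousOn_id.inv₀ fun r hr => (one_pos.trans_le hr.1).ne'
      · filter_upwards [ae_restrict_mem measurableSet_Icc] with r hr
        have : 0 < r := one_pos.trans_le hr.1
        positivity
    rw [h1, ← ENNReal.ofReal_natCast, ← ENNReal.ofReal_mul (by positivity),
      show (4 : ℝ≥0∞) = ENNReal.ofReal 4 by norm_num, ← ENNReal.ofReal_mul (by positivity)]
    congr 1; ring

end Legs

/-! ### Laws of outcomes -/

section Law

variable {α α' X : Type} {Q : α → Prop} {K : ℝ≥0∞} {μ : Measure (Outcome α)}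

/-- A probability law of outcomes such that the result almost surely satisfies `Q` and the expected
number of pivots is at most `K`. -/
structure GoodLaw (Q : α → Prop) (K : ℝ≥0∞) (μ : Measure (Outcome α)) : Prop where
  prob : IsProbabilityMeasure μ
  correct : ∀ᵐ o ∂μ, Q o.result
  cost : ∫⁻ o, (o.pivots : ℝ≥0∞) ∂μ ≤ K

theorem GoodLaw.mono (h : GoodLaw Q K μ) {Q' : α → Prop} {K' : ℝ≥0∞} (hQ : ∀ r, Q r → Q' r)
    (hK : K ≤ K') : GoodLaw Q' K' μ :=
  ⟨h.prob, h.correct.mono fun _ => hQ _, h.cost.trans hK⟩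

theorem GoodLaw.dirac {o : Outcome α} (ho : Q o.result) :
    GoodLaw Q (o.pivots : ℝ≥0∞) (Measure.dirac o) := by
  refine ⟨inferInstance, ?_, ?_⟩
  · rw [ae_dirac_eq]; exact ho
  · rw [lintegral_dirac]

theorem GoodLaw.add (h : GoodLaw Q K μ) (N : ℕ∞) :
    GoodLaw Q (N + K) (μ.map (Outcome.add N)) := by
  have hm : Measurable (Outcome.add N : Outcome α → Outcome α) := measurable_from_top
  have := h.prob
  refine ⟨Measure.isProbabilityMeasure_map hm.aemeasurable, ?_, ?_⟩
  · rw [ae_map_iff hm.aemeasurable trivial]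
    exact h.correct
  · rw [lintegral_map measurable_from_top hm]
    simp only [Outcome.add, ENat.toENNReal_add]
    rw [lintegral_add_left measurable_const, lintegral_const, measure_univ, mul_one]
    gcongr
    exact h.cost

theorem GoodLaw.bind [MeasurableSpace X] {ν : Measure X} [IsProbabilityMeasure ν]
    {f : X → Measure (Outcome α)} (hf : Measurable f) {g : X → ℝ≥0∞}
    (h : ∀ᵐ x ∂ν, GoodLaw Q (g x) (f x)) (hg : ∫⁻ x, g x ∂ν ≤ K) : GoodLaw Q K (ν.bind f) := by
  refine ⟨⟨?_⟩, ?_, ?_⟩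
  · rw [Measure.bind_apply MeasurableSet.univ hf.aemeasurable]
    rw [lintegral_congr_ae (g := fun _ => 1) (h.mono fun x hx => hx.prob.measure_univ)]
    simp
  · rw [ae_iff, Measure.bind_apply (s := {o : Outcome α | ¬ Q o.result}) trivial hf.aemeasurable]
    rw [lintegral_congr_ae (g := fun _ => 0) (h.mono fun x hx => ae_iff.1 hx.correct)]
    simp
  · rw [Measure.lintegral_bind hf.aemeasurable measurable_from_top.aemeasurable]
    exact (lintegral_mono_ae (h.mono fun x hx => hx.cost)).trans hg

theorem GoodLaw.bind_outcome {Q' : α' → Prop} (h : GoodLaw Q K μ)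
    {f : Outcome α → Measure (Outcome α')} {K' : ℝ≥0∞}
    (hf : ∀ o, Q o.result → GoodLaw Q' (o.pivots + K') (f o)) :
    GoodLaw Q' (K + K') (μ.bind f) := by
  have := h.prob
  refine GoodLaw.bind measurable_from_top (h.correct.mono fun o ho => hf o ho) ?_
  rw [lintegral_add_right _ measurable_const, lintegral_const, measure_univ, mul_one]
  gcongr
  exact h.cost

end Law

/-! ### Measurability: outcomes depend on finitely many comparisons -/

section Measurability

theorem measurable_of_factors {X β ι : Type*} [MeasurableSpace X] [MeasurableSpace β] [Finite ι]
    {P : X → ι → Prop} (hP : ∀ i, Measurable fun x => P x i) {f : X → β}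
    (hf : ∀ x y, P x = P y → f x = f y) : Measurable f := by
  rcases isEmpty_or_nonempty X with hX | ⟨⟨x₀⟩⟩
  · exact measurable_of_empty f
  have h1 : f = Function.extend P f (fun _ => f x₀) ∘ P := by
    funext x
    exact (Function.FactorsThrough.extend_apply (fun x y h => hf x y h) _ x).symm
  rw [h1]
  exact (Measurable.of_discrete (f := Function.extend P f (fun _ => f x₀))).comp
    (measurable_pi_iff.2 hP)

variable {M n : ℕ} {L : LinSys M n} {B₀ B S : Finset (Fin M)} {X : Type*} [MeasurableSpace X]

/-- The condition for row `i` to be a candidate for leaving the basis. -/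
def LeavingCond (L : LinSys M n) (S : Finset (Fin M)) (c d : EuclideanSpace ℝ (Fin n))
    (B : Finset (Fin M)) (i : Fin M) : Prop :=
  coords L.a B d i < coords L.a B c i ∧
    coords L.a B c i / (coords L.a B c i - coords L.a B d i) < 1 ∧
    ∀ k ∈ B \ S, coords L.a B d k < coords L.a B c k →
      coords L.a B c i / (coords L.a B c i - coords L.a B d i) ≤
        coords L.a B c k / (coords L.a B c k - coords L.a B d k)

theorem leaving_eq (c d : EuclideanSpace ℝ (Fin n)) :
    leaving L S c d B = firstSuch (B \ S) (LeavingCond L S c d B) := rfl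

theorem IsBasis.measurable_coords {a : Fin M → EuclideanSpace ℝ (Fin n)} (hB : IsBasis a B)
    {c : X → EuclideanSpace ℝ (Fin n)} (hc : Measurable c) (i : Fin M) :
    Measurable fun x => coords a B (c x) i := by
  by_cases hi : i ∈ B
  · simp only [hB.coords_eq_inner hi]
    fun_prop
  · simp only [hB.coords_of_notMem _ hi]
    exact measurable_const

theorem measurable_leavingCond {c d : X → EuclideanSpace ℝ (Fin n)} (hc : Measurable c)
    (hd : Measurable d) (B : Finset (Fin M)) (i : Fin M) :
    Measurable fun x => IsBasis L.a B ∧ LeavingCond L S (c x) (d x) B i := by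
  by_cases hB : IsBasis L.a B
  · have h1 : ∀ k, Measurable fun x => coords L.a B (c x) k := hB.measurable_coords hc
    have h2 : ∀ k, Measurable fun x => coords L.a B (d x) k := hB.measurable_coords hd
    have h3 : ∀ k, Measurable fun x =>
        coords L.a B (c x) k / (coords L.a B (c x) k - coords L.a B (d x) k) := fun k =>
      (h1 k).div ((h1 k).sub (h2 k))
    refine measurable_const.and ((measurableSet_setOfPred.1 (measurableSet_lt (h2 i) (h1 i))).and
      ((measurableSet_setOfPred.1 (measurableSet_lt (h3 i) measurable_const)).and ?_))
    refine Measurable.forall fun k => measurable_const.imp ?_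
    exact (measurableSet_setOfPred.1 (measurableSet_lt (h2 k) (h1 k))).imp
      (measurableSet_setOfPred.1 (measurableSet_le (h3 i) (h3 k)))
  · simp only [hB, false_and]
    exact measurable_const

theorem IsBasis.pivot (hB : IsBasis L.a B) {c d : EuclideanSpace ℝ (Fin n)} {B' : Finset (Fin M)}
    (h : pivot L B₀ S c d B = some B') : IsBasis L.a B' := by
  obtain ⟨i, j, hi, hj, rfl⟩ := pivot_eq_some h
  exact hB.exchange (Finset.mem_sdiff.1 (firstSuch_eq_some hi).1).1 (entering_spec hj).2.2.1.ne'

theorem IsBasis.follow (hB : IsBasis L.a B) (c d : EuclideanSpace ℝ (Fin n)) :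
    IsBasis L.a (follow L B₀ S c d B).result :=
  iterate_getD_invariant (p := ShadowSimplex.pivot L B₀ S c d) hB (fun _ _ h h' => h.pivot h') _

/-- The outcome of following a segment only depends on which rows may leave which basis. -/
theorem follow_congr (hB : IsBasis L.a B) {c d c' d' : EuclideanSpace ℝ (Fin n)}
    (h : ∀ B' i, (IsBasis L.a B' ∧ LeavingCond L S c d B' i) =
      (IsBasis L.a B' ∧ LeavingCond L S c' d' B' i)) :
    follow L B₀ S c d B = follow L B₀ S c' d' B := by
  have hp : ∀ B', IsBasis L.a B' → pivot L B₀ S c d B' = pivot L B₀ S c' d' B' := by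
    intro B' hB'
    have h1 : LeavingCond L S c d B' = LeavingCond L S c' d' B' := by
      funext i
      have := h B' i
      simpa [hB'] using this
    rw [ShadowSimplex.pivot, ShadowSimplex.pivot, leaving_eq, leaving_eq, h1]
  have hbas := iterate_getD_invariant (p := pivot L B₀ S c d) hB (fun _ _ h h' => h.pivot h')
  have hit : ∀ t, (fun B' => (pivot L B₀ S c d B').getD B')^[t] B =
      (fun B' => (pivot L B₀ S c' d' B').getD B')^[t] B := by
    intro t
    induction t with
    | zero => rfl
    | succ t ih =>
      rw [Function.iterate_succ_apply', Function.iterate_succ_apply', ← ih, hp _ (hbas t)]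
  have hN : {t : ℕ | (pivot L B₀ S c d
      ((fun B' => (pivot L B₀ S c d B').getD B')^[t] B)).isSome} =
      {t : ℕ | (pivot L B₀ S c' d'
        ((fun B' => (pivot L B₀ S c' d' B').getD B')^[t] B)).isSome} := by
    ext t
    rw [Set.mem_ofPred_eq, Set.mem_ofPred_eq, ← hit t, hp _ (hbas t)]
  unfold follow
  simp only [hit] at hN ⊢
  rw [hN]

end Measurability

/-! ### Optimization over the faces of a polytope -/

section Optimize

variable {M n : ℕ} {L : LinSys M n} {B₀ B S : Finset (Fin M)} {δ : ℝ}
  {d : EuclideanSpace ℝ (Fin n)}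

/-- The initial objective, which is optimal at the basis `B` of the face. -/
noncomputable def startObj (L : LinSys M n) (S B : Finset (Fin M)) : EuclideanSpace ℝ (Fin n) :=
  ∑ i ∈ B \ S, ‖proj L.a S (L.a i)‖⁻¹ • proj L.a S (L.a i)

/-- The projected objective, scaled to have norm `2`. -/
noncomputable def scaledObj (L : LinSys M n) (S : Finset (Fin M))
    (d : EuclideanSpace ℝ (Fin n)) : EuclideanSpace ℝ (Fin n) :=
  (2 / ‖proj L.a S d‖) • proj L.a S d

/-- The final objective, a small random perturbation of the scaled objective. -/
noncomputable def endObj (L : LinSys M n) (S : Finset (Fin M)) (δ : ℝ)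
    (d : EuclideanSpace ℝ (Fin n))
    (x : EuclideanSpace ℝ (Fin (Module.finrank ℝ (orth L.a S)))) : EuclideanSpace ℝ (Fin n) :=
  scaledObj L S d + (δ / (2 * (Module.finrank ℝ (orth L.a S) : ℝ) ^ 3)) •
    ofCoords (orth L.a S) x

/-- The outcome of the three segments, as a function of the random vector. -/
noncomputable def legs (L : LinSys M n) (B₀ S B : Finset (Fin M)) (δ : ℝ)
    (d : EuclideanSpace ℝ (Fin n))
    (x : EuclideanSpace ℝ (Fin (Module.finrank ℝ (orth L.a S)))) :
    Outcome (Finset (Fin M)) :=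
  threeLegs L B₀ S (startObj L S B) (scaledObj L S d) (endObj L S δ d x)
    (ofCoords (orth L.a S) x) B

/-- The row made tight after the three segments, if any. -/
noncomputable def tightRow (L : LinSys M n) (S : Finset (Fin M)) (e : EuclideanSpace ℝ (Fin n))
    (B : Finset (Fin M)) : Option (Fin M) :=
  firstSuch (B \ S) fun i =>
    1 / (Module.finrank ℝ (orth L.a S) : ℝ) < coords L.a B e i * ‖proj L.a S (L.a i)‖

theorem optimizeFace_succ (t : ℕ) : optimizeFace L B₀ δ d (t + 1) S B =
    if proj L.a S d = 0 then Measure.dirac ⟨B, 0⟩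
    else (truncExp (Module.finrank ℝ (orth L.a S))).bind fun x =>
      match tightRow L S (endObj L S δ d x) (legs L B₀ S B δ d x).result with
      | none => Measure.dirac (legs L B₀ S B δ d x)
      | some i => (optimizeFace L B₀ δ d t (insert i S) (legs L B₀ S B δ d x).result).map
          (Outcome.add (legs L B₀ S B δ d x).pivots) := rfl

theorem startObj_mem : startObj L S B ∈ orth L.a S :=
  Submodule.sum_mem _ fun _ _ => Submodule.smul_mem _ _ (proj_mem _)

theorem scaledObj_mem : scaledObj L S d ∈ orth L.a S := Submodule.smul_mem _ _ (proj_mem _)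

theorem norm_scaledObj (hd : proj L.a S d ≠ 0) : ‖scaledObj L S d‖ = 2 := by
  have : 0 < ‖proj L.a S d‖ := norm_pos_iff.2 hd
  rw [scaledObj, norm_smul, Real.norm_of_nonneg (by positivity), div_mul_cancel₀ _ this.ne']

theorem IsBasis.coords_startObj (hB : IsBasis L.a B) (hS : S ⊆ B) {i : Fin M} (hi : i ∈ B \ S) :
    coords L.a B (startObj L S B) i = ‖proj L.a S (L.a i)‖⁻¹ := by
  have hi' := Finset.mem_sdiff.1 hi
  have h1 : startObj L S B =
      proj L.a S (∑ i ∈ B \ S, ‖proj L.a S (L.a i)‖⁻¹ • L.a i) := by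
    simp only [startObj, proj, map_sum, map_smul]
  rw [h1, hB.coords_proj hS hi'.2]
  rw [hB.coords_eq (f := fun i => if i ∈ S then 0 else ‖proj L.a S (L.a i)‖⁻¹) _ hi'.1,
    if_neg hi'.2]
  rw [← Finset.sum_sdiff hS, Finset.sum_eq_zero (s := S) fun k hk => by simp [hk], add_zero]
  exact Finset.sum_congr rfl fun k hk => by rw [if_neg (Finset.mem_sdiff.1 hk).2]

theorem IsBasis.coords_scaledObj (hB : IsBasis L.a B) (hS : S ⊆ B) {i : Fin M} (hi : i ∉ S) :
    coords L.a B (scaledObj L S d) i = 2 / ‖proj L.a S d‖ * coords L.a B d i := by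
  rw [scaledObj, hB.coords_smul, hB.coords_proj hS hi]

theorem IsOptimal.of_scaledObj (hd : proj L.a S d ≠ 0)
    (h : IsOptimal L B₀ S (scaledObj L S d) B) : IsOptimal L B₀ S d B := by
  refine ⟨h.vertex, h.face, fun k hk => ?_⟩
  have h1 := h.nonneg k hk
  rw [h.vertex.basis.coords_scaledObj h.face (Finset.mem_sdiff.1 hk).2] at h1
  have : 0 < ‖proj L.a S d‖ := norm_pos_iff.2 hd
  exact nonneg_of_mul_nonneg_right h1 (by positivity)

theorem norm_startObj_le (hB : IsBasis L.a B) (hS : S ⊆ B) :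
    ‖startObj L S B‖ ≤ Module.finrank ℝ (orth L.a S) := by
  rw [hB.finrank_orth hS, startObj]
  refine (norm_sum_le _ _).trans ?_
  rw [Finset.card_eq_sum_ones, Nat.cast_sum]
  refine Finset.sum_le_sum fun i hi => ?_
  rw [norm_smul, norm_inv, norm_norm, inv_mul_cancel₀ (norm_ne_zero_iff.2
    (hB.proj_row_ne_zero hS hi))]
  simp

theorem IsVertex.startObj (hB : IsVertex L B₀ B) (hS : S ⊆ B) :
    IsOptimal L B₀ S (startObj L S B) B :=
  ⟨hB, hS, fun k hk => by rw [hB.basis.coords_startObj hS hk]; positivity⟩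

theorem finrank_orth_pos (hd : proj L.a S d ≠ 0) : 0 < Module.finrank ℝ (orth L.a S) := by
  have : Nontrivial (orth L.a S) := ⟨⟨⟨_, proj_mem d⟩, 0, fun h => hd (congrArg Subtype.val h)⟩⟩
  exact Module.finrank_pos

theorem norm_endObj_sub_le (hδ : 0 < δ) (hk : 0 < Module.finrank ℝ (orth L.a S))
    {x : EuclideanSpace ℝ (Fin (Module.finrank ℝ (orth L.a S)))}
    (hx : ‖x‖ ≤ 2 * (Module.finrank ℝ (orth L.a S) : ℝ)) :
    ‖scaledObj L S d - endObj L S δ d x‖ ≤ δ / (Module.finrank ℝ (orth L.a S) : ℝ) ^ 2 := by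
  have hk' : (0 : ℝ) < (Module.finrank ℝ (orth L.a S) : ℝ) := Nat.cast_pos.2 hk
  rw [endObj, sub_add_cancel_left, norm_neg, norm_smul, Real.norm_of_nonneg (by positivity),
    norm_ofCoords]
  calc δ / (2 * (Module.finrank ℝ (orth L.a S) : ℝ) ^ 3) * ‖x‖
      ≤ δ / (2 * (Module.finrank ℝ (orth L.a S) : ℝ) ^ 3) *
        (2 * (Module.finrank ℝ (orth L.a S) : ℝ)) := by gcongr
    _ = _ := by field_simp

/-- If no coefficient is large, then the final objective is half the scaled objective, and the
final basis is optimal. -/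
theorem IsOptimal.of_tightRow_eq_none (hδ : 0 < δ) (hδ1 : δ ≤ 1) (hd : proj L.a S d ≠ 0)
    {x : EuclideanSpace ℝ (Fin (Module.finrank ℝ (orth L.a S)))}
    (hx : ‖x‖ ≤ 2 * (Module.finrank ℝ (orth L.a S) : ℝ))
    (ho : IsOptimal L B₀ S (endObj L S δ d x) B)
    (h : tightRow L S (endObj L S δ d x) B = none) : IsOptimal L B₀ S d B := by
  have hk := finrank_orth_pos hd
  have hk' : (1 : ℝ) ≤ (Module.finrank ℝ (orth L.a S) : ℝ) := Nat.one_le_cast.2 hk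
  have hb := ho.vertex.basis
  set e := endObj L S δ d x with he
  have hemem : e ∈ orth L.a S :=
    Submodule.add_mem _ scaledObj_mem (Submodule.smul_mem _ _ (ofCoords_mem _ _))
  have h1 : ‖e‖ ≤ 1 := by
    rw [← hb.sum_coords_proj ho.face hemem]
    refine (norm_sum_le _ _).trans ?_
    refine (Finset.sum_le_card_nsmul _ _ (1 / (Module.finrank ℝ (orth L.a S) : ℝ))
      fun i hi => ?_).trans_eq ?_
    · rw [norm_smul, Real.norm_of_nonneg (ho.nonneg i hi)]
      exact not_lt.1 (firstSuch_eq_none h hi)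
    · rw [← hb.finrank_orth ho.face, nsmul_eq_mul]
      field_simp
  have h2 := norm_scaledObj hd
  have h3 : ‖scaledObj L S d - e‖ ≤ 1 := by
    refine (norm_endObj_sub_le hδ hk hx).trans ?_
    rw [div_le_one (by positivity)]
    nlinarith
  -- norms at most `1` adding up to a vector of norm `2`: the summands are equal
  have h4 : scaledObj L S d = (2 : ℝ) • e := by
    have h5 := parallelogram_law_with_norm ℝ e (scaledObj L S d - e)
    rw [add_sub_cancel, h2] at h5
    have h6 : ‖e - (scaledObj L S d - e)‖ = 0 := by
      have := norm_nonneg (e - (scaledObj L S d - e))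
      have := norm_nonneg e
      have := norm_nonneg (scaledObj L S d - e)
      nlinarith
    rw [norm_eq_zero, sub_eq_zero] at h6
    rw [two_smul]
    nth_rewrite 2 [h6]
    abel
  refine IsOptimal.of_scaledObj hd ⟨ho.vertex, ho.face, fun k hk => ?_⟩
  rw [h4, hb.coords_smul]
  exact mul_nonneg zero_le_two (ho.nonneg k hk)

/-- A row that is made tight belongs to an optimal basis of the face. -/
theorem IsOptimal.exists_of_tightRow_eq_some (hL : L.IsBounded) (hw : Wide L.a δ) (hδ : 0 < δ)
    (hd : proj L.a S d ≠ 0)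
    {x : EuclideanSpace ℝ (Fin (Module.finrank ℝ (orth L.a S)))}
    (hx : ‖x‖ ≤ 2 * (Module.finrank ℝ (orth L.a S) : ℝ))
    (ho : IsOptimal L B₀ S (endObj L S δ d x) B) {i : Fin M}
    (h : tightRow L S (endObj L S δ d x) B = some i) :
    i ∈ B \ S ∧ ∃ B', IsOptimal L B₀ S d B' ∧ i ∈ B' := by
  obtain ⟨hi, hlt⟩ := firstSuch_eq_some h
  refine ⟨hi, ?_⟩
  have hk := finrank_orth_pos hd
  have hk' : (1 : ℝ) ≤ (Module.finrank ℝ (orth L.a S) : ℝ) := Nat.one_le_cast.2 hk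
  have hb := ho.vertex.basis
  have hi' := (Finset.mem_sdiff.1 hi).1
  have ha : 0 < ‖L.a i‖ := norm_pos_iff.2 (hb.row_ne_zero hi')
  obtain ⟨B', hB', hiB'⟩ := ho.exists_optimal_mem (d := scaledObj L S d) hL hi'
    (μ := 1 / ((Module.finrank ℝ (orth L.a S) : ℝ) ^ 2 * ‖L.a i‖)) (by
      have h0 := ho.nonneg i hi
      rw [div_lt_iff₀ (by positivity)]
      rw [div_lt_iff₀ (by positivity)] at hlt
      calc 1 < coords L.a B (endObj L S δ d x) i * ‖proj L.a S (L.a i)‖ *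
            (Module.finrank ℝ (orth L.a S) : ℝ) := hlt
        _ ≤ coords L.a B (endObj L S δ d x) i * ‖L.a i‖ *
            (Module.finrank ℝ (orth L.a S) : ℝ) ^ 2 := by
          gcongr
          · exact norm_proj_le _
          · exact le_self_pow₀ hk' two_ne_zero
        _ = _ := by ring)
    (fun B' hB' hiB' => by
      refine (hw.abs_coords_le hδ hB' hiB' _).trans ?_
      calc ‖scaledObj L S d - endObj L S δ d x‖ / (δ * ‖L.a i‖)
          ≤ (δ / (Module.finrank ℝ (orth L.a S) : ℝ) ^ 2) / (δ * ‖L.a i‖) := by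
            gcongr
            exact norm_endObj_sub_le hδ hk hx
        _ = _ := by field_simp)
  exact ⟨B', hB'.of_scaledObj hd, hiB'⟩

/-! ### The expected number of pivots on the three segments -/

theorem IsOptimal.follow_pivots_le {c d : EuclideanSpace ℝ (Fin n)}
    (hB : IsOptimal L B₀ S c B) : (ShadowSimplex.follow L B₀ S c d B).pivots ≤
      ((Finset.univ.filter fun q : Finset (Fin M) × Fin M =>
        ∃ s, IsCrossing L B₀ S c d q.1 q.2 s).card : ℕ∞) :=
  (follow_spec hB (fun _ _ => True) trivial (fun _ _ _ _ _ _ _ _ _ => trivial)).2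

/-- A bound for the expected number of pivots on the three segments, in dimension at most `n`. -/
noncomputable def levelCost (n : ℕ) (δ : ℝ) : ℝ := 32 * ((n : ℝ) ^ 2 / δ * (1 + Real.log (n / δ)))

theorem levelCost_bound {k : ℕ} (hk : 0 < k) (hkn : k ≤ n) (hδ : 0 < δ) (hδ1 : δ ≤ 1) :
    8 * (k : ℝ) ^ 2 / δ * Real.log (2 * k / δ) + 4 * (k : ℝ) * (k + 2) / δ +
      8 * (k : ℝ) ^ 2 / δ * Real.log (2 * (k : ℝ) ^ 3 / δ) ≤ levelCost n δ := by
  have hk1 : (1 : ℝ) ≤ k := Nat.one_le_cast.2 hk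
  have hkn' : (k : ℝ) ≤ n := Nat.cast_le.2 hkn
  have hn1 : (1 : ℝ) ≤ n := hk1.trans hkn'
  have hlog0 : 0 ≤ Real.log (n / δ) := by
    refine Real.log_nonneg ?_
    rw [le_div_iff₀ hδ]; linarith
  have hlog2 : Real.log 2 ≤ 1 := by
    have := Real.log_two_lt_d9; linarith
  have hmono : Real.log (2 * (n : ℝ) ^ 3 / δ ^ 3) = Real.log 2 + 3 * Real.log (n / δ) := by
    rw [mul_div_assoc, ← div_pow, Real.log_mul two_ne_zero (by positivity), Real.log_pow]
    norm_num
  have h2 : Real.log (2 * k / δ) ≤ 1 + Real.log (n / δ) := by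
    have : Real.log (2 * k / δ) ≤ Real.log (2 * (n / δ)) := by
      refine Real.log_le_log (by positivity) ?_
      rw [mul_div_assoc]; gcongr
    rw [Real.log_mul two_ne_zero (by positivity)] at this
    linarith
  have h3 : Real.log (2 * (k : ℝ) ^ 3 / δ) ≤ 1 + 3 * Real.log (n / δ) := by
    have : Real.log (2 * (k : ℝ) ^ 3 / δ) ≤ Real.log (2 * (n : ℝ) ^ 3 / δ ^ 3) := by
      refine Real.log_le_log (by positivity) ?_
      gcongr
      exact pow_le_of_le_one hδ.le hδ1 three_ne_zero
    linarith
  have h4 : 4 * (k : ℝ) * (k + 2) / δ ≤ 12 * ((n : ℝ) ^ 2 / δ) := by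
    rw [← mul_div_assoc, div_le_div_iff_of_pos_right hδ]
    nlinarith
  have h5 : 8 * (k : ℝ) ^ 2 / δ ≤ 8 * ((n : ℝ) ^ 2 / δ) := by
    rw [← mul_div_assoc]; gcongr
  have h6 : 8 * (k : ℝ) ^ 2 / δ * Real.log (2 * k / δ) ≤
      8 * ((n : ℝ) ^ 2 / δ) * (1 + Real.log (n / δ)) := by
    refine mul_le_mul h5 h2 (Real.log_nonneg ?_) (by positivity)
    rw [le_div_iff₀ hδ]; linarith
  have h7 : 8 * (k : ℝ) ^ 2 / δ * Real.log (2 * (k : ℝ) ^ 3 / δ) ≤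
      8 * ((n : ℝ) ^ 2 / δ) * (1 + 3 * Real.log (n / δ)) := by
    refine mul_le_mul h5 h3 (Real.log_nonneg ?_) (by positivity)
    rw [le_div_iff₀ hδ]
    have := one_le_pow₀ hk1 (n := 3)
    linarith
  have h8 : 0 ≤ (n : ℝ) ^ 2 / δ := by positivity
  rw [levelCost]
  nlinarith [mul_nonneg h8 hlog0]

end Optimize

section Optimize

variable {M n : ℕ} {L : LinSys M n} {B₀ B S : Finset (Fin M)} {δ : ℝ}
  {d : EuclideanSpace ℝ (Fin n)}

theorem measurable_ofCoords (W : Submodule ℝ (EuclideanSpace ℝ (Fin n))) :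
    Measurable (ofCoords W) := (ofCoordsL W).continuous.measurable

theorem measurable_endObj : Measurable (endObj L S δ d) :=
  measurable_const.add ((measurable_ofCoords (orth L.a S)).const_smul
    (δ / (2 * (Module.finrank ℝ (orth L.a S) : ℝ) ^ 3)))

/-- The comparisons that determine the course of the algorithm on a face. -/
def comparisons (L : LinSys M n) (S B : Finset (Fin M)) (δ : ℝ) (d : EuclideanSpace ℝ (Fin n))
    (x : EuclideanSpace ℝ (Fin (Module.finrank ℝ (orth L.a S)))) :
    ((Finset (Fin M) × Fin M) ⊕ (Finset (Fin M) × Fin M)) ⊕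
      ((Finset (Fin M) × Fin M) ⊕ (Finset (Fin M) × Fin M)) → Prop :=
  Sum.elim
    (Sum.elim
      (fun q => IsBasis L.a q.1 ∧ LeavingCond L S (startObj L S B)
        (startObj L S B + ofCoords (orth L.a S) x) q.1 q.2)
      (fun q => IsBasis L.a q.1 ∧ LeavingCond L S (startObj L S B + ofCoords (orth L.a S) x)
        (scaledObj L S d + ofCoords (orth L.a S) x) q.1 q.2))
    (Sum.elim
      (fun q => IsBasis L.a q.1 ∧ LeavingCond L S (scaledObj L S d + ofCoords (orth L.a S) x)
        (endObj L S δ d x) q.1 q.2)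
      (fun q => IsBasis L.a q.1 ∧ 1 / (Module.finrank ℝ (orth L.a S) : ℝ) <
        coords L.a q.1 (endObj L S δ d x) q.2 * ‖proj L.a S (L.a q.2)‖))

theorem measurable_comparisons (q) : Measurable fun x => comparisons L S B δ d x q := by
  have hX := measurable_ofCoords (orth L.a S)
  have he : Measurable (endObj L S δ d) := measurable_endObj
  rcases q with (q | q) | (q | q)
  · exact measurable_leavingCond measurable_const (measurable_const.add hX) _ _
  · exact measurable_leavingCond (measurable_const.add hX) (measurable_const.add hX) _ _
  · exact measurable_leavingCond (measurable_const.add hX) he _ _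
  · simp only [comparisons, Sum.elim_inr]
    by_cases hB : IsBasis L.a q.1
    · exact measurable_const.and (measurableSet_setOfPred.1 (measurableSet_lt measurable_const
        ((hB.measurable_coords he q.2).mul_const _)))
    · simp only [hB, false_and]
      exact measurable_const

theorem legs_congr (hB : IsBasis L.a B)
    {x y : EuclideanSpace ℝ (Fin (Module.finrank ℝ (orth L.a S)))}
    (h : comparisons L S B δ d x = comparisons L S B δ d y) :
    legs L B₀ S B δ d x = legs L B₀ S B δ d y := by
  have h1 := hB.follow (B₀ := B₀) (S := S) (startObj L S B)
    (startObj L S B + ofCoords (orth L.a S) x)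
  have e1 := follow_congr (B₀ := B₀) hB fun B' i => congrFun h (Sum.inl (Sum.inl (B', i)))
  have h2 := h1.follow (B₀ := B₀) (S := S) (startObj L S B + ofCoords (orth L.a S) x)
    (scaledObj L S d + ofCoords (orth L.a S) x)
  have e2 := follow_congr (B₀ := B₀) h1 fun B' i => congrFun h (Sum.inl (Sum.inr (B', i)))
  have e3 := follow_congr (B₀ := B₀) h2 fun B' i => congrFun h (Sum.inr (Sum.inl (B', i)))
  simp only [legs, threeLegs]
  rw [e3, e2, e1]

theorem IsBasis.legs (hB : IsBasis L.a B)
    (x : EuclideanSpace ℝ (Fin (Module.finrank ℝ (orth L.a S)))) :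
    IsBasis L.a (legs L B₀ S B δ d x).result :=
  ((hB.follow _ _).follow _ _).follow _ _

theorem tightRow_congr (hB : IsBasis L.a B)
    {x y : EuclideanSpace ℝ (Fin (Module.finrank ℝ (orth L.a S)))}
    (h : comparisons L S B δ d x = comparisons L S B δ d y) :
    tightRow L S (endObj L S δ d x) (legs L B₀ S B δ d x).result =
      tightRow L S (endObj L S δ d y) (legs L B₀ S B δ d y).result := by
  rw [← legs_congr hB h, tightRow, tightRow]
  congr 1
  funext i
  have := congrFun h (Sum.inr (Sum.inr ((ShadowSimplex.legs L B₀ S B δ d x).result, i)))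
  simpa [comparisons, hB.legs x] using this

theorem measurable_of_comparisons {β : Type*} [MeasurableSpace β]
    {f : EuclideanSpace ℝ (Fin (Module.finrank ℝ (orth L.a S))) → β}
    (hf : ∀ x y, comparisons L S B δ d x = comparisons L S B δ d y → f x = f y) : Measurable f :=
  measurable_of_factors measurable_comparisons hf

/-- On the first segment, from `c` to `c + X`, no cone is left before the time `δ / (2 k)`, as `c`
lies deep in the cone of the initial basis. -/
theorem lintegral_first_leg_le (hw : Wide L.a δ) (hδ : 0 < δ) (hδ1 : δ ≤ 1)
    (hB : IsVertex L B₀ B) (hS : S ⊆ B) (hk : 0 < Module.finrank ℝ (orth L.a S)) :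
    ∫⁻ x, ((follow L B₀ S (startObj L S B) (startObj L S B + ofCoords (orth L.a S) x) B).pivots :
      ℝ≥0∞) ∂(truncExp (Module.finrank ℝ (orth L.a S))) ≤
      ENNReal.ofReal (8 * (Module.finrank ℝ (orth L.a S) : ℝ) ^ 2 / δ *
        Real.log (2 * (Module.finrank ℝ (orth L.a S) : ℝ) / δ)) := by
  have hk' : (1 : ℝ) ≤ (Module.finrank ℝ (orth L.a S) : ℝ) := Nat.one_le_cast.2 hk
  refine lintegral_radial_leg_le (B₀ := B₀) hw hδ hk (startObj_mem (B := B))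
    (by rw [le_div_iff₀ hδ]; linarith) (c := fun _ => startObj L S B)
    (d := fun x => startObj L S B + ofCoords (orth L.a S) x)
    (fun x _ => (hB.startObj hS).follow_pivots_le) fun x hx B' i s hs => ?_
  have hpt : startObj L S B + s • (startObj L S B + ofCoords (orth L.a S) x - startObj L S B) =
      startObj L S B + s • ofCoords (orth L.a S) x := by rw [add_sub_cancel_left]
  have hdec := hs.decreasing
  rw [add_sub_cancel_left] at hdec
  refine ⟨s, ?_, hs.lt_one.le, hpt, hdec.ne⟩
  by_contra hlt
  rw [not_le, inv_div, lt_div_iff₀ (by positivity)] at hlt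
  have hstrict : ∀ j ∈ B \ S,
      0 < coords L.a B (startObj L S B + s • ofCoords (orth L.a S) x) j := by
    intro j hj
    have hj' := (Finset.mem_sdiff.1 hj).1
    have hp : 0 < ‖proj L.a S (L.a j)‖ := norm_pos_iff.2 (hB.basis.proj_row_ne_zero hS hj)
    have ha : 0 < ‖L.a j‖ := norm_pos_iff.2 (hB.basis.row_ne_zero hj')
    rw [hB.basis.coords_add_smul, hB.basis.coords_startObj hS hj]
    have h1 : |coords L.a B (ofCoords (orth L.a S) x) j| * (δ * ‖L.a j‖) ≤
        2 * (Module.finrank ℝ (orth L.a S) : ℝ) := by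
      rw [← le_div_iff₀ (by positivity)]
      refine (hw.abs_coords_le hδ hB.basis hj' _).trans ?_
      rw [norm_ofCoords]
      gcongr
    have h2 : s * |coords L.a B (ofCoords (orth L.a S) x) j| * ‖proj L.a S (L.a j)‖ < 1 := by
      have h3 : s * |coords L.a B (ofCoords (orth L.a S) x) j| * ‖proj L.a S (L.a j)‖ ≤
          s * |coords L.a B (ofCoords (orth L.a S) x) j| * ‖L.a j‖ :=
        mul_le_mul_of_nonneg_left (norm_proj_le _) (mul_nonneg hs.nonneg (abs_nonneg _))
      refine h3.trans_lt ?_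
      have h4 := mul_le_mul_of_nonneg_left h1 hs.nonneg
      by_contra hcon
      nlinarith
    have h5 : s * |coords L.a B (ofCoords (orth L.a S) x) j| < ‖proj L.a S (L.a j)‖⁻¹ := by
      rwa [← one_div, lt_div_iff₀ hp]
    have h6 := neg_abs_le (coords L.a B (ofCoords (orth L.a S) x) j)
    nlinarith [hs.nonneg]
  have ho := hs.optimal
  rw [hpt] at ho
  have heq := hB.eq_of_optimal ho.vertex hS ho.face hstrict ho.nonneg
  have h0 := hs.coord_eq
  rw [hpt, ← heq] at h0
  have hm := hs.mem
  rw [← heq] at hm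
  exact (hstrict i hm).ne' h0

theorem lintegral_last_leg_le (hw : Wide L.a δ) (hδ : 0 < δ) (hδ1 : δ ≤ 1)
    (hd : proj L.a S d ≠ 0)
    {B' : EuclideanSpace ℝ (Fin (Module.finrank ℝ (orth L.a S))) → Finset (Fin M)}
    (hB' : ∀ x, IsOptimal L B₀ S (scaledObj L S d + ofCoords (orth L.a S) x) (B' x)) :
    ∫⁻ x, ((follow L B₀ S (scaledObj L S d + ofCoords (orth L.a S) x) (endObj L S δ d x)
      (B' x)).pivots : ℝ≥0∞) ∂(truncExp (Module.finrank ℝ (orth L.a S))) ≤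
      ENNReal.ofReal (8 * (Module.finrank ℝ (orth L.a S) : ℝ) ^ 2 / δ *
        Real.log (2 * (Module.finrank ℝ (orth L.a S) : ℝ) ^ 3 / δ)) := by
  have hk := finrank_orth_pos hd
  have hk' : (1 : ℝ) ≤ (Module.finrank ℝ (orth L.a S) : ℝ) := Nat.one_le_cast.2 hk
  have hk3 := one_le_pow₀ hk' (n := 3)
  refine lintegral_radial_leg_le (B₀ := B₀) hw hδ hk (scaledObj_mem (d := d))
    (by rw [le_div_iff₀ hδ]; linarith)
    (c := fun x => scaledObj L S d + ofCoords (orth L.a S) x)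
    (d := fun x => endObj L S δ d x)
    (fun x _ => (hB' x).follow_pivots_le) fun x hx B' i s hs => ?_
  rw [inv_div]
  set η := δ / (2 * (Module.finrank ℝ (orth L.a S) : ℝ) ^ 3) with hη
  have hη0 : 0 < η := by positivity
  have hη1 : η < 1 := by
    rw [hη, div_lt_one (by positivity)]
    linarith
  have hsub : endObj L S δ d x - (scaledObj L S d + ofCoords (orth L.a S) x) =
      (η - 1) • ofCoords (orth L.a S) x := by
    rw [endObj, ← hη]; module
  refine ⟨1 - s * (1 - η), ?_, ?_, ?_, ?_⟩
  · nlinarith [hs.lt_one]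
  · nlinarith [hs.nonneg]
  · simp only [hsub]
    module
  · intro h0
    have := hs.decreasing
    simp only [hsub] at this
    rw [hs.optimal.vertex.basis.coords_smul, h0, mul_zero] at this
    exact lt_irrefl _ this

/-- The expected number of pivots on the three segments. -/
theorem lintegral_legs_le (hL : L.IsBounded) (hw : Wide L.a δ) (hδ : 0 < δ) (hδ1 : δ ≤ 1)
    (hB : IsVertex L B₀ B) (hS : S ⊆ B) (hd : proj L.a S d ≠ 0) :
    ∫⁻ x, ((legs L B₀ S B δ d x).pivots : ℝ≥0∞) ∂(truncExp (Module.finrank ℝ (orth L.a S))) ≤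
      ENNReal.ofReal (levelCost n δ) := by
  have hk := finrank_orth_pos hd
  have hk' : (1 : ℝ) ≤ (Module.finrank ℝ (orth L.a S) : ℝ) := Nat.one_le_cast.2 hk
  have hk3 := one_le_pow₀ hk' (n := 3)
  let o₁ := fun x => follow L B₀ S (startObj L S B) (startObj L S B + ofCoords (orth L.a S) x) B
  let o₂ := fun x => follow L B₀ S (startObj L S B + ofCoords (orth L.a S) x)
    (scaledObj L S d + ofCoords (orth L.a S) x) (o₁ x).result
  let o₃ := fun x => follow L B₀ S (scaledObj L S d + ofCoords (orth L.a S) x)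
    (endObj L S δ d x) (o₂ x).result
  have h1 : ∀ x, IsOptimal L B₀ S (startObj L S B + ofCoords (orth L.a S) x) (o₁ x).result :=
    fun x => (hB.startObj hS).follow hL
  have h2 : ∀ x, IsOptimal L B₀ S (scaledObj L S d + ofCoords (orth L.a S) x) (o₂ x).result :=
    fun x => (h1 x).follow hL
  have c1 := lintegral_first_leg_le hw hδ hδ1 hB hS hk
  have c2 := lintegral_translated_leg_le (B₀ := B₀) hw hδ hk (startObj_mem (B := B))
    (scaledObj_mem (d := d)) (N := fun x => (o₂ x).pivots) (fun x _ => (h1 x).follow_pivots_le)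
  have c3 := lintegral_last_leg_le hw hδ hδ1 hd h2
  have hm1 : Measurable fun x => ((o₁ x).pivots : ℝ≥0∞) := by
    refine measurable_of_comparisons (B := B) (δ := δ) (d := d) fun x y h => ?_
    have e1 : o₁ x = o₁ y :=
      follow_congr hB.basis fun B' i => congrFun h (Sum.inl (Sum.inl (B', i)))
    rw [e1]
  have hm2 : Measurable fun x => ((o₂ x).pivots : ℝ≥0∞) := by
    refine measurable_of_comparisons (B := B) (δ := δ) (d := d) fun x y h => ?_
    have e1 : o₁ x = o₁ y :=
      follow_congr hB.basis fun B' i => congrFun h (Sum.inl (Sum.inl (B', i)))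
    have e2 : o₂ x = o₂ y := by
      simp only [o₂]
      rw [← e1]
      exact follow_congr (h1 x).vertex.basis
        fun B' i => congrFun h (Sum.inl (Sum.inr (B', i)))
    rw [e2]
  have hm12 : Measurable fun x => ((o₁ x).pivots : ℝ≥0∞) + ((o₂ x).pivots : ℝ≥0∞) := hm1.add hm2
  calc ∫⁻ x, ((legs L B₀ S B δ d x).pivots : ℝ≥0∞) ∂(truncExp (Module.finrank ℝ (orth L.a S)))
      = ∫⁻ x, (((o₁ x).pivots : ℝ≥0∞) + ((o₂ x).pivots : ℝ≥0∞) + ((o₃ x).pivots : ℝ≥0∞))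
          ∂(truncExp (Module.finrank ℝ (orth L.a S))) := by
        refine lintegral_congr fun x => ?_
        rw [← ENat.toENNReal_add, ← ENat.toENNReal_add]
        rfl
    _ = _ := by rw [lintegral_add_left hm12, lintegral_add_left hm1]
    _ ≤ _ := add_le_add (add_le_add c1 c2) c3
    _ ≤ ENNReal.ofReal (levelCost n δ) := by
        rw [← ENNReal.ofReal_add, ← ENNReal.ofReal_add]
        · refine ENNReal.ofReal_le_ofReal ?_
          refine le_trans ?_ (levelCost_bound hk ?_ hδ hδ1)
          · gcongr
            refine (norm_sub_le _ _).trans ?_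
            rw [norm_scaledObj hd]
            linarith [norm_startObj_le hB.basis hS]
          · exact (Submodule.finrank_le _).trans (by simp)
        · refine add_nonneg (mul_nonneg (by positivity) (Real.log_nonneg ?_)) (by positivity)
          rw [le_div_iff₀ hδ]; linarith
        · refine mul_nonneg (by positivity) (Real.log_nonneg ?_)
          rw [le_div_iff₀ hδ]; linarith
        · refine mul_nonneg (by positivity) (Real.log_nonneg ?_)
          rw [le_div_iff₀ hδ]; linarith
        · positivity

/-- Optimization over a face, by induction on its dimension. -/
theorem goodLaw_optimizeFace (hL : L.IsBounded) (hw : Wide L.a δ) (hδ : 0 < δ) (hδ1 : δ ≤ 1)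
    (t : ℕ) : ∀ S B, IsVertex L B₀ B → S ⊆ B → (B \ S).card ≤ t →
      GoodLaw (IsOptimal L B₀ S d) (t * ENNReal.ofReal (levelCost n δ))
        (optimizeFace L B₀ δ d t S B) := by
  induction t with
  | zero =>
    intro S B hB hS hcard
    have h0 : B \ S = ∅ := Finset.card_eq_zero.1 (Nat.le_zero.1 hcard)
    have ho : IsOptimal L B₀ S d B := ⟨hB, hS, fun k hk => by simp [h0] at hk⟩
    exact (GoodLaw.dirac (o := ⟨B, 0⟩) ho).mono (fun _ h => h) (by simp)
  | succ t ih =>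
    intro S B hB hS hcard
    rw [optimizeFace_succ]
    split_ifs with hd
    · have ho : IsOptimal L B₀ S d B := ⟨hB, hS, fun k hk => by
        rw [← hB.basis.coords_proj hS (Finset.mem_sdiff.1 hk).2, hd]
        have := hB.basis.coords_smul k 0 0
        rw [zero_smul, zero_mul] at this
        exact this.ge⟩
      exact (GoodLaw.dirac (o := ⟨B, 0⟩) ho).mono (fun _ h => h) (by simp)
    have hk := finrank_orth_pos hd
    have := isProbabilityMeasure_truncExp hk
    refine GoodLaw.bind (g := fun x => ((legs L B₀ S B δ d x).pivots : ℝ≥0∞) +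
      t * ENNReal.ofReal (levelCost n δ)) ?_ ?_ ?_
    · refine measurable_of_comparisons (B := B) (δ := δ) (d := d) fun x y h => ?_
      rw [tightRow_congr hB.basis h, legs_congr hB.basis h]
    · filter_upwards [ae_truncExp_norm_le] with x hx
      have ho : IsOptimal L B₀ S (endObj L S δ d x) (legs L B₀ S B δ d x).result :=
        (((hB.startObj hS).follow hL).follow hL).follow hL
      cases htr : tightRow L S (endObj L S δ d x) (legs L B₀ S B δ d x).result with
      | none =>
        exact (GoodLaw.dirac (ho.of_tightRow_eq_none hδ hδ1 hd hx htr)).mono (fun _ h => h)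
          le_self_add
      | some i =>
        obtain ⟨hi, Bstar, hBstar, hiB⟩ := ho.exists_of_tightRow_eq_some hL hw hδ hd hx htr
        have hi' := Finset.mem_sdiff.1 hi
        refine ((ih (insert i S) (legs L B₀ S B δ d x).result ho.vertex
          (Finset.insert_subset hi'.1 ho.face) ?_).add _).mono (fun B' hB' => ?_) le_rfl
        · have h1 : ((legs L B₀ S B δ d x).result \ S).card = (B \ S).card := by
            rw [← ho.vertex.basis.finrank_orth ho.face, hB.basis.finrank_orth hS]
          rw [Finset.sdiff_insert, Finset.card_erase_of_mem hi, h1]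
          omega
        · refine ⟨hB'.vertex, (Finset.subset_insert _ _).trans hB'.face, fun k hk => ?_⟩
          by_cases hki : k = i
          · subst hki
            exact hBstar.vertex.coords_nonneg_of_facet hL hB'.vertex hi'.2
              (Finset.insert_subset hiB hBstar.face) hB'.face hBstar.nonneg hB'.nonneg
          · refine hB'.nonneg k (Finset.mem_sdiff.2 ⟨(Finset.mem_sdiff.1 hk).1, ?_⟩)
            rw [Finset.mem_insert, not_or]
            exact ⟨hki, (Finset.mem_sdiff.1 hk).2⟩
    · rw [lintegral_add_right _ measurable_const, lintegral_const, measure_univ, mul_one,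
        Nat.cast_succ, add_mul, one_mul, add_comm]
      gcongr
      exact lintegral_legs_le hL hw hδ hδ1 hB hS hd

/-- Optimization over a polytope, starting at a feasible basis. -/
theorem goodLaw_optimize (hL : L.IsBounded) (hw : Wide L.a δ) (hδ : 0 < δ) (hδ1 : δ ≤ 1)
    (hB : IsVertex L B B) :
    GoodLaw (IsOptimal L B ∅ d) (n * ENNReal.ofReal (levelCost n δ)) (optimize L δ B d) :=
  goodLaw_optimizeFace hL hw hδ hδ1 n ∅ B hB (Finset.empty_subset _)
    (by rw [Finset.sdiff_empty, hB.basis.card])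

end Optimize

/-! ### The boxed system -/

section Boxed

variable {M M' n : ℕ} {B : Finset (Fin M)}

/-- Relabelling the rows of a basis and changing their signs. -/
theorem IsBasis.image {a : Fin M → EuclideanSpace ℝ (Fin n)}
    {a' : Fin M' → EuclideanSpace ℝ (Fin n)} (hB : IsBasis a B) {f : Fin M → Fin M'}
    {σ : Fin M → ℝ} (hσ : ∀ i, σ i * σ i = 1) (ha : ∀ i ∈ B, a' (f i) = σ i • a i)
    (hf : Set.InjOn f B) : IsBasis a' (B.image f) := by
  refine ⟨linearIndepOn_finset_iff.2 fun g hg => ?_, by rw [Finset.card_image_of_injOn hf, hB.card]⟩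
  rw [Finset.sum_image hf] at hg
  have h1 : ∑ i ∈ B, (g (f i) * σ i) • a i = 0 := by
    rw [← hg]
    exact Finset.sum_congr rfl fun i hi => by rw [ha i hi, smul_smul]
  intro j hj
  obtain ⟨i, hi, rfl⟩ := Finset.mem_image.1 hj
  have h2 := linearIndepOn_finset_iff.1 hB.linInd _ h1 i hi
  have h3 : σ i ≠ 0 := fun h => by have := hσ i; simp [h] at this
  exact (mul_eq_zero.1 h2).resolve_right h3

theorem IsBasis.edge_image {a : Fin M → EuclideanSpace ℝ (Fin n)}
    {a' : Fin M' → EuclideanSpace ℝ (Fin n)} (hB : IsBasis a B) {f : Fin M → Fin M'}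
    {σ : Fin M → ℝ} (hσ : ∀ i, σ i * σ i = 1) (ha : ∀ i ∈ B, a' (f i) = σ i • a i)
    (hf : Set.InjOn f B) {i : Fin M} (hi : i ∈ B) :
    edge a' (B.image f) (f i) = σ i • edge a B i := by
  refine ((hB.image hσ ha hf).eq_solve fun k hk => ?_).symm
  obtain ⟨j, hj, rfl⟩ := Finset.mem_image.1 hk
  rw [ha j hj, inner_smul_left, inner_smul_right]
  by_cases hij : j = i
  · subst hij
    rw [hB.inner_edge_self hi, Pi.single_eq_same]
    have := hσ j
    simp only [conj_trivial]
    linear_combination -this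
  · rw [hB.inner_edge_of_ne hj hij, Pi.single_eq_of_ne (fun h => hij (hf hj hi h))]
    simp

variable {L : LinSys M n} {δ : ℝ}

theorem boxed_a_castAdd (i : Fin M) : (boxed L δ).a (Fin.castAdd M i) = L.a i :=
  Fin.append_left L.a (fun i => -L.a i) i

theorem boxed_a_natAdd (i : Fin M) : (boxed L δ).a (Fin.natAdd M i) = -L.a i :=
  Fin.append_right L.a (fun i => -L.a i) i

theorem boxed_b_castAdd (i : Fin M) : (boxed L δ).b (Fin.castAdd M i) = L.b i :=
  Fin.append_left L.b
    (fun i => (n : ℝ) * ‖L.a i‖ * (⨆ j, |L.b j| / ‖L.a j‖) / δ + 1) i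

theorem boxed_b_natAdd (i : Fin M) : (boxed L δ).b (Fin.natAdd M i) =
    (n : ℝ) * ‖L.a i‖ * (⨆ j, |L.b j| / ‖L.a j‖) / δ + 1 :=
  Fin.append_right L.b
    (fun i => (n : ℝ) * ‖L.a i‖ * (⨆ j, |L.b j| / ‖L.a j‖) / δ + 1) i

theorem castAdd_mem_boxed {i : Fin M} (hi : i ∈ L.active) :
    Fin.castAdd M i ∈ (boxed L δ).active :=
  Finset.mem_union_left _ (Finset.mem_image_of_mem _ hi)

theorem natAdd_mem_boxed {i : Fin M} (hi : i ∈ L.active) :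
    Fin.natAdd M i ∈ (boxed L δ).active :=
  Finset.mem_union_right _ (Finset.mem_image_of_mem _ hi)

theorem mem_boxed_active {q : Fin (M + M)} (hq : q ∈ (boxed L δ).active) :
    (∃ i ∈ L.active, q = Fin.castAdd M i) ∨ ∃ i ∈ L.active, q = Fin.natAdd M i := by
  rcases Finset.mem_union.1 hq with h | h
  · obtain ⟨i, hi, rfl⟩ := Finset.mem_image.1 h; exact Or.inl ⟨i, hi, rfl⟩
  · obtain ⟨i, hi, rfl⟩ := Finset.mem_image.1 h; exact Or.inr ⟨i, hi, rfl⟩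

theorem boxed_row_eq (q : Fin (M + M)) :
    L.a (Fin.addCases (motive := fun _ => Fin M) id id q) =
      (Fin.addCases (motive := fun _ => ℝ) (fun _ => 1) (fun _ => -1) q : ℝ) •
        (boxed L δ).a q := by
  induction q using Fin.addCases with
  | left i => rw [Fin.addCases_left, Fin.addCases_left, boxed_a_castAdd, one_smul, id]
  | right i =>
    rw [Fin.addCases_right, Fin.addCases_right, boxed_a_natAdd, neg_one_smul, neg_neg, id]

/-- Adding the opposite rows does not affect the distance property. -/
theorem Wide.boxed (hw : Wide L.a δ) : Wide (boxed L δ).a δ := by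
  intro B hB q hq
  let f : Fin (M + M) → Fin M := Fin.addCases (motive := fun _ => Fin M) id id
  let σ : Fin (M + M) → ℝ := Fin.addCases (motive := fun _ => ℝ) (fun _ => 1) (fun _ => -1)
  have hσ : ∀ q, σ q * σ q = 1 := by
    intro q
    induction q using Fin.addCases with
    | left i => simp only [σ, Fin.addCases_left, mul_one]
    | right i => simp only [σ, Fin.addCases_right, mul_neg, mul_one, neg_neg]
  have ha : ∀ q ∈ B, L.a (f q) = σ q • (ShadowSimplex.boxed L δ).a q := fun q _ => boxed_row_eq q
  have hf : Set.InjOn f B := by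
    -- two rows of a basis that are equal up to sign have equal indices
    intro p hp q hq hpq
    by_contra hne
    have h1 : (ShadowSimplex.boxed L δ).a p = (σ p * σ q) • (ShadowSimplex.boxed L δ).a q := by
      rw [← smul_smul, ← ha q hq, ← hpq, ha p hp, smul_smul, hσ, one_smul]
    have h2 := hB.coords_row (i := p) hp
    rw [h1, hB.coords_smul, hB.coords_row hq, if_neg hne, if_pos rfl, mul_zero] at h2
    exact zero_ne_one h2
  have h1 := hw _ (hB.image hσ ha hf) (f q) (Finset.mem_image_of_mem f hq)
  have h2 : ‖σ q‖ = 1 := by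
    have := congrArg norm (hσ q)
    rw [norm_mul, norm_one] at this
    nlinarith [norm_nonneg (σ q)]
  rw [hB.edge_image hσ ha hf hq, ha q hq, norm_smul, norm_smul, h2, one_mul, one_mul] at h1
  exact h1

theorem IsBasis.boxed (hB : IsBasis L.a B) :
    IsBasis (boxed L δ).a (B.image (Fin.castAdd M)) :=
  hB.image (σ := fun _ => 1) (fun _ => by norm_num) (fun i _ => by simp [boxed_a_castAdd])
    (Fin.castAdd_injective M M).injOn

theorem IsBasis.solve_boxed (hB : IsBasis L.a B) :
    solve (ShadowSimplex.boxed L δ).a (B.image (Fin.castAdd M)) (ShadowSimplex.boxed L δ).b =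
      solve L.a B L.b := by
  refine (hB.boxed.eq_solve fun q hq => ?_).symm
  obtain ⟨i, hi, rfl⟩ := Finset.mem_image.1 hq
  rw [boxed_a_castAdd, boxed_b_castAdd, hB.inner_solve _ hi]

/-- The basic solutions lie in a ball whose radius does not depend on the basis. -/
theorem Wide.norm_solve_le (hw : Wide L.a δ) (hδ : 0 < δ) (hB : IsBasis L.a B) :
    ‖solve L.a B L.b‖ ≤ (n : ℝ) * (⨆ j, |L.b j| / ‖L.a j‖) / δ := by
  have hx : solve L.a B L.b = ∑ j ∈ B, (-L.b j) • edge L.a B j := by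
    refine (hB.eq_solve fun k hk => ?_).symm
    rw [inner_sum, Finset.sum_eq_single k]
    · rw [inner_smul_right, hB.inner_edge_self hk]; ring
    · intro j _ hjk
      rw [inner_smul_right, hB.inner_edge_of_ne hk hjk.symm, mul_zero]
    · exact fun h => absurd hk h
  rw [hx]
  refine (norm_sum_le _ _).trans ?_
  refine (Finset.sum_le_card_nsmul _ _ ((⨆ j, |L.b j| / ‖L.a j‖) / δ) fun j hj => ?_).trans_eq ?_
  · have ha : 0 < ‖L.a j‖ := norm_pos_iff.2 (hB.row_ne_zero hj)
    have h1 : |L.b j| / ‖L.a j‖ ≤ ⨆ j, |L.b j| / ‖L.a j‖ :=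
      le_ciSup (f := fun j => |L.b j| / ‖L.a j‖) (Set.finite_range _).bddAbove j
    have h2 := hw B hB j hj
    rw [norm_smul, norm_neg, Real.norm_eq_abs, le_div_iff₀ hδ]
    calc |L.b j| * ‖edge L.a B j‖ * δ
        = |L.b j| / ‖L.a j‖ * (δ * ‖L.a j‖ * ‖edge L.a B j‖) := by field_simp
      _ ≤ |L.b j| / ‖L.a j‖ * 1 := by gcongr
      _ ≤ _ := by rw [mul_one]; exact h1
  · rw [hB.card, nsmul_eq_mul, mul_div_assoc]

/-- The added constraints are slack at every basic solution of the original system. -/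
theorem Wide.inner_natAdd_lt (hw : Wide L.a δ) (hδ : 0 < δ) (hB : IsBasis L.a B) (i : Fin M) :
    inner ℝ ((ShadowSimplex.boxed L δ).a (Fin.natAdd M i)) (solve L.a B L.b) <
      (ShadowSimplex.boxed L δ).b (Fin.natAdd M i) := by
  rw [boxed_a_natAdd, boxed_b_natAdd, inner_neg_left]
  have h1 := abs_real_inner_le_norm (L.a i) (solve L.a B L.b)
  have h2 := mul_le_mul_of_nonneg_left (hw.norm_solve_le hδ hB) (norm_nonneg (L.a i))
  have h3 := neg_abs_le (inner ℝ (L.a i) (solve L.a B L.b))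
  have h4 : ‖L.a i‖ * ((n : ℝ) * (⨆ j, |L.b j| / ‖L.a j‖) / δ) =
    (n : ℝ) * ‖L.a i‖ * (⨆ j, |L.b j| / ‖L.a j‖) / δ := by ring
  linarith

/-- `B` is a feasible basis of the (unperturbed) system. -/
structure IsFeasibleBasis (L : LinSys M n) (B : Finset (Fin M)) : Prop where
  basis : IsBasis L.a B
  subset : B ⊆ L.active
  feasible : ∀ j ∈ L.active, inner ℝ (L.a j) (solve L.a B L.b) ≤ L.b j

theorem IsFeasibleBasis.isVertex (hB : IsFeasibleBasis L B) : IsVertex L B B :=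
  hB.basis.isVertex hB.subset hB.feasible

theorem IsFeasibleBasis.isVertex_boxed (hw : Wide L.a δ) (hδ : 0 < δ)
    (hB : IsFeasibleBasis L B) :
    IsVertex (boxed L δ) (B.image (Fin.castAdd M)) (B.image (Fin.castAdd M)) := by
  refine hB.basis.boxed.isVertex (fun q hq => ?_) fun q hq => ?_
  · obtain ⟨i, hi, rfl⟩ := Finset.mem_image.1 hq
    exact castAdd_mem_boxed (hB.subset hi)
  · rw [hB.basis.solve_boxed]
    rcases mem_boxed_active hq with ⟨i, hi, rfl⟩ | ⟨i, hi, rfl⟩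
    · rw [boxed_a_castAdd, boxed_b_castAdd]; exact hB.feasible i hi
    · exact (hw.inner_natAdd_lt hδ hB.basis i).le

theorem IsBasis.isBounded_boxed (hB : IsBasis L.a B) (hsub : B ⊆ L.active) :
    (ShadowSimplex.boxed L δ).IsBounded := by
  intro z hz
  obtain ⟨i, hi, hne⟩ : ∃ i ∈ B, inner ℝ (L.a i) z ≠ 0 := by
    by_contra hcon
    push Not at hcon
    exact hz (hB.eq_zero_of_inner hcon)
  rcases lt_or_gt_of_ne hne with h | h
  · exact ⟨_, natAdd_mem_boxed (hsub hi), by rw [boxed_a_natAdd, inner_neg_left]; linarith⟩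
  · exact ⟨_, castAdd_mem_boxed (hsub hi), by rw [boxed_a_castAdd]; exact h⟩

theorem goodLaw_optimizeBoxed (hw : Wide L.a δ) (hδ : 0 < δ) (hδ1 : δ ≤ 1)
    (hB : IsFeasibleBasis L B) (d : EuclideanSpace ℝ (Fin n)) :
    GoodLaw (IsOptimal (boxed L δ) (B.image (Fin.castAdd M)) ∅ d)
      (n * ENNReal.ofReal (levelCost n δ)) (optimizeBoxed L δ B d) :=
  goodLaw_optimize (hB.basis.isBounded_boxed hB.subset) hw.boxed hδ hδ1 (hB.isVertex_boxed hw hδ)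

/-! ### Dual certificates -/

variable {B₀ B' : Finset (Fin (M + M))} {d : EuclideanSpace ℝ (Fin n)}

theorem IsOptimal.feasible_of_boxed (ho : IsOptimal (boxed L δ) B₀ ∅ d B') {j : Fin M}
    (hj : j ∈ L.active) :
    inner ℝ (L.a j) (solve (boxed L δ).a B' (boxed L δ).b) ≤ L.b j := by
  have := ho.vertex.feasible_zero (castAdd_mem_boxed hj)
  rwa [boxed_a_castAdd, boxed_b_castAdd] at this

theorem IsOptimal.coords_nonneg {M : ℕ} {L : LinSys M n} {B₀ B : Finset (Fin M)}
    (ho : IsOptimal L B₀ ∅ d B) (k : Fin M) : 0 ≤ coords L.a B d k := by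
  by_cases hk : k ∈ B
  · exact ho.nonneg k (by simpa using hk)
  · rw [ho.vertex.basis.coords_of_notMem _ hk]

/-- An optimal basis of the boxed system maximizes the objective over the basic solutions of the
original system. -/
theorem IsOptimal.inner_le_of_boxed (hw : Wide L.a δ) (hδ : 0 < δ)
    (ho : IsOptimal (boxed L δ) B₀ ∅ d B') {L' : LinSys M n} (ha : L'.a = L.a) (hb : L'.b = L.b)
    (hact : L.active ⊆ L'.active) (hB : IsFeasibleBasis L' B) :
    inner ℝ d (solve L.a B L.b) ≤ inner ℝ d (solve (boxed L δ).a B' (boxed L δ).b) := by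
  refine ho.vertex.basis.inner_le_of_optimal ho.nonneg (fun q hq => ?_) (by simp)
  rcases mem_boxed_active (ho.vertex.subset hq) with ⟨i, hi, rfl⟩ | ⟨i, hi, rfl⟩
  · rw [boxed_a_castAdd, boxed_b_castAdd]
    have := hB.feasible i (hact hi)
    rwa [ha, hb] at this
  · exact (hw.inner_natAdd_lt hδ (ha ▸ hB.basis) i).le

/-- If the original problem has an optimal basis, then the multipliers of the added constraints
vanish, by complementary slackness. -/
theorem IsOptimal.coords_natAdd_eq_zero (hw : Wide L.a δ) (hδ : 0 < δ)
    (ho : IsOptimal (boxed L δ) B₀ ∅ d B') {B₁ Bopt : Finset (Fin M)}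
    (hopt : IsOptimal L B₁ ∅ d Bopt) (j : Fin M) :
    coords (boxed L δ).a B' d (Fin.natAdd M j) = 0 := by
  by_contra hne
  have hj : Fin.natAdd M j ∈ B' := by
    by_contra h
    exact hne (ho.vertex.basis.coords_of_notMem _ h)
  have hpos := lt_of_le_of_ne (ho.coords_nonneg _) (Ne.symm hne)
  have h1 : inner ℝ d (solve (boxed L δ).a B' (boxed L δ).b) ≤
      inner ℝ d (solve L.a Bopt L.b) :=
    hopt.vertex.basis.inner_le_of_optimal hopt.nonneg
      (fun i hi => ho.feasible_of_boxed (hopt.vertex.subset hi)) (by simp)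
  refine absurd h1 (not_le.2 ?_)
  rw [ho.vertex.basis.inner_eq_sum d, ho.vertex.basis.inner_eq_sum d]
  refine Finset.sum_lt_sum (fun q hq => ?_) ⟨_, hj, ?_⟩
  · rw [ho.vertex.basis.inner_solve _ hq]
    refine mul_le_mul_of_nonneg_left ?_ (ho.coords_nonneg q)
    rcases mem_boxed_active (ho.vertex.subset hq) with ⟨i, hi, rfl⟩ | ⟨i, hi, rfl⟩
    · rw [boxed_a_castAdd, boxed_b_castAdd]; exact hopt.vertex.feasible_zero hi
    · exact (hw.inner_natAdd_lt hδ hopt.vertex.basis i).le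
  · rw [ho.vertex.basis.inner_solve _ hj]
    exact mul_lt_mul_of_pos_left (hw.inner_natAdd_lt hδ hopt.vertex.basis j) hpos

theorem IsBasis.sum_castAdd (hB : IsBasis (ShadowSimplex.boxed L δ).a B')
    (h0 : ∀ j, coords (ShadowSimplex.boxed L δ).a B' d (Fin.natAdd M j) = 0) :
    ∑ j, coords (ShadowSimplex.boxed L δ).a B' d (Fin.castAdd M j) • L.a j = d := by
  have h1 := hB.sum_coords d
  rw [Finset.sum_subset (Finset.subset_univ B') (fun q _ hq => by
    rw [hB.coords_of_notMem _ hq, zero_smul]), Fin.sum_univ_add] at h1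
  rw [Finset.sum_eq_zero (s := Finset.univ) (f := fun j =>
    coords (ShadowSimplex.boxed L δ).a B' d (Fin.natAdd M j) •
      (ShadowSimplex.boxed L δ).a (Fin.natAdd M j)) (fun j _ => by rw [h0, zero_smul]),
    add_zero] at h1
  simpa only [boxed_a_castAdd] using h1

theorem IsBasis.sum_castAdd_mul (hB : IsBasis (ShadowSimplex.boxed L δ).a B')
    (h0 : ∀ j, coords (ShadowSimplex.boxed L δ).a B' d (Fin.natAdd M j) = 0) :
    ∑ j, coords (ShadowSimplex.boxed L δ).a B' d (Fin.castAdd M j) * L.b j =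
      inner ℝ d (solve (ShadowSimplex.boxed L δ).a B' (ShadowSimplex.boxed L δ).b) := by
  have h1 : inner ℝ d (solve (ShadowSimplex.boxed L δ).a B' (ShadowSimplex.boxed L δ).b) =
      ∑ q ∈ B', coords (ShadowSimplex.boxed L δ).a B' d q * (ShadowSimplex.boxed L δ).b q := by
    rw [hB.inner_eq_sum d]
    exact Finset.sum_congr rfl fun q hq => by rw [hB.inner_solve _ hq]
  rw [h1, Finset.sum_subset (Finset.subset_univ B') (fun q _ hq => by
      rw [hB.coords_of_notMem _ hq, zero_mul]), Fin.sum_univ_add,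
    Finset.sum_eq_zero (s := Finset.univ) (f := fun j =>
      coords (ShadowSimplex.boxed L δ).a B' d (Fin.natAdd M j) *
        (ShadowSimplex.boxed L δ).b (Fin.natAdd M j)) (fun j _ => by rw [h0, zero_mul]), add_zero]
  simp only [boxed_b_castAdd]

end Boxed

/-! ### Ray casting -/

section RayCast

variable {M n : ℕ} {L : LinSys M n}

/-- The invariant of ray casting: a feasible point together with linearly independent tight
constraints. -/
structure IsTight (L : LinSys M n) (p : Finset (Fin M) × EuclideanSpace ℝ (Fin n)) : Prop where
  linInd : LinearIndepOn ℝ L.a (p.1 : Set (Fin M))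
  subset : p.1 ⊆ L.active
  feasible : ∀ j ∈ L.active, inner ℝ (L.a j) p.2 ≤ L.b j
  tight : ∀ j ∈ p.1, inner ℝ (L.a j) p.2 = L.b j

theorem proj_eq_zero_iff {a : Fin M → EuclideanSpace ℝ (Fin n)} {S : Finset (Fin M)}
    {v : EuclideanSpace ℝ (Fin n)} :
    proj a S v = 0 ↔ v ∈ Submodule.span ℝ (a '' (S : Set (Fin M))) := by
  rw [proj, Submodule.starProjection_apply_eq_zero_iff, orth, Submodule.orthogonal_orthogonal]

theorem inner_proj_self {a : Fin M → EuclideanSpace ℝ (Fin n)} {S : Finset (Fin M)}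
    (v : EuclideanSpace ℝ (Fin n)) : inner ℝ v (proj a S v) = ‖proj a S v‖ ^ 2 := by
  have h1 : inner ℝ (v - proj a S v) (proj a S v) = 0 :=
    Submodule.inner_right_of_mem_orthogonal (sub_proj_mem v) (proj_mem v)
  rw [inner_sub_left, real_inner_self_eq_norm_sq] at h1
  linarith

theorem IsTight.rayCastStep {p : Finset (Fin M) × EuclideanSpace ℝ (Fin n)} (hp : IsTight L p)
    {B : Finset (Fin M)} (hB : IsBasis L.a B) (hBact : B ⊆ L.active) (hcard : p.1.card < n) :
    IsTight L (rayCastStep L p) ∧ (rayCastStep L p).1.card = p.1.card + 1 := by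
  obtain ⟨T, x⟩ := p
  have hex : firstSuch L.active (fun j => proj L.a T (L.a j) ≠ 0) ≠ none := by
    intro h
    have h1 : ∀ i ∈ B, L.a i ∈ Submodule.span ℝ (L.a '' (T : Set (Fin M))) := fun i hi =>
      proj_eq_zero_iff.1 (not_not.1 (firstSuch_eq_none h (hBact hi)))
    have h2 : Submodule.span ℝ (L.a '' (T : Set (Fin M))) = ⊤ := by
      rw [eq_top_iff, ← hB.span_eq_top, Submodule.span_le]
      rintro _ ⟨i, hi, rfl⟩
      exact h1 i hi
    have h3 := finrank_span_le_card (R := ℝ) (L.a '' (T : Set (Fin M)))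
    rw [h2, finrank_top, finrank_euclideanSpace, Fintype.card_fin, Set.toFinset_card] at h3
    have h4 : Fintype.card (L.a '' (T : Set (Fin M))) ≤ T.card := by
      rw [← Nat.card_eq_fintype_card, ← Set.ncard_coe_finset]
      exact Set.ncard_image_le T.finite_toSet
    simp only at hcard
    omega
  obtain ⟨j, hj⟩ := Option.ne_none_iff_exists'.1 hex
  obtain ⟨hjact, hjne⟩ := firstSuch_eq_some hj
  set z := proj L.a T (L.a j) with hz
  have hzpos : 0 < inner ℝ (L.a j) z := by
    rw [hz, inner_proj_self]
    have := norm_pos_iff.2 hjne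
    positivity
  let ρ : Fin M → ℝ := fun k => (L.b k - inner ℝ (L.a k) x) / inner ℝ (L.a k) z
  have hex2 : firstSuch L.active (fun k => 0 < inner ℝ (L.a k) z ∧
      ∀ l ∈ L.active, 0 < inner ℝ (L.a l) z → ρ k ≤ ρ l) ≠ none := by
    intro h
    obtain ⟨k, hk, hmin⟩ := Finset.exists_min_image
      (L.active.filter fun k => 0 < inner ℝ (L.a k) z) ρ ⟨j, Finset.mem_filter.2 ⟨hjact, hzpos⟩⟩
    rw [Finset.mem_filter] at hk
    exact firstSuch_eq_none h hk.1
      ⟨hk.2, fun l hl hpos => hmin l (Finset.mem_filter.2 ⟨hl, hpos⟩)⟩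
  obtain ⟨k, hk⟩ := Option.ne_none_iff_exists'.1 hex2
  have hstep : ShadowSimplex.rayCastStep L (T, x) = (insert k T, x + ρ k • z) := by
    simp only [ShadowSimplex.rayCastStep, hj]
    simp only [ρ, hz] at hk
    simp only [hk]
    rfl
  obtain ⟨hkact, hkpos, hkmin⟩ := firstSuch_eq_some hk
  have hzT : ∀ i ∈ T, inner ℝ (L.a i) z = 0 := fun i hi => mem_orth_iff.1 (proj_mem _) i hi
  have hρ : 0 ≤ ρ k := div_nonneg (sub_nonneg.2 (hp.feasible k hkact)) hkpos.le
  have hρk : ρ k * inner ℝ (L.a k) z = L.b k - inner ℝ (L.a k) x := div_mul_cancel₀ _ hkpos.ne'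
  have hkspan : L.a k ∉ Submodule.span ℝ (L.a '' (T : Set (Fin M))) := fun h =>
    hkpos.ne' (Submodule.inner_right_of_mem_orthogonal h (proj_mem (a := L.a) (S := T) (L.a j)))
  have hkT : k ∉ T := fun h => hkspan (Submodule.subset_span ⟨k, h, rfl⟩)
  rw [hstep]
  refine ⟨⟨?_, Finset.insert_subset hkact hp.subset, fun l hl => ?_, fun l hl => ?_⟩,
    Finset.card_insert_of_notMem hkT⟩
  · simp only [Finset.coe_insert]
    exact hp.linInd.insert hkspan
  · rw [inner_add_right, inner_smul_right]
    have h1 := hp.feasible l hl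
    rcases le_or_gt (inner ℝ (L.a l) z) 0 with h | h
    · nlinarith
    · have h2 := hkmin l hl h
      have h3 : ρ l * inner ℝ (L.a l) z = L.b l - inner ℝ (L.a l) x := div_mul_cancel₀ _ h.ne'
      have h4 := mul_le_mul_of_nonneg_right h2 h.le
      linarith
  · rw [inner_add_right, inner_smul_right]
    rcases Finset.mem_insert.1 hl with rfl | hl
    · rw [hρk]; ring
    · rw [hzT l hl, mul_zero, add_zero, hp.tight l hl]

/-- Ray casting finds a feasible basis, provided that the active rows have full rank. -/
theorem isFeasibleBasis_rayCast {B : Finset (Fin M)} (hB : IsBasis L.a B)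
    (hBact : B ⊆ L.active) {x : EuclideanSpace ℝ (Fin n)}
    (hx : ∀ j ∈ L.active, inner ℝ (L.a j) x ≤ L.b j) : IsFeasibleBasis L (rayCast L x) := by
  have h : ∀ t ≤ n, IsTight L ((rayCastStep L)^[t] (∅, x)) ∧
      ((rayCastStep L)^[t] (∅, x)).1.card = t := by
    intro t
    induction t with
    | zero =>
      exact fun _ => ⟨⟨by simp, Finset.empty_subset _, hx, by simp⟩, rfl⟩
    | succ t ih =>
      intro ht
      obtain ⟨h1, h2⟩ := ih (by omega)
      rw [Function.iterate_succ_apply']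
      have h3 := h1.rayCastStep hB hBact (by omega)
      exact ⟨h3.1, by rw [h3.2, h2]⟩
  obtain ⟨h1, h2⟩ := h n le_rfl
  have hbas : IsBasis L.a (rayCast L x) := ⟨h1.linInd, h2⟩
  refine ⟨hbas, h1.subset, fun j hj => ?_⟩
  have h3 : ((rayCastStep L)^[n] (∅, x)).2 = solve L.a (rayCast L x) L.b :=
    hbas.eq_solve h1.tight
  rw [← h3]
  exact h1.feasible j hj

end RayCast

/-! ### Rows of matrices -/

section Rows

variable {m n : ℕ} {A : Matrix (Fin m) (Fin n) ℝ} {b : Fin m → ℝ} {B : Finset (Fin m)}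

theorem GlobalDeltaDistance.wide {δ : ℝ} (h : GlobalDeltaDistance δ A) : Wide (row A) δ := by
  intro B hB i hi
  have h1 := h (B : Set (Fin m)) hB.linInd ⟨i, hi⟩
  have he : 0 < ‖edge (row A) B i‖ := norm_pos_iff.2 (hB.edge_ne_zero hi)
  -- the projection of row `i` to the span of the other rows of the basis
  set y : EuclideanSpace ℝ (Fin n) :=
    row A i + (‖edge (row A) B i‖ ^ 2)⁻¹ • edge (row A) B i with hy
  have h2 : coords (row A) B y i = 0 := by
    rw [hB.coords_eq_inner hi, hy, inner_add_right, inner_smul_right, real_inner_comm,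
      hB.inner_edge_self hi, real_inner_self_eq_norm_sq]
    field_simp
    ring
  have h3 : y ∈ Submodule.span ℝ ((fun k : (B : Set (Fin m)) => row A k) '' {k | k ≠ ⟨i, hi⟩}) := by
    rw [← hB.sum_coords y]
    refine Submodule.sum_mem _ fun j hj => ?_
    by_cases hji : j = i
    · rw [hji, h2, zero_smul]; exact Submodule.zero_mem _
    · exact Submodule.smul_mem _ _
        (Submodule.subset_span ⟨⟨j, hj⟩, fun h => hji (congrArg Subtype.val h), rfl⟩)
  have h4 := h1.trans (Metric.infDist_le_dist_of_mem h3)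
  have h5 : dist (row A i) y = ‖edge (row A) B i‖⁻¹ := by
    rw [dist_comm, dist_eq_norm, hy, add_sub_cancel_left, norm_smul, norm_inv, norm_pow, norm_norm]
    field_simp
  have h6 : δ * ‖row A i‖ ≤ ‖edge (row A) B i‖⁻¹ := h5 ▸ h4
  calc δ * ‖row A i‖ * ‖edge (row A) B i‖ ≤ ‖edge (row A) B i‖⁻¹ * ‖edge (row A) B i‖ := by gcongr
    _ = 1 := inv_mul_cancel₀ he.ne'

theorem inner_row (i : Fin m) (x : EuclideanSpace ℝ (Fin n)) :
    inner ℝ (row A i) x = A.mulVec (WithLp.ofLp x) i := by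
  rw [EuclideanSpace.inner_eq_star_dotProduct, star_trivial, dotProduct_comm]
  rfl

theorem span_range_row (hA : A.rank = n) : Submodule.span ℝ (Set.range (row A)) = ⊤ := by
  have h1 : Set.range (row A) = (WithLp.linearEquiv 2 ℝ (Fin n → ℝ)).symm '' Set.range A.row := by
    rw [← Set.range_comp]; rfl
  have h2 : Submodule.span ℝ (Set.range A.row) = ⊤ := by
    apply Submodule.eq_top_of_finrank_eq
    rw [← Matrix.rank_eq_finrank_span_row, hA]
    simp
  have h3 := Submodule.map_span (WithLp.linearEquiv 2 ℝ (Fin n → ℝ)).symm.toLinearMap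
    (Set.range A.row)
  rw [h2, Submodule.map_top, LinearEquiv.range] at h3
  rw [h1]
  exact h3.symm

/-- Rows that are not in the span of the preceding ones are linearly independent. -/
theorem linearIndepOn_of_notMem_span {M n : ℕ} {a : Fin M → EuclideanSpace ℝ (Fin n)}
    {S : Finset (Fin M)} (h : ∀ i ∈ S, a i ∉ Submodule.span ℝ (a '' {j | j < i})) :
    LinearIndepOn ℝ a (S : Set (Fin M)) := by
  induction S using Finset.induction_on_max with
  | empty => simp
  | insert k S hk ih =>
    rw [Finset.coe_insert]
    refine (ih fun i hi => h i (Finset.mem_insert_of_mem hi)).insert fun hmem => ?_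
    exact h k (Finset.mem_insert_self _ _)
      (Submodule.span_mono (Set.image_mono fun j hj => hk j hj) hmem)

theorem isBasis_greedyBasis {M n : ℕ} {a : Fin M → EuclideanSpace ℝ (Fin n)}
    (h : Submodule.span ℝ (Set.range a) = ⊤) : IsBasis a (greedyBasis a) := by
  have hind : LinearIndepOn ℝ a (greedyBasis a : Set (Fin M)) :=
    linearIndepOn_of_notMem_span fun i hi => (Finset.mem_filter.1 hi).2
  have hmem : ∀ i, a i ∈ Submodule.span ℝ (a '' (greedyBasis a : Set (Fin M))) := by
    intro i
    induction i using WellFoundedLT.induction with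
    | ind i ih =>
      by_cases hi : i ∈ greedyBasis a
      · exact Submodule.subset_span ⟨i, hi, rfl⟩
      · have hi' : a i ∈ Submodule.span ℝ (a '' {j | j < i}) := by
          by_contra h'
          exact hi (Finset.mem_filter.2 ⟨Finset.mem_univ _, h'⟩)
        refine Submodule.span_le.2 ?_ hi'
        rintro _ ⟨j, hj, rfl⟩
        exact ih j hj
  have htop : Submodule.span ℝ (a '' (greedyBasis a : Set (Fin M))) = ⊤ := by
    rw [eq_top_iff, ← h, Submodule.span_le]
    rintro _ ⟨i, rfl⟩
    exact hmem i
  refine ⟨hind, ?_⟩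
  have h1 := finrank_span_eq_card hind
  rw [← Set.image_eq_range, htop, finrank_top, finrank_euclideanSpace, Fintype.card_fin] at h1
  simpa using h1.symm

theorem IsFeasibleBasis.correct {I : Finset (Fin m)}
    (hB : IsFeasibleBasis (⟨row A, b, I⟩ : LinSys m n) B) (hI : ∀ i, i ∈ I) :
    Answer.Correct A b (.feasible (WithLp.ofLp (solve (row A) B b)) B) := by
  refine ⟨fun i => ?_, ?_, hB.basis.card, fun i hi => ?_⟩
  · rw [← inner_row]; exact hB.feasible i (hI i)
  · have h1 : LinearIndependent ℝ (fun i : B => row A i) := hB.basis.linInd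
    exact h1.map' (WithLp.linearEquiv 2 ℝ (Fin n → ℝ)).toLinearMap (LinearEquiv.ker _)
  · rw [← inner_row]; exact hB.basis.inner_solve b hi

theorem vecMul_eq_zero {y : Fin m → ℝ} (h : ∑ j, y j • row A j = 0) : Matrix.vecMul y A = 0 := by
  rw [Matrix.vecMul_eq_sum]
  have h1 := congrArg (WithLp.linearEquiv 2 ℝ (Fin n → ℝ)) h
  rw [map_sum, map_zero] at h1
  exact h1

end Rows

/-! ### Adding constraints one at a time -/

section AddConstraints

variable {m n : ℕ} {δ : ℝ}

/-- If the minimum of `⟪a i, x⟫` over the boxed system exceeds `b i`, then the problem is also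
bounded without the box: along a ray, one would reach a point satisfying constraint `i` as well,
and the basic solution obtained by ray casting from it would lie in the box. -/
theorem IsFeasibleBasis.exists_optimal {L : LinSys m n} {B : Finset (Fin m)}
    (hB : IsFeasibleBasis L B) (hw : Wide L.a δ) (hδ : 0 < δ) {i : Fin m}
    {B₀ B' : Finset (Fin (m + m))} (ho : IsOptimal (boxed L δ) B₀ ∅ (-L.a i) B')
    (hlt : L.b i < inner ℝ (L.a i) (solve (boxed L δ).a B' (boxed L δ).b)) :
    ∃ B₁, IsOptimal L B ∅ (-L.a i) B₁ := by
  rcases hB.isVertex.exists_optimal_or_ray (-L.a i) with h | ⟨z, hz, hiz⟩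
  · exact h
  exfalso
  rw [inner_neg_left] at hiz
  set x := solve L.a B L.b with hx
  set t : ℝ := max 0 ((inner ℝ (L.a i) x - L.b i) / -inner ℝ (L.a i) z) with ht
  have ht0 : 0 ≤ t := le_max_left _ _
  have hti : inner ℝ (L.a i) x - L.b i ≤ t * -inner ℝ (L.a i) z := by
    rw [← div_le_iff₀ hiz]; exact le_max_right _ _
  let L' : LinSys m n := ⟨L.a, L.b, insert i L.active⟩
  have hB' : IsFeasibleBasis L' (rayCast L' (x + t • z)) := by
    refine isFeasibleBasis_rayCast (L := L') (B := B) hB.basis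
      (hB.subset.trans (Finset.subset_insert i L.active)) fun j hj => ?_
    change inner ℝ (L.a j) _ ≤ L.b j
    rw [inner_add_right, inner_smul_right]
    rcases Finset.mem_insert.1 hj with rfl | hj
    · linarith
    · have h1 := hB.feasible j hj
      have h2 := mul_nonpos_of_nonneg_of_nonpos ht0 (hz j hj)
      linarith
  have h1 := ho.inner_le_of_boxed hw hδ (L' := L') rfl rfl (Finset.subset_insert _ _) hB'
  have h2 : inner ℝ (L.a i) (solve L.a (rayCast L' (x + t • z)) L.b) ≤ L.b i :=
    hB'.feasible i (Finset.mem_insert_self _ _)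
  rw [inner_neg_left, inner_neg_left] at h1
  linarith

theorem goodLaw_addConstraints {A : Matrix (Fin m) (Fin n) ℝ} {b : Fin m → ℝ}
    (hw : Wide (row A) δ) (hδ : 0 < δ) (hδ1 : δ ≤ 1) :
    ∀ (l : List (Fin m)) (I B : Finset (Fin m)),
      IsFeasibleBasis (⟨row A, b, I⟩ : LinSys m n) B → (∀ i, i ∈ I ∨ i ∈ l) →
      GoodLaw (Answer.Correct A b) (l.length * (n * ENNReal.ofReal (levelCost n δ)))
        (addConstraints A b δ l I B) := by
  intro l
  induction l with
  | nil =>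
    intro I B hB hI
    rw [addConstraints]
    have hc := hB.correct fun i => (hI i).resolve_right List.not_mem_nil
    refine (GoodLaw.dirac (Q := Answer.Correct A b) (o := ⟨_, 0⟩) hc).mono (fun _ h => h) ?_
    simp
  | cons i l ih =>
    intro I B hB hI
    rw [addConstraints]
    by_cases hi : i ∈ I
    · rw [if_pos hi]
      refine (ih I B hB fun j => ?_).mono (fun _ h => h) ?_
      · rcases hI j with h | h
        · exact Or.inl h
        · rcases List.mem_cons.1 h with rfl | h
          · exact Or.inl hi
          · exact Or.inr h
      · gcongr
        simp
    rw [if_neg hi]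
    have hK : ((i :: l).length : ℝ≥0∞) * (n * ENNReal.ofReal (levelCost n δ)) =
        n * ENNReal.ofReal (levelCost n δ) +
          l.length * (n * ENNReal.ofReal (levelCost n δ)) := by
      rw [List.length_cons, Nat.cast_add, Nat.cast_one]; ring
    rw [hK]
    refine (goodLaw_optimizeBoxed (L := ⟨row A, b, I⟩) hw hδ hδ1 hB (-row A i)).bind_outcome
      fun o ho => ?_
    dsimp only
    split_ifs with hlt
    · obtain ⟨B₁, hB₁⟩ := hB.exists_optimal (L := ⟨row A, b, I⟩) hw hδ ho hlt
      have h0 := ho.coords_natAdd_eq_zero (L := ⟨row A, b, I⟩) hw hδ hB₁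
      have h1 := ho.vertex.basis.sum_castAdd (L := ⟨row A, b, I⟩) h0
      have h2 := ho.vertex.basis.sum_castAdd_mul (L := ⟨row A, b, I⟩) h0
      refine (GoodLaw.dirac ?_).mono (fun _ h => h) le_self_add
      refine ⟨fun j => add_nonneg (ho.coords_nonneg _) (by split_ifs <;> norm_num),
        vecMul_eq_zero ?_, ?_⟩
      · simp only [add_smul, Finset.sum_add_distrib, ite_smul, one_smul, zero_smul,
          Finset.sum_ite_eq', Finset.mem_univ, if_true]
        rw [h1, neg_add_cancel]
      · simp only [dotProduct, add_mul, Finset.sum_add_distrib, ite_mul, one_mul, zero_mul,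
          Finset.sum_ite_eq', Finset.mem_univ, if_true]
        rw [h2, inner_neg_left]
        linarith
    · refine GoodLaw.add (ih _ _ ?_ fun j => ?_) _
      · refine isFeasibleBasis_rayCast (L := ⟨row A, b, insert i I⟩) hB.basis
          (hB.subset.trans (Finset.subset_insert _ _)) fun j hj => ?_
        rcases Finset.mem_insert.1 hj with rfl | hj
        · exact not_lt.1 hlt
        · exact ho.feasible_of_boxed (L := ⟨row A, b, I⟩) hj
      · rcases hI j with h | h
        · exact Or.inl (Finset.mem_insert_of_mem h)
        · rcases List.mem_cons.1 h with rfl | h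
          · exact Or.inl (Finset.mem_insert_self _ _)
          · exact Or.inr h

theorem GlobalDeltaDistance.le_one {A : Matrix (Fin m) (Fin n) ℝ} (hn : 0 < n)
    (hA : A.rank = n) (hδ : 0 < δ) (h : GlobalDeltaDistance δ A) : δ ≤ 1 := by
  have hB := isBasis_greedyBasis (span_range_row hA)
  obtain ⟨i, hi⟩ : (greedyBasis (row A)).Nonempty := by
    rw [← Finset.card_pos, hB.card]; exact hn
  exact h.wide.le_one hδ hB hi

theorem goodLaw_feasibility {A : Matrix (Fin m) (Fin n) ℝ} {b : Fin m → ℝ} (hn : 0 < n)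
    (hA : A.rank = n) (hδ : 0 < δ) (h : GlobalDeltaDistance δ A) :
    GoodLaw (Answer.Correct A b)
      (ENNReal.ofReal (32 * ((m : ℝ) * (n : ℝ) ^ 3 / δ * (1 + Real.log ((n : ℝ) / δ)))))
      (feasibility A b δ) := by
  have hB := isBasis_greedyBasis (span_range_row hA)
  refine (goodLaw_addConstraints h.wide hδ (h.le_one hn hA hδ) (List.finRange m) _ _
    ⟨hB, Finset.Subset.refl _, fun j hj => (hB.inner_solve b hj).le⟩
    fun j => Or.inr (List.mem_finRange j)).mono (fun _ h => h) ?_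
  rw [List.length_finRange, ← ENNReal.ofReal_natCast m, ← ENNReal.ofReal_natCast n,
    ← ENNReal.ofReal_mul (Nat.cast_nonneg _), ← ENNReal.ofReal_mul (Nat.cast_nonneg _), levelCost]
  exact ENNReal.ofReal_le_ofReal (le_of_eq (by ring))

end AddConstraints

/-! ### Integral matrices with bounded subdeterminants -/

section Slack

variable {m n : ℕ}

/-- The coefficient matrix of the system `A x - s ≤ b`, `- s ≤ 0`, for an integral matrix `A`. -/
def slackMatrix (A : Matrix (Fin m) (Fin n) ℤ) : Matrix (Fin (m + 1)) (Fin (n + 1)) ℤ :=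
  Fin.snoc (α := fun _ => Fin (n + 1) → ℤ) (fun i => Fin.snoc (α := fun _ => ℤ) (A i) (-1))
    (Fin.snoc (α := fun _ => ℤ) (fun _ => 0) (-1))

variable {A : Matrix (Fin m) (Fin n) ℤ} {Δ : ℝ}

theorem slackMatrix_castSucc_castSucc (i : Fin m) (j : Fin n) :
    slackMatrix A i.castSucc j.castSucc = A i j := by
  simp [slackMatrix]

theorem slackMatrix_last_castSucc (j : Fin n) : slackMatrix A (Fin.last m) j.castSucc = 0 := by
  simp [slackMatrix]

theorem slackMatrix_last (i : Fin (m + 1)) : slackMatrix A i (Fin.last n) = -1 := by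
  induction i using Fin.lastCases <;> simp [slackMatrix]

theorem one_le_of_minors (hΔ : ∀ (k : ℕ) (f : Fin k → Fin m) (g : Fin k → Fin n),
    |((A.submatrix f g).det : ℝ)| ≤ Δ) : 1 ≤ Δ := by
  simpa using hΔ 0 Fin.elim0 Fin.elim0

/-- Minors of the extended matrix that avoid the last column are minors of `A` or zero. -/
theorem abs_slack_minor_castSucc_le
    (hΔ : ∀ (k : ℕ) (f : Fin k → Fin m) (g : Fin k → Fin n),
      |((A.submatrix f g).det : ℝ)| ≤ Δ) {k : ℕ} (f : Fin k → Fin (m + 1)) (g : Fin k → Fin n) :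
    |(((slackMatrix A).submatrix f fun q => (g q).castSucc).det : ℝ)| ≤ Δ := by
  by_cases h : ∃ p, f p = Fin.last m
  · obtain ⟨p, hp⟩ := h
    rw [Matrix.det_eq_zero_of_row_eq_zero p fun q => by
      rw [Matrix.submatrix_apply, hp, slackMatrix_last_castSucc]]
    simpa using zero_le_one.trans (one_le_of_minors hΔ)
  · push Not at h
    choose f' hf' using fun p => Fin.exists_castSucc_eq.2 (h p)
    have h1 : (slackMatrix A).submatrix f (fun q => (g q).castSucc) = A.submatrix f' g := by
      ext p q
      rw [Matrix.submatrix_apply, Matrix.submatrix_apply, ← hf', slackMatrix_castSucc_castSucc]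
    rw [h1]
    exact hΔ k f' g

/-- Minors that omit one column of the extended matrix: expand along the last column. -/
theorem abs_slack_minor_le (hn : 0 < n)
    (hΔ : ∀ (k : ℕ) (f : Fin k → Fin m) (g : Fin k → Fin n),
      |((A.submatrix f g).det : ℝ)| ≤ Δ) (f : Fin n → Fin (m + 1)) (j : Fin (n + 1)) :
    |(((slackMatrix A).submatrix f j.succAbove).det : ℝ)| ≤ n * Δ := by
  have hΔ1 := one_le_of_minors hΔ
  have hn1 : (1 : ℝ) ≤ n := Nat.one_le_cast.2 hn
  by_cases hj : j = Fin.last n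
  · have h1 : j.succAbove = fun q => Fin.castSucc q := by
      rw [hj]; exact Fin.succAbove_last
    rw [h1]
    refine (abs_slack_minor_castSucc_le hΔ f id).trans ?_
    nlinarith
  obtain ⟨p, hp⟩ := Fin.exists_succAbove_eq (Ne.symm hj)
  obtain ⟨k, rfl⟩ : ∃ k, n = k + 1 := ⟨n - 1, by omega⟩
  rw [Matrix.det_succ_column _ p]
  have hg : ∀ q, j.succAbove (p.succAbove q) ≠ Fin.last (k + 1) := fun q h =>
    Fin.succAbove_ne p q (Fin.succAbove_right_injective (h.trans hp.symm))
  choose g hg' using fun q => Fin.exists_castSucc_eq.2 (hg q)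
  simp only [Int.cast_sum, Int.cast_mul, Int.cast_pow, Int.cast_neg, Int.cast_one]
  refine (Finset.abs_sum_le_sum_abs _ _).trans ?_
  refine (Finset.sum_le_card_nsmul _ _ Δ fun i _ => ?_).trans_eq (by simp)
  have h2 : ((slackMatrix A).submatrix f j.succAbove).submatrix i.succAbove p.succAbove =
      (slackMatrix A).submatrix (fun q => f (i.succAbove q)) fun q => (g q).castSucc := by
    ext r q
    simp only [Matrix.submatrix_apply, hg']
  rw [h2, Matrix.submatrix_apply, hp, slackMatrix_last, Int.cast_neg, Int.cast_one, abs_mul,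
    abs_mul, abs_pow, abs_neg, abs_one, one_pow, one_mul, one_mul]
  exact abs_slack_minor_castSucc_le hΔ (fun q => f (i.succAbove q)) g

variable {b : Fin m → ℝ}

theorem slackSystem_a :
    (slackSystem (A.map (Int.cast : ℤ → ℝ)) b).a =
      row ((slackMatrix A).map (Int.cast : ℤ → ℝ)) := by
  funext i
  ext j
  induction i using Fin.lastCases <;> induction j using Fin.lastCases <;>
    simp [slackSystem, row, slackMatrix, Matrix.map]

theorem norm_le_of_abs_le {N : ℕ} {r : ℝ} {x : EuclideanSpace ℝ (Fin N)} (h : ∀ j, |x j| ≤ r) :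
    ‖x‖ ^ 2 ≤ N * r ^ 2 := by
  rw [EuclideanSpace.norm_sq_eq]
  refine (Finset.sum_le_card_nsmul _ _ (r ^ 2) fun j _ => ?_).trans_eq (by simp)
  rw [Real.norm_eq_abs]
  exact pow_le_pow_left₀ (abs_nonneg _) (h j) 2

/-- By Cramer's rule, the entries of the edges of the extended system are quotients of minors, with
an integral denominator. -/
theorem wide_slackMatrix (hn : 0 < n)
    (hΔ : ∀ (k : ℕ) (f : Fin k → Fin m) (g : Fin k → Fin n),
      |((A.submatrix f g).det : ℝ)| ≤ Δ) :
    Wide (row ((slackMatrix A).map (Int.cast : ℤ → ℝ))) (1 / (((n : ℝ) + 1) * Δ) ^ 2) := by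
  intro B hB i hi
  have hΔ1 := one_le_of_minors hΔ
  have hn0 : (0 : ℝ) ≤ n := Nat.cast_nonneg n
  set E : Matrix (Fin (m + 1)) (Fin (n + 1)) ℝ := (slackMatrix A).map (Int.cast : ℤ → ℝ) with hE
  set e := edge (row E) B i with he
  let f := B.orderEmbOfFin hB.card
  have hf : ∀ p, f p ∈ B := B.orderEmbOfFin_mem hB.card
  obtain ⟨p, hp⟩ : ∃ p, f p = i := by
    have : i ∈ Set.range f := by rw [Finset.range_orderEmbOfFin]; exact hi
    exact this
  have hrange : ∀ k ∈ B, ∃ q, f q = k := fun k hk => by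
    have : k ∈ Set.range f := by rw [Finset.range_orderEmbOfFin]; exact hk
    exact this
  let G : Matrix (Fin (n + 1)) (Fin (n + 1)) ℤ := (slackMatrix A).submatrix f id
  let G' : Matrix (Fin (n + 1)) (Fin (n + 1)) ℝ := G.map (Int.cast : ℤ → ℝ)
  have hdet : G'.det = (G.det : ℝ) := ((Int.castRingHom ℝ).map_det G).symm
  have hmul : ∀ (x : EuclideanSpace ℝ (Fin (n + 1))) q,
      G'.mulVec (WithLp.ofLp x) q = inner ℝ (row E (f q)) x := fun x q => (inner_row _ _).symm
  have hdet0 : G.det ≠ 0 := by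
    intro h
    obtain ⟨v, hv, hv0⟩ := Matrix.exists_mulVec_eq_zero_iff.2
      (show G'.det = 0 by rw [hdet, h, Int.cast_zero])
    refine hv ?_
    have h1 : WithLp.toLp 2 v = (0 : EuclideanSpace ℝ (Fin (n + 1))) :=
      hB.eq_zero_of_inner fun k hk => by
        obtain ⟨q, rfl⟩ := hrange k hk
        rw [← hmul]
        exact congrFun hv0 q
    exact congrArg WithLp.ofLp h1
  have hdet1 : (1 : ℝ) ≤ |(G.det : ℝ)| := by
    exact_mod_cast Int.one_le_abs hdet0
  have hGe : G'.mulVec (WithLp.ofLp e) = Pi.single p (-1) := by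
    funext q
    rw [hmul]
    by_cases hq : q = p
    · rw [hq, hp, hB.inner_edge_self hi, Pi.single_eq_same]
    · rw [hB.inner_edge_of_ne (hf q) fun h => hq (f.injective (h.trans hp.symm)),
        Pi.single_eq_of_ne hq]
  have hcramer : ∀ j, G'.det * e j = -G'.adjugate j p := by
    intro j
    have h1 : G'.adjugate.mulVec (G'.mulVec (WithLp.ofLp e)) = G'.det • WithLp.ofLp e := by
      rw [Matrix.mulVec_mulVec, Matrix.adjugate_mul, Matrix.smul_mulVec, Matrix.one_mulVec]
    rw [hGe, Matrix.mulVec_single] at h1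
    have h2 := congrFun h1 j
    simp at h2
    linarith
  have hadj : ∀ j, |G'.adjugate j p| ≤ n * Δ := by
    intro j
    have h1 : G'.adjugate j p = ((G.adjugate j p : ℤ) : ℝ) := by
      have := (Int.castRingHom ℝ).map_adjugate G
      exact (congrFun (congrFun this j) p).symm
    have h2 : G.submatrix p.succAbove j.succAbove =
      (slackMatrix A).submatrix (fun q => f (p.succAbove q)) j.succAbove := rfl
    rw [h1, Matrix.adjugate_fin_succ_eq_det_submatrix, h2]
    rw [Int.cast_mul, Int.cast_pow, Int.cast_neg, Int.cast_one, abs_mul, abs_pow, abs_neg, abs_one,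
      one_pow, one_mul]
    exact abs_slack_minor_le hn hΔ (fun q => f (p.succAbove q)) j
  have hentry : ∀ j, |e j| ≤ n * Δ := by
    intro j
    calc |e j| ≤ |(G.det : ℝ)| * |e j| := le_mul_of_one_le_left (abs_nonneg _) hdet1
      _ = |G'.adjugate j p| := by rw [← hdet, ← abs_mul, hcramer, abs_neg]
      _ ≤ _ := hadj j
  have hrow : ∀ j, |row E i j| ≤ Δ := by
    intro j
    change |((slackMatrix A i j : ℤ) : ℝ)| ≤ Δ
    induction j using Fin.lastCases with
    | last => rw [slackMatrix_last]; simpa using hΔ1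
    | cast j =>
      have := abs_slack_minor_castSucc_le hΔ (k := 1) (fun _ => i) (fun _ => j)
      rwa [Matrix.det_fin_one] at this
  have h1 := norm_le_of_abs_le hrow
  have h2 := norm_le_of_abs_le hentry
  have h3 : ‖row E i‖ * ‖e‖ ≤ (((n : ℝ) + 1) * Δ) ^ 2 := by
    refine abs_le_of_sq_le_sq' ?_ (by positivity) |>.2
    rw [mul_pow]
    refine (mul_le_mul h1 h2 (sq_nonneg _) (by positivity)).trans ?_
    push_cast
    calc ((n : ℝ) + 1) * Δ ^ 2 * (((n : ℝ) + 1) * (n * Δ) ^ 2)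
        = ((n : ℝ) + 1) ^ 2 * Δ ^ 4 * (n : ℝ) ^ 2 := by ring
      _ ≤ ((n : ℝ) + 1) ^ 2 * Δ ^ 4 * ((n : ℝ) + 1) ^ 2 := by gcongr; linarith
      _ = _ := by ring
  rw [mul_assoc, one_div_mul_eq_div]
  exact div_le_one_of_le₀ h3 (by positivity)

end Slack

/-! ### Minimizing the slack variable -/

section SlackSystem

variable {m n : ℕ} {A : Matrix (Fin m) (Fin n) ℝ} {b : Fin m → ℝ} {δ : ℝ}

theorem inner_slackSystem_castSucc (i : Fin m) (z : EuclideanSpace ℝ (Fin (n + 1))) :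
    inner ℝ ((slackSystem A b).a i.castSucc) z =
      inner ℝ (row A i) (WithLp.toLp 2 fun j => z (Fin.castSucc j)) - z (Fin.last n) := by
  rw [EuclideanSpace.inner_eq_star_dotProduct, EuclideanSpace.inner_eq_star_dotProduct]
  simp only [slackSystem, Fin.snoc_castSucc, star_trivial, dotProduct, row, Fin.sum_univ_castSucc,
    Fin.snoc_last]
  ring

theorem inner_slackSystem_last (z : EuclideanSpace ℝ (Fin (n + 1))) :
    inner ℝ ((slackSystem A b).a (Fin.last m)) z = - z (Fin.last n) := by
  rw [EuclideanSpace.inner_eq_star_dotProduct]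
  simp [slackSystem, dotProduct, Fin.sum_univ_castSucc]

theorem slackSystem_b_castSucc (i : Fin m) : (slackSystem A b).b i.castSucc = b i := by
  simp [slackSystem]

theorem slackSystem_b_last : (slackSystem A b).b (Fin.last m) = 0 := by
  simp [slackSystem]

theorem span_range_slackSystem (hA : A.rank = n) :
    Submodule.span ℝ (Set.range (slackSystem A b).a) = ⊤ := by
  rw [← Submodule.orthogonal_eq_bot_iff, Submodule.eq_bot_iff]
  intro z hz
  have h1 : ∀ i, inner ℝ ((slackSystem A b).a i) z = 0 := fun i =>
    Submodule.inner_right_of_mem_orthogonal (Submodule.subset_span (Set.mem_range_self i)) hz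
  have h2 := h1 (Fin.last m)
  rw [inner_slackSystem_last, neg_eq_zero] at h2
  have h3 : (WithLp.toLp 2 fun j => z (Fin.castSucc j) : EuclideanSpace ℝ (Fin n)) = 0 :=
    (isBasis_greedyBasis (span_range_row hA)).eq_zero_of_inner fun i _ => by
      have := h1 i.castSucc
      rwa [inner_slackSystem_castSucc, h2, sub_zero] at this
  ext j
  induction j using Fin.lastCases with
  | last => exact h2
  | cast j => exact congrFun (congrArg WithLp.ofLp h3) j

/-- The point at which the optimization starts is feasible. -/
theorem slackSystem_start_feasible (j : Fin (m + 1)) :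
    inner ℝ ((slackSystem A b).a j)
      (WithLp.toLp 2 (Fin.snoc (α := fun _ => ℝ) (fun _ => 0) (max 0 (⨆ i, -b i))) :
        EuclideanSpace ℝ (Fin (n + 1))) ≤ (slackSystem A b).b j := by
  induction j using Fin.lastCases with
  | last =>
    rw [inner_slackSystem_last, slackSystem_b_last]
    simp
  | cast i =>
    rw [inner_slackSystem_castSucc, slackSystem_b_castSucc]
    have h1 : -b i ≤ ⨆ i, -b i :=
      le_ciSup (f := fun i => -b i) (Set.finite_range _).bddAbove i
    have h2 : (⨆ i, -b i) ≤ max 0 (⨆ i, -b i) := le_max_right _ _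
    have h3 : (WithLp.toLp 2 fun _ => 0 : EuclideanSpace ℝ (Fin n)) = 0 := rfl
    simp only [Fin.snoc_castSucc, Fin.snoc_last, h3, inner_zero_right]
    linarith

/-- Multipliers of the extended system whose combination of rows is the objective `-s` restrict to a
Farkas certificate if the optimal value is negative. -/
theorem correct_of_slack_multipliers {β : Fin (m + 1) → ℝ} {v : ℝ} (h0 : ∀ q, 0 ≤ β q)
    (h1 : ∑ q, β q • (slackSystem A b).a q = (slackSystem A b).a (Fin.last m))
    (h2 : ∑ q, β q * (slackSystem A b).b q = v) (hv : v < 0) :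
    Answer.Correct A b (.infeasible (n := n) fun j => β j.castSucc) := by
  refine ⟨fun j => h0 _, ?_, ?_⟩
  · funext j
    have h3 := congrFun (congrArg WithLp.ofLp h1) j.castSucc
    rw [WithLp.ofLp_sum, Finset.sum_apply, Fin.sum_univ_castSucc] at h3
    simpa [slackSystem, Matrix.vecMul, dotProduct] using h3
  · rw [Fin.sum_univ_castSucc] at h2
    simp only [slackSystem_b_castSucc, slackSystem_b_last, mul_zero, add_zero] at h2
    rw [dotProduct, h2]
    exact hv

end SlackSystem

section Integral

variable {m n : ℕ} {A : Matrix (Fin m) (Fin n) ℤ} {b : Fin m → ℝ} {Δ : ℝ}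

theorem slack_cost_le (hn : 0 < n) (hΔ : 1 ≤ Δ) :
    ((n + 1 : ℕ) : ℝ) * levelCost (n + 1) (1 / (((n : ℝ) + 1) * Δ) ^ 2) ≤
      4096 * ((n : ℝ) ^ 5 * Δ ^ 2 * (1 + Real.log ((n : ℝ) * Δ))) := by
  have hn1 : (1 : ℝ) ≤ n := Nat.one_le_cast.2 hn
  have hN : (n : ℝ) + 1 ≤ 2 * n := by linarith
  have hΔ0 : 0 < Δ := by linarith
  have hnΔ : 1 ≤ (n : ℝ) * Δ := one_le_mul_of_one_le_of_one_le hn1 hΔ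
  have hlog0 : 0 ≤ Real.log ((n : ℝ) * Δ) := Real.log_nonneg hnΔ
  have hlog2 : Real.log 2 ≤ 1 := by
    have := Real.log_two_lt_d9; linarith
  have hlog : Real.log (((n : ℝ) + 1) ^ 3 * Δ ^ 2) ≤ 3 + 3 * Real.log ((n : ℝ) * Δ) := by
    have h1 : ((n : ℝ) + 1) ^ 3 * Δ ^ 2 ≤ (2 * ((n : ℝ) * Δ)) ^ 3 := by
      calc ((n : ℝ) + 1) ^ 3 * Δ ^ 2 ≤ (2 * n) ^ 3 * Δ ^ 3 := by gcongr; norm_num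
        _ = _ := by ring
    refine (Real.log_le_log (by positivity) h1).trans ?_
    rw [Real.log_pow, Real.log_mul (by norm_num) (by positivity)]
    push_cast
    linarith
  have h5 : ((n : ℝ) + 1) ^ 5 ≤ 32 * (n : ℝ) ^ 5 := by
    calc ((n : ℝ) + 1) ^ 5 ≤ (2 * n) ^ 5 := by gcongr
      _ = _ := by ring
  have h6 : ((n + 1 : ℕ) : ℝ) / (1 / (((n : ℝ) + 1) * Δ) ^ 2) = ((n : ℝ) + 1) ^ 3 * Δ ^ 2 := by
    push_cast
    field_simp
  have h7 : ((n + 1 : ℕ) : ℝ) ^ 2 / (1 / (((n : ℝ) + 1) * Δ) ^ 2) =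
      ((n : ℝ) + 1) ^ 4 * Δ ^ 2 := by
    push_cast
    field_simp
  rw [levelCost, h6, h7]
  push_cast
  calc ((n : ℝ) + 1) * (32 * (((n : ℝ) + 1) ^ 4 * Δ ^ 2 *
        (1 + Real.log (((n : ℝ) + 1) ^ 3 * Δ ^ 2))))
      = 32 * (((n : ℝ) + 1) ^ 5 * Δ ^ 2 * (1 + Real.log (((n : ℝ) + 1) ^ 3 * Δ ^ 2))) := by ring
    _ ≤ 32 * (((n : ℝ) + 1) ^ 5 * Δ ^ 2 * (4 * (1 + Real.log ((n : ℝ) * Δ)))) := by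
        gcongr; linarith
    _ ≤ 32 * (32 * (n : ℝ) ^ 5 * Δ ^ 2 * (4 * (1 + Real.log ((n : ℝ) * Δ)))) := by gcongr
    _ = _ := by ring

theorem goodLaw_integralFeasibility (hn : 0 < n) (hA : (A.map (Int.cast : ℤ → ℝ)).rank = n)
    (hΔ : ∀ (k : ℕ) (f : Fin k → Fin m) (g : Fin k → Fin n),
      |((A.submatrix f g).det : ℝ)| ≤ Δ) :
    GoodLaw (Answer.Correct (A.map (Int.cast : ℤ → ℝ)) b)
      (ENNReal.ofReal (4096 * ((n : ℝ) ^ 5 * Δ ^ 2 * (1 + Real.log ((n : ℝ) * Δ)))))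
      (integralFeasibility A b Δ) := by
  have hΔ1 := one_le_of_minors hΔ
  have hn0 : (0 : ℝ) ≤ n := Nat.cast_nonneg n
  have hNΔ : 1 ≤ ((n : ℝ) + 1) * Δ := one_le_mul_of_one_le_of_one_le (by linarith) hΔ1
  have hδ : 0 < 1 / (((n : ℝ) + 1) * Δ) ^ 2 := by positivity
  have hδ1 : 1 / (((n : ℝ) + 1) * Δ) ^ 2 ≤ 1 :=
    div_le_one_of_le₀ (one_le_pow₀ hNΔ) (by positivity)
  have hw : Wide (slackSystem (A.map (Int.cast : ℤ → ℝ)) b).a (1 / (((n : ℝ) + 1) * Δ) ^ 2) := by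
    rw [slackSystem_a]; exact wide_slackMatrix hn hΔ
  rw [integralFeasibility]
  dsimp only
  generalize A.map (Int.cast : ℤ → ℝ) = A' at hA hw ⊢
  obtain ⟨B₀, hB₀⟩ : ∃ B₀, B₀ = rayCast (slackSystem A' b) (WithLp.toLp 2
      (Fin.snoc (α := fun _ => ℝ) (fun _ => 0) (max 0 (⨆ i, -b i)))) := ⟨_, rfl⟩
  have hB := isFeasibleBasis_rayCast (L := slackSystem A' b)
    (isBasis_greedyBasis (span_range_slackSystem hA)) (Finset.subset_univ _)
    (fun j _ => slackSystem_start_feasible j)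
  have hd : (WithLp.toLp 2 (Fin.snoc (α := fun _ => ℝ) (fun _ => 0) (-1)) :
      EuclideanSpace ℝ (Fin (n + 1))) = (slackSystem A' b).a (Fin.last m) := by
    simp [slackSystem]
  rw [hd]
  rw [← hB₀] at hB ⊢
  have hopt : ∃ B₁, IsOptimal (slackSystem A' b) B₀ ∅ ((slackSystem A' b).a (Fin.last m)) B₁ := by
    rcases hB.isVertex.exists_optimal_or_ray ((slackSystem A' b).a (Fin.last m)) with h | ⟨z, hz, h⟩
    · exact h
    · exact absurd (hz _ (Finset.mem_univ _)) (not_le.2 h)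
  obtain ⟨B₁, hB₁⟩ := hopt
  refine ((goodLaw_optimizeBoxed hw hδ hδ1 hB _).bind_outcome (K' := 0) fun o ho => ?_).mono
    (fun _ h => h) ?_
  · split_ifs with hz
    · have h0 := ho.coords_natAdd_eq_zero hw hδ hB₁
      refine (GoodLaw.dirac ?_).mono (fun _ h => h) le_self_add
      refine correct_of_slack_multipliers (fun q => ho.coords_nonneg _)
        (ho.vertex.basis.sum_castAdd h0) (ho.vertex.basis.sum_castAdd_mul h0) ?_
      rw [inner_slackSystem_last]
      linarith
    · refine (GoodLaw.dirac ?_).mono (fun _ h => h) le_self_add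
      refine (isFeasibleBasis_rayCast (L := ⟨row A', b, Finset.univ⟩)
        (isBasis_greedyBasis (span_range_row hA)) (Finset.subset_univ _)
        fun i _ => ?_).correct fun i => Finset.mem_univ i
      have h1 := ho.feasible_of_boxed (j := i.castSucc) (Finset.mem_univ _)
      rw [inner_slackSystem_castSucc, slackSystem_b_castSucc] at h1
      linarith
  · rw [add_zero, ← ENNReal.ofReal_natCast, ← ENNReal.ofReal_mul (Nat.cast_nonneg _)]
    exact ENNReal.ofReal_le_ofReal (slack_cost_le hn hΔ1)

end Integral

end ShadowSimplex

theorem mainTheorem4 :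
    ∃ C : ℝ, 0 < C ∧
      (∀ (n m : ℕ) (A : Matrix (Fin m) (Fin n) ℝ) (b : Fin m → ℝ) (δ : ℝ),
        0 < n → A.rank = n → 0 < δ → ShadowSimplex.GlobalDeltaDistance δ A →
          MeasureTheory.IsProbabilityMeasure (ShadowSimplex.feasibility A b δ) ∧
          (∀ᵐ o ∂(ShadowSimplex.feasibility A b δ), o.result.Correct A b) ∧
          ∫⁻ o, (o.pivots : ENNReal) ∂(ShadowSimplex.feasibility A b δ) ≤
            ENNReal.ofReal (C * ((m : ℝ) * (n : ℝ) ^ 3 / δ * (1 + Real.log ((n : ℝ) / δ))))) ∧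
      (∀ (n m : ℕ) (A : Matrix (Fin m) (Fin n) ℤ) (b : Fin m → ℝ) (Δ : ℝ),
        0 < n → (A.map (Int.cast : ℤ → ℝ)).rank = n →
        (∀ (k : ℕ) (f : Fin k → Fin m) (g : Fin k → Fin n),
          |((A.submatrix f g).det : ℝ)| ≤ Δ) →
          MeasureTheory.IsProbabilityMeasure (ShadowSimplex.integralFeasibility A b Δ) ∧
          (∀ᵐ o ∂(ShadowSimplex.integralFeasibility A b Δ),
            o.result.Correct (A.map (Int.cast : ℤ → ℝ)) b) ∧
          ∫⁻ o, (o.pivots : ENNReal) ∂(ShadowSimplex.integralFeasibility A b Δ) ≤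
            ENNReal.ofReal
              (C * ((n : ℝ) ^ 5 * Δ ^ 2 * (1 + Real.log ((n : ℝ) * Δ))))) := by
  refine ⟨4096, by norm_num, fun n m A b δ hn hA hδ h => ?_, fun n m A b Δ hn hA hΔ => ?_⟩
  · have hn1 : (1 : ℝ) ≤ n := Nat.one_le_cast.2 hn
    have hlog : 0 ≤ Real.log ((n : ℝ) / δ) :=
      Real.log_nonneg ((one_le_div hδ).2 ((h.le_one hn hA hδ).trans hn1))
    have h1 := ShadowSimplex.goodLaw_feasibility (b := b) hn hA hδ h
    refine ⟨h1.prob, h1.correct, h1.cost.trans (ENNReal.ofReal_le_ofReal ?_)⟩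
    gcongr
    norm_num
  · have h1 := ShadowSimplex.goodLaw_integralFeasibility (b := b) hn hA hΔ
    exact ⟨h1.prob, h1.correct, h1.cost⟩
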